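/- Let $d\ge 1$, let $\Omega\subset\mathbb{R}^d$ be a bounded domain with Lipschitz boundary $\Gamma$, and let $S$ be the surface measure on $\Gamma$. Let $Q$ be a field of real symmetric, uniformly positive definite $d\times d$ matrices of class $C^{1,1}$ on an open superset of $\overline\Omega$. Let $\alpha\in L^\infty(\Omega,\mathbb{R})$ and $\beta,\gamma,\delta\in L^\infty(\Gamma,\mathbb{R})$ with $\alpha\ge\eta$ a.e. on $\Omega$ and $\beta\ge\eta$ a.e. on $\Gamma$ for some constant $\eta>0$, and with $\delta\ge 0$ a.e. on $\Gamma$. All function spaces are complex unless marked otherwise, and $\operatorname{tr}\colon H^1(\Omega)\to L^2(\Gamma)$ is the trace. Let $B$ be the operator on $L^2(\Omega)$ associated with the form $$\mathfrak b(u,v)=\int_\Omega Q\nabla u\cdot\overline{\nabla v}\,dx+\int_\Gamma \delta\,\operatorname{tr}u\,\overline{\operatorname{tr}v}\,dS,\qquad u,v\in H^1(\Omega),$$ i.e. the realization of $-\operatorname{div}Q\nabla$ with boundary condition $\partial_\nu^Q u+\delta\operatorname{tr}u=0$ (Neumann if $\delta=0$, Robin in general). Let $\mathcal H=L^2(\Omega)\times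 L^2(\Gamma,\beta^{-1}dS)$, and let $\mathcal A$ be the operator on $\mathcal H$ associated with the form $$\mathfrak a(\mathcal u,\mathcal v)=\int_\Omega\alpha\,Bu_1\,\overline{Bv_1}\,dx+\int_\Gamma\gamma\,u_2\,\overline{v_2}\,\beta^{-1}dS$$ with domain $D(\mathfrak a)=\{\mathcal u=(u_1,u_2)\in\mathcal H: u_1\in D(B),\ u_2=\operatorname{tr}u_1\}$. That is, $\mathcal u\in D(\mathcal A)$ and $\mathcal A\mathcal u=f$ if and only if $\mathcal u\in D(\mathfrak a)$ and $\mathfrak a(\mathcal u,\mathcal v)=\langle f,\mathcal v\rangle_{\mathcal H}$ for all $\mathcal v\in D(\mathfrak a)$. Suppose that $\gamma\ge 0$ a.e. on $\Gamma$. Then $-\mathcal A$ generates a unique strongly continuous semigroup $(\mathcal T(t))_{t\ge0}$ on $\mathcal H$. This semigroup is real (each $\mathcal T(t)$ maps real-valued elements of $\mathcal H$ to real-valued ones). It is not positive (it is not the case that every $\mathcal T(t)$ maps a.e. nonnegative elements to a.e. nonnegative elements), and it is not $L^\infty$-contractive (it is not the case that $\|\mathcal T(t)f\|_\infty\le\|f\|_\infty$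 for all $t\ge0$ and all essentially bounded $f\in\mathcal H$, where $\|(f_1,f_2)\|_\infty=\max(\|f_1\|_{L^\infty(\Omega)},\|f_2\|_{L^\infty(\Gamma)})$). -/

import Mathlib

open MeasureTheory Filter Topology Set
open scoped ENNReal NNReal ContDiff

namespace Wentzell

noncomputable section

/-- `ℝ^d` with its Euclidean norm. -/
abbrev Sp (d : ℕ) : Type := EuclideanSpace ℝ (Fin d)

/-! ### Lipschitz domains and their surface measure -/

/-- The boundary of `Ω` is Lipschitz: near every boundary point `Ω` is, after a choice of a unit
vector `e` as vertical direction, the strict epigraph of a Lipschitz function `ψ` of the horizontal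
component `x - ⟪e, x⟫ e`. -/
def HasLipschitzBoundary {d : ℕ} (Ω : Set (Sp d)) : Prop :=
  ∀ p ∈ frontier Ω, ∃ e : Sp d, ‖e‖ = 1 ∧ ∃ (K : ℝ≥0) (ψ : Sp d → ℝ), LipschitzWith K ψ ∧
    ∃ U ∈ 𝓝 p, ∀ x ∈ U, (x ∈ Ω ↔ ψ (x - inner ℝ e x • e) < inner ℝ e x)

/-- A bounded domain (nonempty, open, connected) with Lipschitz boundary. -/
structure IsBoundedLipschitzDomain {d : ℕ} (Ω : Set (Sp d)) : Prop where
  isOpen : IsOpen Ω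
  isConnected : IsConnected Ω
  isBounded : Bornology.IsBounded Ω
  lipschitz : HasLipschitzBoundary Ω

/-- Lebesgue measure on `Ω`. -/
def vol {d : ℕ} (Ω : Set (Sp d)) : Measure (Sp d) := volume.restrict Ω

/-- The surface measure `dS` on `Γ = ∂Ω`: the `(d-1)`-dimensional Hausdorff measure, normalized so
that it agrees with Lebesgue measure on `(d-1)`-dimensional planes. -/
def surf {d : ℕ} (Ω : Set (Sp d)) : Measure (Sp d) :=
  (Measure.euclideanHausdorffMeasure (d - 1) : Measure (Sp d)).restrict (frontier Ω)

/-- The weighted surface measure `β⁻¹ dS` on `Γ`. -/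
def wsurf {d : ℕ} (Ω : Set (Sp d)) (β : Sp d → ℝ) : Measure (Sp d) :=
  (surf Ω).withDensity fun x => ENNReal.ofReal (β x)⁻¹

/-! ### The coefficients -/

/-- `Q` is a real symmetric, uniformly positive definite matrix field of class `C^{1,1}` on an open
superset of `closure Ω`. -/
def IsEllipticCoeff {d : ℕ} (Ω : Set (Sp d)) (Q : Sp d → Matrix (Fin d) (Fin d) ℝ) : Prop :=
  ∃ U : Set (Sp d), IsOpen U ∧ closure Ω ⊆ U ∧
    (∀ i j, ContDiffOn ℝ 1 (fun x => Q x i j) U ∧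
      ∃ K : ℝ≥0, LipschitzOnWith K (fderiv ℝ fun x => Q x i j) U) ∧
    (∀ x ∈ U, (Q x).IsSymm) ∧
    ∃ κ : ℝ, 0 < κ ∧ ∀ x ∈ U, ∀ ξ : Fin d → ℝ, κ * ∑ i, ξ i ^ 2 ≤ ξ ⬝ᵥ (Q x).mulVec ξ

/-- `α ∈ L^∞(Ω, ℝ)` and `β, γ, δ ∈ L^∞(Γ, ℝ)`, where `α` and `β` are bounded below by a positive
constant and `δ ≥ 0` (almost everywhere). -/
structure IsAdmissibleCoeff {d : ℕ} (Ω : Set (Sp d)) (α β γ δ : Sp d → ℝ) : Prop where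
  memα : MemLp α ∞ (vol Ω)
  memβ : MemLp β ∞ (surf Ω)
  memγ : MemLp γ ∞ (surf Ω)
  memδ : MemLp δ ∞ (surf Ω)
  lower : ∃ η : ℝ, 0 < η ∧ (∀ᵐ x ∂vol Ω, η ≤ α x) ∧ ∀ᵐ x ∂surf Ω, η ≤ β x
  nonnegδ : ∀ᵐ x ∂surf Ω, 0 ≤ δ x

/-! ### Sobolev functions and traces -/

/-- The `i`-th classical partial derivative. -/
def partialDeriv {d : ℕ} {F : Type*} [NormedAddCommGroup F] [NormedSpace ℝ F]
    (i : Fin d) (φ : Sp d → F) (x : Sp d) : F :=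
  fderiv ℝ φ x (EuclideanSpace.single i 1)

/-- `u ∈ H¹(Ω)` with weak gradient `G`. -/
structure HasWeakGradient {d : ℕ} (Ω : Set (Sp d)) (u : Sp d → ℂ) (G : Fin d → Sp d → ℂ) :
    Prop where
  memLp : MemLp u 2 (vol Ω)
  memLp_grad : ∀ i, MemLp (G i) 2 (vol Ω)
  weak : ∀ (i : Fin d) (φ : Sp d → ℝ), ContDiff ℝ ∞ φ → HasCompactSupport φ → tsupport φ ⊆ Ω →
    ∫ x, ((partialDeriv i φ x : ℝ) : ℂ) * u x ∂vol Ω = -∫ x, ((φ x : ℝ) : ℂ) * G i x ∂vol Ω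

/-- `g = tr u ∈ L²(Γ)` for `u ∈ H¹(Ω)`: the trace is the extension by continuity of the restriction
map `φ ↦ φ|_Γ` from `C^∞(closure Ω)` (restrictions of smooth functions on `ℝ^d`) to `H¹(Ω)`. -/
def HasTrace {d : ℕ} (Ω : Set (Sp d)) (u g : Sp d → ℂ) : Prop :=
  MemLp g 2 (surf Ω) ∧ ∃ G, HasWeakGradient Ω u G ∧ ∃ φ : ℕ → Sp d → ℂ,
    (∀ n, ContDiff ℝ ∞ (φ n)) ∧
    Tendsto (fun n => eLpNorm (φ n - u) 2 (vol Ω)) atTop (𝓝 0) ∧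
    (∀ i, Tendsto (fun n => eLpNorm (partialDeriv i (φ n) - G i) 2 (vol Ω)) atTop (𝓝 0)) ∧
    Tendsto (fun n => eLpNorm (φ n - g) 2 (surf Ω)) atTop (𝓝 0)

/-! ### The second-order operator `B_{N,δ}` -/

/-- The subsidiary form `b_δ(u, v) = ⟨Q ∇u, ∇v⟩_Ω + ⟨δ tr u, tr v⟩_Γ`, in terms of the gradients
`G, G'` and the traces `g, g'` of `u, v`. -/
def subForm {d : ℕ} (Ω : Set (Sp d)) (Q : Sp d → Matrix (Fin d) (Fin d) ℝ) (δ : Sp d → ℝ)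
    (G : Fin d → Sp d → ℂ) (g : Sp d → ℂ) (G' : Fin d → Sp d → ℂ) (g' : Sp d → ℂ) : ℂ :=
  ∫ x, ∑ i, ∑ j, (Q x i j : ℂ) * G j x * star (G' i x) ∂vol Ω +
    ∫ x, (δ x : ℂ) * g x * star (g' x) ∂surf Ω

/-- The graph of the operator `B_{N,δ}` on `L²(Ω)` associated with the form `b_δ` on `H¹(Ω)`, i.e.
of the realization of `-div Q∇` with boundary condition `∂_ν^Q u + δ tr u = 0`:
`u ∈ D(B_{N,δ})` and `B_{N,δ} u = w` iff `u ∈ H¹(Ω)`, `w ∈ L²(Ω)` and `b_δ(u, v) = ⟨w, v⟩_Ω` for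
all `v ∈ H¹(Ω)`. -/
def IsB {d : ℕ} (Ω : Set (Sp d)) (Q : Sp d → Matrix (Fin d) (Fin d) ℝ) (δ : Sp d → ℝ)
    (u w : Sp d → ℂ) : Prop :=
  MemLp w 2 (vol Ω) ∧ ∃ G g, HasWeakGradient Ω u G ∧ HasTrace Ω u g ∧
    ∀ v G' g', HasWeakGradient Ω v G' → HasTrace Ω v g' →
      subForm Ω Q δ G g G' g' = ∫ x, w x * star (v x) ∂vol Ω

/-! ### The fourth-order operator `𝒜` on the product space -/

/-- The Hilbert space `ℋ = L²(Ω) × L²(Γ, β⁻¹ dS)`, with complex scalars. -/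
abbrev HSpace {d : ℕ} (Ω : Set (Sp d)) (β : Sp d → ℝ) : Type :=
  WithLp 2 (Lp ℂ 2 (vol Ω) × Lp ℂ 2 (wsurf Ω β))

/-- `u = (u₁, u₂) ∈ D(𝔞)`, i.e. `u₁ ∈ D(B_{N,δ})` and `u₂ = tr u₁`, and `w = B_{N,δ} u₁`. -/
def InFormDomain {d : ℕ} (Ω : Set (Sp d)) (Q : Sp d → Matrix (Fin d) (Fin d) ℝ)
    (β δ : Sp d → ℝ) (u : HSpace Ω β) (w : Sp d → ℂ) : Prop :=
  IsB Ω Q δ u.fst w ∧ HasTrace Ω u.fst u.snd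

/-- The primary form
`𝔞(u, v) = ⟨α B_{N,δ} u₁, B_{N,δ} v₁⟩_Ω + ⟨γ u₂, v₂⟩_{Γ,β}` with `w = B_{N,δ} u₁` and
`z = B_{N,δ} v₁`. -/
def primForm {d : ℕ} (Ω : Set (Sp d)) (α β γ : Sp d → ℝ)
    (u : HSpace Ω β) (w : Sp d → ℂ) (v : HSpace Ω β) (z : Sp d → ℂ) : ℂ :=
  ∫ x, (α x : ℂ) * w x * star (z x) ∂vol Ω +
    ∫ x, (γ x : ℂ) * u.snd x * star (v.snd x) ∂wsurf Ω β

/-- The graph of the operator `𝒜` on `ℋ` associated with the form `𝔞`: `u ∈ D(𝒜)` and `𝒜 u = f` iff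
`u ∈ D(𝔞)` and `𝔞(u, v) = ⟨f, v⟩_ℋ` for all `v ∈ D(𝔞)`.
(Mathlib's `inner ℂ v f` is linear in `f` and conjugate-linear in `v`.) -/
def IsA {d : ℕ} (Ω : Set (Sp d)) (Q : Sp d → Matrix (Fin d) (Fin d) ℝ) (α β γ δ : Sp d → ℝ)
    (u f : HSpace Ω β) : Prop :=
  ∃ w, InFormDomain Ω Q β δ u w ∧
    ∀ v z, InFormDomain Ω Q β δ v z → primForm Ω α β γ u w v z = inner ℂ v f

/-! ### Strongly continuous semigroups -/

/-- `T` is a strongly continuous semigroup of bounded operators. -/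
structure IsC0Semigroup {H : Type*} [NormedAddCommGroup H] [NormedSpace ℂ H]
    (T : ℝ≥0 → H →L[ℂ] H) : Prop where
  map_zero : T 0 = 1
  map_add : ∀ s t, T (s + t) = T s * T t
  continuous : ∀ u, Continuous fun t => T t u

/-- `T` is a strongly continuous semigroup whose generator is the operator `L` given by its graph:
`u ∈ D(L)` and `L u = f` iff `(T(t) u - u) / t → f` as `t ↓ 0`. -/
def IsGeneratedBy {H : Type*} [NormedAddCommGroup H] [NormedSpace ℂ H]
    (T : ℝ≥0 → H →L[ℂ] H) (L : H → H → Prop) : Prop :=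
  IsC0Semigroup T ∧ ∀ u f, L u f ↔
    Tendsto (fun t : ℝ≥0 => ((t : ℝ) : ℂ)⁻¹ • (T t u - u)) (𝓝[>] 0) (𝓝 f)

/-- `T` is a semigroup generated by `-𝒜`. -/
def IsGeneratedByNegA {d : ℕ} (Ω : Set (Sp d)) (Q : Sp d → Matrix (Fin d) (Fin d) ℝ)
    (α β γ δ : Sp d → ℝ) (T : ℝ≥0 → HSpace Ω β →L[ℂ] HSpace Ω β) : Prop :=
  IsGeneratedBy T fun u f => IsA Ω Q α β γ δ u (-f)

/-! ### Real, positive and `L^∞`-contractive semigroups on `ℋ` -/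

/-- `f ∈ ℋ` is real-valued almost everywhere. -/
def IsRealElt {d : ℕ} {Ω : Set (Sp d)} {β : Sp d → ℝ} (f : HSpace Ω β) : Prop :=
  (∀ᵐ x ∂vol Ω, (f.fst x).im = 0) ∧ ∀ᵐ x ∂wsurf Ω β, (f.snd x).im = 0

/-- `f ∈ ℋ` is real-valued and nonnegative almost everywhere. -/
def IsNonnegElt {d : ℕ} {Ω : Set (Sp d)} {β : Sp d → ℝ} (f : HSpace Ω β) : Prop :=
  (∀ᵐ x ∂vol Ω, (f.fst x).im = 0 ∧ 0 ≤ (f.fst x).re) ∧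
    ∀ᵐ x ∂wsurf Ω β, (f.snd x).im = 0 ∧ 0 ≤ (f.snd x).re

/-- The norm of `f` in `L^∞(Ω ⊔ Γ)`, which is `∞` if `f` is not essentially bounded. -/
def linfNorm {d : ℕ} {Ω : Set (Sp d)} {β : Sp d → ℝ} (f : HSpace Ω β) : ℝ≥0∞ :=
  max (eLpNorm f.fst ∞ (vol Ω)) (eLpNorm f.snd ∞ (wsurf Ω β))

/-- Every `T(t)` maps real-valued elements to real-valued elements. -/
def IsRealSemigroup {d : ℕ} {Ω : Set (Sp d)} {β : Sp d → ℝ}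
    (T : ℝ≥0 → HSpace Ω β →L[ℂ] HSpace Ω β) : Prop :=
  ∀ t f, IsRealElt f → IsRealElt (T t f)

/-- Every `T(t)` maps nonnegative elements to nonnegative elements. -/
def IsPositiveSemigroup {d : ℕ} {Ω : Set (Sp d)} {β : Sp d → ℝ}
    (T : ℝ≥0 → HSpace Ω β →L[ℂ] HSpace Ω β) : Prop :=
  ∀ t f, IsNonnegElt f → IsNonnegElt (T t f)

/-- `‖T(t) f‖_∞ ≤ ‖f‖_∞` for all `t ≥ 0` and all `f ∈ ℋ` (equivalently: all bounded `f ∈ ℋ`). -/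
def IsLinfContractive {d : ℕ} {Ω : Set (Sp d)} {β : Sp d → ℝ}
    (T : ℝ≥0 → HSpace Ω β →L[ℂ] HSpace Ω β) : Prop :=
  ∀ t f, linfNorm (T t f) ≤ linfNorm f

end

end Wentzell

/-!
The operator `𝒜` is nonnegative and self-adjoint, so `-𝒜` generates the semigroup `exp (-t 𝒜)`,
and everything else is read off from the form domain `D(𝔞)`.

*Generation.* The Sobolev space `sobolev Ω` is the closure of the triples `(φ, ∇φ, φ|_Γ)`, with
`φ` smooth, in a product of `L²` spaces. The trace inequality (`exists_trace_bound`), proved in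
Lipschitz charts with the fundamental theorem of calculus on lines transversal to the boundary,
shows that such a triple is determined by its first entry (`sobFun_injective`). So `H¹(Ω)`, the
trace and `B` are described by bounded operators on Hilbert spaces, and `D(𝔞)` is the Hilbert
space `FormData.FormSpace` of all `(u, B u)`. The form `𝔞` plus the inner product of `ℋ` is
coercive on it because of `α ≥ η`, of `γ ≥ 0` and of the Gårding inequality for `𝔟`; the form
domain is dense in `ℋ` (`FormData.denseRange_formEmb`). The Lax-Milgram lemma provides the
resolvent `R = (1 + 𝒜)⁻¹` (`FormData.exists_isResolvent`). The semigroup is the function `r ↦ exp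
(-t (r⁻¹ - 1))` of `R` in the sense of the continuous functional calculus (`heatSemigroup`), and
uniqueness follows from dissipativity (`IsResolvent.existsUnique_isGeneratedBy`).

*Reality.* Complex conjugation maps the graph of `𝒜` to itself, so the conjugate of the semigroup
has the same generator and hence is the same semigroup (`IsResolvent.heatSemigroup_conj`).

*Failure of positivity and of `L^∞`-contractivity.* The form domain consists of the vectors `u`
for which `⟨u - exp (-t 𝒜) u, u⟩ / t` is bounded. By the argument of Beurling, Deny and Ouhabaz,
it is therefore mapped to itself by the projection onto any closed convex set that the semigroup
leaves invariant (`IsResolvent.isFormBounded_of_invariant`). For a positive semigroup, the form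
domain would be stable under `u ↦ max u 0`, and for an `L^∞`-contractive one under `u ↦ min u 1`
for `u ≥ 0`. But `D(𝔞)` contains the smooth functions with compact support in `Ω`
(`FormData.exists_formSpace_of_contDiff`), while it contains no function that looks like `c + b |y
i - x i|` with `b ≠ 0` near an interior point `x`, because the distribution `div Q∇` of such a
function charges a hyperplane (`FormData.kink_eq_zero`).
-/

namespace Wentzell

open scoped InnerProductSpace

noncomputable section

/-! ### The semigroup of a nonnegative self-adjoint operator -/

/-- The function `r ↦ exp (-t (r⁻¹ - 1))` on `[0, 1]`, extended continuously to `ℝ`. If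
`R = (1 + A)⁻¹`, then `heatFun t` applied to `R` is `exp (-t A)`. -/
def heatFun (t : ℝ≥0) (r : ℝ) : ℝ :=
  if t = 0 then 1 else Real.exp t * expNegInvGlue (r / t)

/-- The continuous extension of `heatFun t r / r`, for `t ≠ 0`. -/
def heatFunDiv (t : ℝ≥0) (r : ℝ) : ℝ :=
  Real.exp t * (r⁻¹ * expNegInvGlue (r / t))

lemma continuous_heatFun (t : ℝ≥0) : Continuous (heatFun t) := by
  unfold heatFun
  split_ifs
  · exact continuous_const
  · have h : Continuous expNegInvGlue := (expNegInvGlue.contDiff (n := 0)).continuous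
    fun_prop

lemma continuous_heatFunDiv {t : ℝ≥0} (ht : t ≠ 0) : Continuous (heatFunDiv t) := by
  have h := expNegInvGlue.continuous_polynomial_eval_inv_mul Polynomial.X
  have h2 : heatFunDiv t = fun r => Real.exp t * (t : ℝ)⁻¹ *
      ((fun x => Polynomial.eval x⁻¹ (Polynomial.X : Polynomial ℝ) * expNegInvGlue x)
        (r / t)) := by
    funext r
    have : (t : ℝ) ≠ 0 := by exact_mod_cast ht
    simp only [heatFunDiv, Polynomial.eval_X]
    field_simp
  rw [h2]
  exact continuous_const.mul (h.comp (continuous_id.div_const _))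

lemma heatFun_of_pos (t : ℝ≥0) {r : ℝ} (hr : 0 < r) :
    heatFun t r = Real.exp (-(t * (r⁻¹ - 1))) := by
  unfold heatFun
  split_ifs with h
  · simp [h]
  · have ht : 0 < (t : ℝ) := by exact_mod_cast pos_iff_ne_zero.2 h
    have : ¬ (r / t ≤ 0) := not_le.2 (div_pos hr ht)
    rw [expNegInvGlue, if_neg this, ← Real.exp_add]
    congr 1
    field_simp
    ring

lemma heatFun_zero_left (r : ℝ) : heatFun 0 r = 1 := by simp [heatFun]

lemma heatFun_zero_right {t : ℝ≥0} (ht : t ≠ 0) : heatFun t 0 = 0 := by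
  simp [heatFun, ht, expNegInvGlue.zero]

lemma heatFun_add (s t : ℝ≥0) {r : ℝ} (hr : 0 ≤ r) :
    heatFun (s + t) r = heatFun s r * heatFun t r := by
  rcases hr.eq_or_lt with rfl | hr
  · rcases eq_or_ne s 0 with rfl | hs
    · simp [heatFun_zero_left]
    · have : s + t ≠ 0 := by simp [hs]
      simp [heatFun_zero_right, hs, this]
  · rw [heatFun_of_pos _ hr, heatFun_of_pos _ hr, heatFun_of_pos _ hr, ← Real.exp_add]
    congr 1
    push_cast
    ring

lemma heatFun_nonneg (t : ℝ≥0) (r : ℝ) : 0 ≤ heatFun t r := by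
  unfold heatFun
  split_ifs
  · exact zero_le_one
  · exact mul_nonneg (Real.exp_pos _).le (expNegInvGlue.nonneg _)

lemma heatFun_le_one (t : ℝ≥0) {r : ℝ} (hr : r ∈ Icc (0 : ℝ) 1) : heatFun t r ≤ 1 := by
  rcases hr.1.eq_or_lt with rfl | h
  · rcases eq_or_ne t 0 with rfl | ht
    · simp [heatFun_zero_left]
    · simp [heatFun_zero_right ht]
  · rw [heatFun_of_pos _ h, Real.exp_le_one_iff]
    have : 1 ≤ r⁻¹ := (one_le_inv₀ h).2 hr.2
    have := mul_nonneg t.coe_nonneg (sub_nonneg.2 this)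
    linarith [this]

/-- Together with the two bounds below, this expresses how smoothly `t ↦ exp (-t A)` behaves on the
ranges of `R` and of `R ^ 2`, where `r` stands for `R = (1 + A)⁻¹`. -/
lemma mul_one_sub_heatFun_le (t : ℝ≥0) {r : ℝ} (hr : r ∈ Icc (0 : ℝ) 1) :
    r * (1 - heatFun t r) ≤ t := by
  rcases hr.1.eq_or_lt with rfl | h
  · simp
  · rw [heatFun_of_pos _ h]
    have h1 := Real.add_one_le_exp (-(t * (r⁻¹ - 1)))
    have h2 : r * r⁻¹ = 1 := mul_inv_cancel₀ h.ne'
    have h3 : r * (t * (r⁻¹ - 1)) = t * (1 - r) := by linear_combination t * h2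
    have h4 : r * (1 - Real.exp (-(t * (r⁻¹ - 1)))) ≤ r * (t * (r⁻¹ - 1)) := by
      gcongr
      linarith
    have h5 : (t : ℝ) * (1 - r) ≤ t * 1 := by gcongr; linarith [hr.1]
    linarith

lemma abs_mul_heatFun_sub_le (s t : ℝ≥0) {r : ℝ} (hr : r ∈ Icc (0 : ℝ) 1) :
    |r * (heatFun t r - heatFun s r)| ≤ |(t : ℝ) - s| := by
  wlog hst : s ≤ t generalizing s t
  · have := this t s (le_of_not_ge hst)
    rw [abs_sub_comm (t : ℝ) s]
    convert this using 1
    rw [← abs_neg]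
    congr 1
    ring
  obtain ⟨u, rfl⟩ := exists_add_of_le hst
  rw [heatFun_add _ _ hr.1]
  have h1 := mul_one_sub_heatFun_le u hr
  have h2 := heatFun_le_one u hr
  have h3 := heatFun_le_one s hr
  have h4 := heatFun_nonneg s r
  have h5 : r * (heatFun s r * heatFun u r - heatFun s r) =
    -(heatFun s r * (r * (1 - heatFun u r))) := by ring
  have h6 : 0 ≤ r * (1 - heatFun u r) := mul_nonneg hr.1 (by linarith)
  rw [h5, abs_neg, abs_of_nonneg (mul_nonneg h4 h6)]
  have : ((s + u : ℝ≥0) : ℝ) - s = u := by push_cast; ring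
  rw [this]
  refine le_trans ?_ (le_abs_self _)
  calc heatFun s r * (r * (1 - heatFun u r)) ≤ 1 * (r * (1 - heatFun u r)) := by gcongr
    _ ≤ u := by linarith

/-- The second-order Taylor expansion in `t` at `0`; note that `r (1 - r)` is `r ^ 2 (r⁻¹ - 1)`. -/
lemma abs_sq_mul_heatFun_sub_le (t : ℝ≥0) {r : ℝ} (hr : r ∈ Icc (0 : ℝ) 1) :
    |r ^ 2 * (heatFun t r - 1) + t * (r * (1 - r))| ≤ (t : ℝ) ^ 2 := by
  rcases hr.1.eq_or_lt with rfl | h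
  · simp
  · rw [heatFun_of_pos _ h]
    set x := (t : ℝ) * (r⁻¹ - 1) with hx
    have h0 : 0 ≤ x := mul_nonneg t.coe_nonneg (sub_nonneg.2 ((one_le_inv₀ h).2 hr.2))
    have h2 : r * r⁻¹ = 1 := mul_inv_cancel₀ h.ne'
    have h3 : r * x = t * (1 - r) := by rw [hx]; linear_combination t * h2
    have h4 : r ^ 2 * (Real.exp (-x) - 1) + t * (r * (1 - r)) =
        r ^ 2 * (Real.exp (-x) - 1 + x) := by linear_combination -r * h3
    have h5 : 0 ≤ Real.exp (-x) - 1 + x := by linarith [Real.add_one_le_exp (-x)]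
    have h6 : Real.exp (-x) - 1 + x ≤ x ^ 2 := by
      have : Real.exp (-x) * (1 + x) ≤ 1 := by
        rw [Real.exp_neg, inv_mul_le_iff₀ (Real.exp_pos _)]
        linarith [Real.add_one_le_exp x]
      have h7 : 0 < Real.exp (-x) := Real.exp_pos _
      have h8 : Real.exp (-x) ≤ 1 / (1 + x) := by
        rw [le_div_iff₀ (by linarith)]; exact this
      have h9 : 1 / (1 + x) ≤ 1 - x + x ^ 2 := by
        rw [div_le_iff₀ (by linarith)]
        nlinarith [pow_nonneg h0 3]
      linarith
    rw [h4, abs_of_nonneg (by positivity)]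
    calc r ^ 2 * (Real.exp (-x) - 1 + x) ≤ r ^ 2 * x ^ 2 := by gcongr
      _ = (t * (1 - r)) ^ 2 := by rw [← h3]; ring
      _ ≤ (t : ℝ) ^ 2 := by
        have : 0 ≤ t * (1 - r) := mul_nonneg t.coe_nonneg (by linarith [hr.2])
        gcongr
        nlinarith [hr.1, t.coe_nonneg]

lemma mul_heatFunDiv {t : ℝ≥0} (ht : t ≠ 0) (r : ℝ) : r * heatFunDiv t r = heatFun t r := by
  rw [heatFunDiv, heatFun, if_neg ht]
  rcases eq_or_ne r 0 with rfl | hr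
  · simp [expNegInvGlue.zero]
  · field_simp

/-- The bound behind the regularizing effect of the semigroup: in terms of `λ = r⁻¹ - 1`, it reads
`(1 + λ) exp (-2 t λ) ≤ (1 - exp (-t λ)) / t + 1`. -/
lemma mul_mul_heatFunDiv_sq_le {t : ℝ≥0} (ht : t ≠ 0) {r : ℝ} (hr : r ∈ Icc (0 : ℝ) 1) :
    t * (r * heatFunDiv t r ^ 2) ≤ (1 - heatFun t r) + t := by
  have ht' : 0 < (t : ℝ) := by exact_mod_cast pos_iff_ne_zero.2 ht
  rcases hr.1.eq_or_lt with rfl | h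
  · simp [heatFun_zero_right ht]
    positivity
  · have h1 : heatFunDiv t r = r⁻¹ * heatFun t r := by
      rw [← mul_heatFunDiv ht]; field_simp
    have h2 := heatFun_le_one t hr
    have h3 := heatFun_nonneg t r
    have h4 : heatFun t r = Real.exp (-(t * (r⁻¹ - 1))) := heatFun_of_pos t h
    set x := (t : ℝ) * (r⁻¹ - 1) with hx
    have h0 : 0 ≤ x := mul_nonneg t.coe_nonneg (sub_nonneg.2 ((one_le_inv₀ h).2 hr.2))
    have h5 : heatFun t r * (1 + x) ≤ 1 := by
      rw [h4, Real.exp_neg, inv_mul_le_iff₀ (Real.exp_pos _)]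
      linarith [Real.add_one_le_exp x]
    have h6 : (t : ℝ) * (r * heatFunDiv t r ^ 2) = (x + t) * heatFun t r ^ 2 := by
      rw [h1, hx]; field_simp; ring
    rw [h6]
    have h7 : heatFun t r ^ 2 ≤ heatFun t r := by nlinarith
    have h8 : x * heatFun t r ^ 2 ≤ x * heatFun t r := by gcongr
    have h9 : t * heatFun t r ^ 2 ≤ t * 1 := by gcongr; nlinarith
    nlinarith

section Abstract

variable {H : Type*} [NormedAddCommGroup H] [InnerProductSpace ℂ H] [CompleteSpace H]

/-- `R` is the resolvent `(1 + A)⁻¹` of a nonnegative self-adjoint operator `A`. -/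
structure IsResolvent (R : H →L[ℂ] H) : Prop where
  isPositive : R.IsPositive
  norm_le : ‖R‖ ≤ 1
  injective : Function.Injective R

/-- The semigroup `exp (-t A)`, where `R = (1 + A)⁻¹`. -/
def heatSemigroup (R : H →L[ℂ] H) (t : ℝ≥0) : H →L[ℂ] H := cfc (heatFun t) R

/-- The form domain of `A` where `R = (1 + A)⁻¹`, i.e. the range of `R ^ (1 / 2)`, described by
duality. -/
def IsFormBounded (R : H →L[ℂ] H) (p : H) : Prop :=
  ∃ C : ℝ, 0 ≤ C ∧ ∀ h, ‖⟪p, h⟫_ℂ‖ ^ 2 ≤ C * (⟪R h, h⟫_ℂ).re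

namespace IsResolvent

variable {R : H →L[ℂ] H} (hR : IsResolvent R)
include hR

lemma isSelfAdjoint : IsSelfAdjoint R := hR.isPositive.isSelfAdjoint

lemma inner_left (x y : H) : ⟪R x, y⟫_ℂ = ⟪x, R y⟫_ℂ :=
  ContinuousLinearMap.isSelfAdjoint_iff_isSymmetric.1 hR.isSelfAdjoint x y

lemma spectrum_subset : spectrum ℝ R ⊆ Icc 0 1 := by
  intro x hx
  have h0 : 0 ≤ x := spectrum_nonneg_of_nonneg
    ((ContinuousLinearMap.nonneg_iff_isPositive R).2 hR.isPositive) hx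
  refine ⟨h0, ?_⟩
  have h1 := spectrum.norm_le_norm_mul_of_mem hx
  have h2 : ‖(1 : H →L[ℂ] H)‖ ≤ 1 := ContinuousLinearMap.norm_id_le
  have h3 := hR.norm_le
  rw [Real.norm_eq_abs, abs_of_nonneg h0] at h1
  nlinarith [norm_nonneg (1 : H →L[ℂ] H), norm_nonneg R]

lemma cfc_id_mul {f : ℝ → ℝ} (hf : Continuous f) :
    cfc (fun r => r * f r) R = R * cfc f R := by
  have := hR.isSelfAdjoint
  rw [cfc_mul (fun r => r) f R (by fun_prop) hf.continuousOn, cfc_id' ℝ R]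

lemma re_inner_cfc_le {f g : ℝ → ℝ} (hf : Continuous f) (hg : Continuous g)
    (h : ∀ r ∈ Icc (0 : ℝ) 1, f r ≤ g r) (x : H) :
    (⟪cfc f R x, x⟫_ℂ).re ≤ (⟪cfc g R x, x⟫_ℂ).re := by
  have h1 : cfc f R ≤ cfc g R :=
    cfc_mono (fun r hr => h r (hR.spectrum_subset hr)) hf.continuousOn hg.continuousOn
  have h2 := ((ContinuousLinearMap.le_def _ _).1 h1).re_inner_nonneg_left x
  simp only [sub_apply, inner_sub_left] at h2
  simpa using h2

omit hR in
lemma inner_cfc_left (f : ℝ → ℝ) (x y : H) : ⟪cfc f R x, y⟫_ℂ = ⟪x, cfc f R y⟫_ℂ := by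
  have h : IsSelfAdjoint (cfc f R) := cfc_predicate f R
  exact (ContinuousLinearMap.isSelfAdjoint_iff_isSymmetric.1 h) x y

lemma norm_cfc_le {f : ℝ → ℝ} {c : ℝ} (hc : 0 ≤ c) (h : ∀ r ∈ Icc (0 : ℝ) 1, |f r| ≤ c) :
    ‖cfc f R‖ ≤ c :=
  _root_.norm_cfc_le hc fun r hr => h r (hR.spectrum_subset hr)

lemma heatSemigroup_zero : heatSemigroup R 0 = 1 := by
  have := hR.isSelfAdjoint
  have h : heatFun 0 = fun _ => 1 := funext heatFun_zero_left
  rw [heatSemigroup, h, cfc_const_one ℝ R]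

lemma heatSemigroup_add (s t : ℝ≥0) :
    heatSemigroup R (s + t) = heatSemigroup R s * heatSemigroup R t := by
  rw [heatSemigroup, heatSemigroup, heatSemigroup,
    ← cfc_mul _ _ R (continuous_heatFun s).continuousOn (continuous_heatFun t).continuousOn]
  exact cfc_congr fun r hr => heatFun_add s t (hR.spectrum_subset hr).1

lemma norm_heatSemigroup_le (t : ℝ≥0) : ‖heatSemigroup R t‖ ≤ 1 :=
  hR.norm_cfc_le zero_le_one fun r hr => by
    rw [abs_of_nonneg (heatFun_nonneg t r)]; exact heatFun_le_one t hr

lemma heatSemigroup_mul_comm (t : ℝ≥0) : heatSemigroup R t * R = R * heatSemigroup R t := by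
  have := hR.isSelfAdjoint
  rw [heatSemigroup, ← hR.cfc_id_mul (continuous_heatFun t)]
  have h := cfc_mul (heatFun t) (fun r => r) R (continuous_heatFun t).continuousOn (by fun_prop)
  rw [cfc_id' ℝ R] at h
  rw [← h]
  congr 1
  funext r
  ring

lemma norm_mul_heatSemigroup_sub_le (s t : ℝ≥0) :
    ‖R * (heatSemigroup R t - heatSemigroup R s)‖ ≤ |(t : ℝ) - s| := by
  rw [heatSemigroup, heatSemigroup, ← cfc_sub (heatFun t) (heatFun s) R
    (continuous_heatFun t).continuousOn (continuous_heatFun s).continuousOn,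
    ← hR.cfc_id_mul (f := fun r => heatFun t r - heatFun s r)
      ((continuous_heatFun t).sub (continuous_heatFun s))]
  exact hR.norm_cfc_le (abs_nonneg _) fun r hr => abs_mul_heatFun_sub_le s t hr

/-- The derivative at `0` of the semigroup on the range of `R ^ 2`. -/
lemma norm_sq_mul_heatSemigroup_sub_le (t : ℝ≥0) :
    ‖R * (R * (heatSemigroup R t - 1)) + (t : ℝ) • (R * (1 - R))‖ ≤ (t : ℝ) ^ 2 := by
  have hs := hR.isSelfAdjoint
  have hf := continuous_heatFun t
  have h1 : R * (R * (heatSemigroup R t - 1)) = cfc (fun r => r * (r * (heatFun t r - 1))) R := by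
    rw [hR.cfc_id_mul (by fun_prop), hR.cfc_id_mul (by fun_prop),
      cfc_sub (heatFun t) (fun _ => (1 : ℝ)) R hf.continuousOn (by fun_prop), cfc_const_one ℝ R,
      heatSemigroup]
  have h2 : (t : ℝ) • (R * (1 - R)) = cfc (fun r : ℝ => (t : ℝ) • (r * (1 - r))) R := by
    rw [cfc_smul (t : ℝ) (fun r : ℝ => r * (1 - r)) R (by fun_prop), hR.cfc_id_mul (by fun_prop),
      cfc_sub (fun _ => (1 : ℝ)) (fun r => r) R (by fun_prop) (by fun_prop), cfc_const_one ℝ R,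
      cfc_id' ℝ R]
  rw [h1, h2, ← cfc_add R (fun r => r * (r * (heatFun t r - 1)))
    (fun r : ℝ => (t : ℝ) • (r * (1 - r))) (by fun_prop) (by fun_prop)]
  refine hR.norm_cfc_le (sq_nonneg _) fun r hr => ?_
  have := abs_sq_mul_heatFun_sub_le t hr
  rw [smul_eq_mul]
  convert this using 2
  ring

lemma denseRange : DenseRange R := by
  have h : (LinearMap.range (R : H →ₗ[ℂ] H)).topologicalClosure = ⊤ := by
    rw [Submodule.topologicalClosure_eq_top_iff, Submodule.eq_bot_iff]
    intro x hx
    apply hR.injective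
    rw [map_zero, ← inner_self_eq_zero (𝕜 := ℂ)]
    have h1 := hx (R (R x)) ⟨R x, rfl⟩
    rwa [hR.inner_left] at h1
  have h2 := Submodule.dense_iff_topologicalClosure_eq_top.2 h
  exact h2

end IsResolvent

omit [CompleteSpace H] in
/-- Strong convergence of a bounded family of operators need only be checked on a dense set. -/
lemma tendsto_apply_of_denseRange {ι α : Type*} {l : Filter ι} {B : ι → H →L[ℂ] H}
    {B₀ : H →L[ℂ] H} {C : ℝ} (hB : ∀ᶠ i in l, ‖B i‖ ≤ C) {e : α → H} (he : DenseRange e)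
    (h : ∀ a, Tendsto (fun i => B i (e a)) l (𝓝 (B₀ (e a)))) (x : H) :
    Tendsto (fun i => B i x) l (𝓝 (B₀ x)) := by
  rw [Metric.tendsto_nhds]
  intro ε hε
  set D := max C 0 + ‖B₀‖ + 1 with hD
  have hD0 : 0 < D := by positivity
  obtain ⟨a, ha⟩ := he.exists_dist_lt x (ε := ε / (2 * D)) (by positivity)
  filter_upwards [hB, Metric.tendsto_nhds.1 (h a) (ε / 2) (by positivity)] with i hi hi2
  rw [dist_eq_norm] at *
  have h1 : B i x - B₀ x = B i (x - e a) + (B i (e a) - B₀ (e a)) - B₀ (x - e a) := by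
    simp only [map_sub]; abel
  have h2 : ‖B i (x - e a)‖ ≤ max C 0 * ‖x - e a‖ :=
    ((B i).le_opNorm _).trans (by gcongr; exact hi.trans (le_max_left _ _))
  have h3 : ‖B₀ (x - e a)‖ ≤ ‖B₀‖ * ‖x - e a‖ := B₀.le_opNorm _
  have h4 : D * ‖x - e a‖ < ε / 2 := by
    rw [lt_div_iff₀ (by positivity)] at ha
    linarith
  rw [h1]
  calc _ ≤ ‖B i (x - e a)‖ + ‖B i (e a) - B₀ (e a)‖ + ‖B₀ (x - e a)‖ :=
        (norm_sub_le _ _).trans (by gcongr; exact norm_add_le _ _)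
    _ < ε := by
        have : (max C 0 + ‖B₀‖) * ‖x - e a‖ ≤ D * ‖x - e a‖ := by gcongr; linarith
        nlinarith

namespace IsResolvent

variable {R : H →L[ℂ] H} (hR : IsResolvent R)
include hR

lemma isC0Semigroup : IsC0Semigroup (heatSemigroup R) where
  map_zero := hR.heatSemigroup_zero
  map_add := hR.heatSemigroup_add
  continuous u := by
    rw [continuous_iff_continuousAt]
    intro t
    refine tendsto_apply_of_denseRange (B := fun t => heatSemigroup R t)
      (Eventually.of_forall hR.norm_heatSemigroup_le) hR.denseRange (fun g => ?_) u
    rw [tendsto_iff_norm_sub_tendsto_zero]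
    have h1 : Tendsto (fun s : ℝ≥0 => |(s : ℝ) - t| * ‖g‖) (𝓝 t) (𝓝 0) := by
      have : Continuous fun s : ℝ≥0 => |(s : ℝ) - t| * ‖g‖ := by fun_prop
      simpa using this.tendsto t
    refine squeeze_zero (fun _ => norm_nonneg _) (fun s => ?_) h1
    have h2 : heatSemigroup R s (R g) - heatSemigroup R t (R g) =
        (R * (heatSemigroup R s - heatSemigroup R t)) g := by
      rw [mul_sub, ← hR.heatSemigroup_mul_comm, ← hR.heatSemigroup_mul_comm]
      rfl
    rw [h2]
    exact (ContinuousLinearMap.le_opNorm _ _).trans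
      (by gcongr; exact hR.norm_mul_heatSemigroup_sub_le t s)

lemma tendsto_heatSemigroup_slope (g : H) :
    Tendsto (fun t : ℝ≥0 => ((t : ℝ) : ℂ)⁻¹ • (heatSemigroup R t (R g) - R g)) (𝓝[>] 0)
      (𝓝 (R g - g)) := by
  have hc : ∀ (t : ℝ≥0) (g : H), heatSemigroup R t (R g) = R (heatSemigroup R t g) := fun t g =>
    congrArg (fun S : H →L[ℂ] H => S g) (hR.heatSemigroup_mul_comm t)
  have h0 := hR.heatSemigroup_zero
  have key := tendsto_apply_of_denseRange (l := 𝓝[>] (0 : ℝ≥0))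
    (B := fun t : ℝ≥0 => ((t : ℝ) : ℂ)⁻¹ • (R * (heatSemigroup R t - heatSemigroup R 0)))
    (B₀ := R - 1) (C := 1) ?_ hR.denseRange ?_ g
  · refine (key.congr fun t => ?_)
    simp [h0, hc]
  · filter_upwards [self_mem_nhdsWithin] with t ht
    have ht : 0 < (t : ℝ) := ht
    rw [norm_smul, norm_inv, Complex.norm_real, Real.norm_eq_abs, abs_of_pos ht,
      inv_mul_le_iff₀ ht]
    have := hR.norm_mul_heatSemigroup_sub_le 0 t
    simpa [abs_of_pos ht] using this
  · intro k
    rw [tendsto_iff_norm_sub_tendsto_zero]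
    have h1 : Tendsto (fun s : ℝ≥0 => (s : ℝ) * ‖k‖) (𝓝[>] 0) (𝓝 0) := by
      have : Continuous fun s : ℝ≥0 => (s : ℝ) * ‖k‖ := by fun_prop
      simpa using (this.tendsto 0).mono_left nhdsWithin_le_nhds
    refine squeeze_zero' (Eventually.of_forall fun _ => norm_nonneg _) ?_ h1
    filter_upwards [self_mem_nhdsWithin] with t ht
    have ht : 0 < (t : ℝ) := ht
    have h2 := (ContinuousLinearMap.le_opNorm
      (R * (R * (heatSemigroup R t - 1)) + (t : ℝ) • (R * (1 - R))) k).trans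
      (mul_le_mul_of_nonneg_right (hR.norm_sq_mul_heatSemigroup_sub_le t) (norm_nonneg k))
    have h3 : (((t : ℝ) : ℂ)⁻¹ • (R * (heatSemigroup R t - heatSemigroup R 0))) (R k) -
        (R - 1) (R k) = ((t : ℝ) : ℂ)⁻¹ •
        ((R * (R * (heatSemigroup R t - 1)) + (t : ℝ) • (R * (1 - R))) k) := by
      have h4 : ((t : ℝ) : ℂ)⁻¹ • ((t : ℝ) • (R k - R (R k))) = R k - R (R k) := by
        rw [← Complex.coe_smul, smul_smul, inv_mul_cancel₀ (by exact_mod_cast ht.ne'), one_smul]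
      simp only [h0, smul_apply, mul_apply_eq_comp, sub_apply,
        one_apply_eq_self, add_apply, hc, map_sub, smul_add, h4]
      abel
    rw [h3, norm_smul, norm_inv, Complex.norm_real, Real.norm_eq_abs, abs_of_pos ht,
      inv_mul_le_iff₀ ht]
    linarith

/-- The generator of `heatSemigroup R` is `-A`, where `R = (1 + A)⁻¹`. -/
lemma isGeneratedBy : IsGeneratedBy (heatSemigroup R) fun u f => u = R (u - f) := by
  refine ⟨hR.isC0Semigroup, fun u f => ⟨fun h => ?_, fun h => ?_⟩⟩
  · have h1 := hR.tendsto_heatSemigroup_slope (u - f)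
    rw [← h] at h1
    simpa using h1
  · have h1 := hR.tendsto_heatSemigroup_slope u
    have h2 := (R.continuous.tendsto f).comp h
    have h3 : R u - u = R f := by
      refine tendsto_nhds_unique (h1.congr fun t => ?_) h2
      have hc : heatSemigroup R t (R u) = R (heatSemigroup R t u) :=
        congrArg (fun S : H →L[ℂ] H => S u) (hR.heatSemigroup_mul_comm t)
      simp [hc]
    change u = R (u - f)
    rw [map_sub, ← h3]
    abel

/-- `R ^ 2 ≤ R`, which expresses that `A ≥ 0`. -/
lemma norm_sq_le_re_inner (g : H) : ‖R g‖ ^ 2 ≤ (⟪R g, g⟫_ℂ).re := by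
  have hs := hR.isSelfAdjoint
  have h := hR.re_inner_cfc_le (f := fun r => r * r) (g := fun r => r) (by fun_prop) (by fun_prop)
    (fun r hr => by nlinarith [hr.1, hr.2]) g
  rw [hR.cfc_id_mul continuous_id', cfc_id' ℝ R, mul_apply_eq_comp,
    hR.inner_left] at h
  rw [← inner_self_eq_norm_sq (𝕜 := ℂ)]
  exact h

end IsResolvent

end Abstract

end

noncomputable section

/-! ### Uniqueness of the semigroup and invariant sets -/

section Abstract

variable {H : Type*} [NormedAddCommGroup H] [InnerProductSpace ℂ H] [CompleteSpace H]

omit [CompleteSpace H] in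
/-- An orbit of a semigroup that starts in the domain of the generator stays there. -/
lemma IsGeneratedBy.map_domain {T : ℝ≥0 → H →L[ℂ] H} {L : H → H → Prop}
    (hT : IsGeneratedBy T L) {u f : H} (h : L u f) (s : ℝ≥0) : L (T s u) (T s f) := by
  rw [hT.2] at h ⊢
  refine (((T s).continuous.tendsto f).comp h).congr fun t => ?_
  have h1 : T s (T t u) = T t (T s u) := by
    rw [← mul_apply_eq_comp, ← mul_apply_eq_comp, ← hT.1.map_add, ← hT.1.map_add, add_comm]
  simp [h1]

omit [CompleteSpace H] in
/-- The right derivative of an orbit of a semigroup. -/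
lemma IsGeneratedBy.hasDerivWithinAt {T : ℝ≥0 → H →L[ℂ] H} {L : H → H → Prop}
    (hT : IsGeneratedBy T L) {u f : H} (h : L u f) {s : ℝ} (hs : 0 ≤ s) :
    HasDerivWithinAt (fun s : ℝ => T s.toNNReal u) (T s.toNNReal f) (Ici s) s := by
  have h1 := (hT.2 _ _).1 (hT.map_domain h s.toNNReal)
  rw [← hasDerivWithinAt_Ioi_iff_Ici, hasDerivWithinAt_iff_tendsto_slope' (by simp)]
  have h2 : Tendsto (fun y : ℝ => (y - s).toNNReal) (𝓝[>] s) (𝓝[>] 0) := by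
    refine tendsto_nhdsWithin_iff.2 ⟨?_, ?_⟩
    · have : Continuous fun y : ℝ => (y - s).toNNReal := by fun_prop
      simpa using (this.tendsto s).mono_left nhdsWithin_le_nhds
    · filter_upwards [self_mem_nhdsWithin] with y hy
      simpa using hy
  refine (h1.comp h2).congr' ?_
  filter_upwards [self_mem_nhdsWithin] with y hy
  have hy : s < y := hy
  have h3 : T (y - s).toNNReal (T s.toNNReal u) = T y.toNNReal u := by
    rw [← mul_apply_eq_comp, ← hT.1.map_add, ← Real.toNNReal_add (by linarith) hs]
    congr 3
    ring
  simp only [Function.comp, h3, slope_def_module]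
  rw [Real.coe_toNNReal _ (by linarith), ← Complex.ofReal_inv, Complex.coe_smul]

namespace IsResolvent

variable {R : H →L[ℂ] H} (hR : IsResolvent R)
include hR

/-- A semigroup is determined by its generator `-A`, because `‖T t u - S t u‖` does not increase
in `t` for `u` in the domain of `A`. -/
lemma eq_heatSemigroup {T : ℝ≥0 → H →L[ℂ] H}
    (hT : IsGeneratedBy T fun u f => u = R (u - f)) : T = heatSemigroup R := by
  have hS := hR.isGeneratedBy
  let _ : InnerProductSpace ℝ H := InnerProductSpace.rclikeToReal ℂ H
  have key : ∀ g, ∀ t : ℝ≥0, T t (R g) = heatSemigroup R t (R g) := by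
    intro g t
    have hL : R g = R (R g - (R g - g)) := by rw [sub_sub_cancel]
    set u := R g
    set f := R g - g
    let w : ℝ → H := fun s => T s.toNNReal u - heatSemigroup R s.toNNReal u
    let w' : ℝ → H := fun s => T s.toNNReal f - heatSemigroup R s.toNNReal f
    have hd : ∀ s ∈ Ico (0 : ℝ) t, HasDerivWithinAt (fun s => ‖w s‖ ^ 2)
        (2 * ⟪w s, w' s⟫_ℝ) (Ici s) s := fun s hs =>
      ((hT.hasDerivWithinAt hL hs.1).sub (hS.hasDerivWithinAt hL hs.1)).norm_sq
    have hneg : ∀ s ∈ Ico (0 : ℝ) t, 2 * ⟪w s, w' s⟫_ℝ ≤ 0 := by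
      intro s _
      have h1 := hT.map_domain hL s.toNNReal
      have h2 := hS.map_domain hL s.toNNReal
      have h3 : w s = R (w s - w' s) := by
        have h4 : w s - w' s = (T s.toNNReal u - T s.toNNReal f) -
          (heatSemigroup R s.toNNReal u - heatSemigroup R s.toNNReal f) := by
          simp only [w, w']; abel
        rw [h4, map_sub, ← h1, ← h2]
      have h5 := hR.norm_sq_le_re_inner (w s - w' s)
      rw [← h3, inner_sub_right] at h5
      have h6 : (⟪w s, w s⟫_ℂ).re = ‖w s‖ ^ 2 := inner_self_eq_norm_sq (𝕜 := ℂ) (w s)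
      rw [Complex.sub_re, h6] at h5
      have h7 : ⟪w s, w' s⟫_ℝ = (⟪w s, w' s⟫_ℂ).re := rfl
      rw [h7]
      linarith
    have hcont : ContinuousOn (fun s => ‖w s‖ ^ 2) (Icc (0 : ℝ) t) := by
      have h1 := (hT.1.continuous u).comp continuous_real_toNNReal
      have h2 := (hS.1.continuous u).comp continuous_real_toNNReal
      exact ((h1.sub h2).norm.pow 2).continuousOn
    have h0 : ‖w 0‖ ^ 2 ≤ 0 := by
      simp [w, hT.1.map_zero, hS.1.map_zero]
    have := image_le_of_deriv_right_le_deriv_boundary hcont hd (B := fun _ => 0) (B' := fun _ => 0)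
      h0 continuousOn_const (fun x _ => hasDerivWithinAt_const _ _ _) hneg
      (right_mem_Icc.2 t.coe_nonneg)
    have h8 : ‖w t‖ = 0 := by nlinarith [norm_nonneg (w t)]
    simpa [w, sub_eq_zero] using h8
  funext t
  refine ContinuousLinearMap.coeFn_injective ?_
  exact hR.denseRange.equalizer (T t).continuous (heatSemigroup R t).continuous
    (funext fun g => key g t)

lemma existsUnique_isGeneratedBy :
    ∃! T : ℝ≥0 → H →L[ℂ] H, IsGeneratedBy T fun u f => u = R (u - f) :=
  ⟨heatSemigroup R, hR.isGeneratedBy, fun _ hT => hR.eq_heatSemigroup hT⟩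

lemma re_inner_sub_heatSemigroup_nonneg (t : ℝ≥0) (x : H) :
    0 ≤ (⟪x - heatSemigroup R t x, x⟫_ℂ).re := by
  have h1 := hR.re_inner_cfc_le (continuous_heatFun t) (g := fun _ => 1) continuous_const
    (fun r hr => heatFun_le_one t hr) x
  have := hR.isSelfAdjoint
  rw [cfc_const_one ℝ R] at h1
  rw [inner_sub_left, Complex.sub_re]
  exact sub_nonneg.2 h1

/-- The difference quotients of the form are bounded on the form domain. -/
lemma exists_re_inner_sub_heatSemigroup_le {u : H} (hu : IsFormBounded R u) :
    ∃ C, 0 ≤ C ∧ ∀ t : ℝ≥0, (⟪u - heatSemigroup R t u, u⟫_ℂ).re ≤ t * C := by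
  obtain ⟨C, hC0, hC⟩ := hu
  have hs := hR.isSelfAdjoint
  refine ⟨C, hC0, fun t => ?_⟩
  have hf := continuous_heatFun t
  set g : ℝ → ℝ := fun r => 1 - heatFun t r with hg
  have hgc : Continuous g := by fun_prop
  have h0 : cfc g R = 1 - heatSemigroup R t := by
    rw [hg, cfc_sub (fun _ => (1 : ℝ)) (heatFun t) R (by fun_prop) hf.continuousOn,
      cfc_const_one ℝ R]
    rfl
  set N := (⟪u - heatSemigroup R t u, u⟫_ℂ).re with hN
  have hN0 : 0 ≤ N := hR.re_inner_sub_heatSemigroup_nonneg t u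
  have hN1 : N = (⟪cfc g R u, u⟫_ℂ).re := by rw [h0]; rfl
  -- Duality is applied to `h = (1 - T t) u`.
  have h1 := hC (cfc g R u)
  have h2 : N ≤ ‖⟪u, cfc g R u⟫_ℂ‖ := by
    rw [hN1, inner_cfc_left]
    exact Complex.re_le_norm _
  have h3 : (⟪R (cfc g R u), cfc g R u⟫_ℂ).re = (⟪cfc (fun r => r * (g r * g r)) R u, u⟫_ℂ).re := by
    have h4 : cfc (fun r => r * (g r * g r)) R = cfc g R * (R * cfc g R) := by
      rw [← hR.cfc_id_mul hgc, ← cfc_mul g (fun r => r * g r) R]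
      congr 1
      funext r
      ring
    rw [h4, mul_apply_eq_comp, inner_cfc_left]
    rfl
  have h5 : (⟪cfc (fun r => r * (g r * g r)) R u, u⟫_ℂ).re ≤ t * N := by
    have h6 := hR.re_inner_cfc_le (f := fun r => r * (g r * g r)) (g := fun r => (t : ℝ) • g r)
      (by fun_prop) (by fun_prop) (fun r hr => ?_) u
    · rw [cfc_smul (t : ℝ) g R] at h6
      refine h6.trans (le_of_eq ?_)
      rw [smul_apply, ← Complex.coe_smul, inner_smul_left, hN1]
      simp
    · have h7 := mul_one_sub_heatFun_le t hr
      have h8 := heatFun_le_one t hr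
      rw [← mul_assoc, smul_eq_mul]
      exact mul_le_mul_of_nonneg_right h7 (by simp only [hg]; linarith)
  rw [h3] at h1
  have h9 : N ^ 2 ≤ C * (t * N) := by
    calc N ^ 2 ≤ ‖⟪u, cfc g R u⟫_ℂ‖ ^ 2 := by gcongr
      _ ≤ _ := h1
      _ ≤ _ := by gcongr
  rcases hN0.eq_or_lt with h | h
  · rw [← h]; positivity
  · nlinarith

/-- If the difference quotients of the form at `p` are bounded, then `p` lies in the form domain. -/
lemma isFormBounded_of_le {p : H} {C : ℝ} (hC0 : 0 ≤ C)
    (hC : ∀ t : ℝ≥0, (⟪p - heatSemigroup R t p, p⟫_ℂ).re ≤ t * C) : IsFormBounded R p := by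
  have hs := hR.isSelfAdjoint
  refine ⟨C + ‖p‖ ^ 2, by positivity, fun h => ?_⟩
  have key : ∀ t : ℝ≥0, t ≠ 0 →
      ‖⟪heatSemigroup R t p, h⟫_ℂ‖ ^ 2 ≤ (C + ‖p‖ ^ 2) * (⟪R h, h⟫_ℂ).re := by
    intro t ht
    have hf := continuous_heatFun t
    have hdiv := continuous_heatFunDiv ht
    set q := cfc (heatFunDiv t) R p with hq
    have h1 : heatSemigroup R t p = R q := by
      have : heatFun t = fun r => r * heatFunDiv t r := by
        funext r; rw [mul_heatFunDiv ht]
      rw [heatSemigroup, this, hR.cfc_id_mul hdiv]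
      rfl
    -- The Cauchy-Schwarz inequality for the semi-inner product `⟪R x, y⟫`.
    have h2 : ‖⟪R q, h⟫_ℂ‖ ^ 2 ≤ (⟪R q, q⟫_ℂ).re * (⟪R h, h⟫_ℂ).re := by
      have h3 : R = cfc Real.sqrt R * cfc Real.sqrt R := by
        rw [← cfc_mul Real.sqrt Real.sqrt R (by fun_prop) (by fun_prop)]
        conv_lhs => rw [← cfc_id' ℝ R]
        exact cfc_congr fun r hr => (Real.mul_self_sqrt (hR.spectrum_subset hr).1).symm
      have h4 : ∀ x y : H, ⟪R x, y⟫_ℂ = ⟪cfc Real.sqrt R x, cfc Real.sqrt R y⟫_ℂ := by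
        intro x y
        rw [← inner_cfc_left, ← mul_apply_eq_comp, ← h3]
      have h5 : ∀ x : H, (⟪R x, x⟫_ℂ).re = ‖cfc Real.sqrt R x‖ ^ 2 := by
        intro x
        rw [h4]
        exact inner_self_eq_norm_sq (𝕜 := ℂ) _
      rw [h4, h5, h5, ← mul_pow]
      gcongr
      exact norm_inner_le_norm _ _
    have h3 : (t : ℝ) * (⟪R q, q⟫_ℂ).re ≤ t * (C + ‖p‖ ^ 2) := by
      have h4 : cfc (fun r => (t : ℝ) • (r * (heatFunDiv t r * heatFunDiv t r))) R =
          (t : ℝ) • (cfc (heatFunDiv t) R * (R * cfc (heatFunDiv t) R)) := by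
        rw [← hR.cfc_id_mul hdiv, ← cfc_mul (heatFunDiv t) (fun r => r * heatFunDiv t r) R,
          ← cfc_smul (t : ℝ) (fun r => heatFunDiv t r * (r * heatFunDiv t r)) R]
        congr 1
        funext r
        simp only [smul_eq_mul]
        ring
      have h5 : cfc (fun r => (1 - heatFun t r) + t) R = (1 - heatSemigroup R t) +
          (t : ℝ) • (1 : H →L[ℂ] H) := by
        rw [cfc_add R (fun r => 1 - heatFun t r) (fun _ => (t : ℝ)) (by fun_prop) (by fun_prop),
          cfc_sub (fun _ => (1 : ℝ)) (heatFun t) R (by fun_prop) hf.continuousOn,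
          cfc_const_one ℝ R, cfc_const (t : ℝ) R, Algebra.algebraMap_eq_smul_one]
        rfl
      have h6 := hR.re_inner_cfc_le
        (f := fun r => (t : ℝ) • (r * (heatFunDiv t r * heatFunDiv t r)))
        (g := fun r => (1 - heatFun t r) + t) (by fun_prop) (by fun_prop) (fun r hr => by
          have := mul_mul_heatFunDiv_sq_le ht hr
          rw [smul_eq_mul, ← sq]
          exact this) p
      rw [h4, h5] at h6
      have h7 : (⟪((t : ℝ) • (cfc (heatFunDiv t) R * (R * cfc (heatFunDiv t) R))) p, p⟫_ℂ).re =
          t * (⟪R q, q⟫_ℂ).re := by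
        rw [smul_apply, ← Complex.coe_smul, inner_smul_left, mul_apply_eq_comp, inner_cfc_left]
        simp [hq]
      have h8 : (⟪((1 - heatSemigroup R t) + (t : ℝ) • (1 : H →L[ℂ] H)) p, p⟫_ℂ).re =
          (⟪p - heatSemigroup R t p, p⟫_ℂ).re + t * ‖p‖ ^ 2 := by
        rw [add_apply, inner_add_left, Complex.add_re, smul_apply, ← Complex.coe_smul,
          inner_smul_left, one_apply_eq_self, ← inner_self_eq_norm_sq (𝕜 := ℂ)]
        simp [inner_sub_left]
      rw [h7, h8] at h6
      linarith [hC t]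
    have h4 : (⟪R q, q⟫_ℂ).re ≤ C + ‖p‖ ^ 2 :=
      le_of_mul_le_mul_left h3 (by exact_mod_cast pos_iff_ne_zero.2 ht)
    rw [h1]
    exact h2.trans (mul_le_mul_of_nonneg_right h4 (hR.isPositive.re_inner_nonneg_left h))
  have hlim : Tendsto (fun t : ℝ≥0 => ‖⟪heatSemigroup R t p, h⟫_ℂ‖ ^ 2) (𝓝[>] 0)
      (𝓝 (‖⟪p, h⟫_ℂ‖ ^ 2)) := by
    have h1 := (hR.isC0Semigroup.continuous p).tendsto 0
    rw [hR.heatSemigroup_zero] at h1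
    exact (((h1.mono_left nhdsWithin_le_nhds).inner tendsto_const_nhds).norm).pow 2
  refine le_of_tendsto hlim ?_
  filter_upwards [self_mem_nhdsWithin] with t ht
  exact key t (ne_of_gt ht)

/-- If the semigroup leaves a set `S` invariant, then the metric projection `p ∈ S` of an element
`u` of the form domain lies in the form domain, too. -/
lemma isFormBounded_of_invariant {S : Set H} {u p : H} (hS : ∀ t, ∀ x ∈ S, heatSemigroup R t x ∈ S)
    (hp : p ∈ S) (hproj : ∀ y ∈ S, (⟪y - p, u - p⟫_ℂ).re ≤ 0) (hu : IsFormBounded R u) :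
    IsFormBounded R p := by
  obtain ⟨C, hC0, hC⟩ := hR.exists_re_inner_sub_heatSemigroup_le hu
  refine hR.isFormBounded_of_le hC0 fun t => le_trans ?_ (hC t)
  set T := heatSemigroup R t with hT
  have h1 := hproj _ (hS t p hp)
  have h2 := hR.re_inner_sub_heatSemigroup_nonneg t (p - u)
  have h3 : (⟪u - T u, p⟫_ℂ).re = (⟪p - T p, u⟫_ℂ).re := by
    have h4 : ⟪T u, p⟫_ℂ = ⟪u, T p⟫_ℂ := inner_cfc_left _ _ _
    rw [inner_sub_left, h4, ← inner_sub_right, ← inner_conj_symm, Complex.conj_re]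
  have h5 : (p - u) - T (p - u) = (p - T p) - (u - T u) := by rw [map_sub]; abel
  have h6 : T p - p = -(p - T p) := by abel
  rw [← hT, h5] at h2
  rw [h6, inner_neg_left, inner_sub_right] at h1
  simp only [inner_sub_left (p - T p), inner_sub_right _ p u, Complex.sub_re, Complex.neg_re,
    h3] at h1 h2
  linarith

end IsResolvent

end Abstract

end

noncomputable section

/-! ### Coercive forms -/

section Coercive

variable {H : Type*} [NormedAddCommGroup H] [InnerProductSpace ℂ H] [CompleteSpace H]
variable {K : Type*} [NormedAddCommGroup K] [InnerProductSpace ℂ K] [CompleteSpace K]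

/-- The Lax-Milgram lemma. -/
lemma exists_inverse_of_coercive (M : K →L[ℂ] K) {c : ℝ} (hc : 0 < c)
    (h : ∀ x, c * ‖x‖ ^ 2 ≤ (⟪M x, x⟫_ℂ).re) :
    ∃ N : K →L[ℂ] K, (∀ x, M (N x) = x) ∧ ∀ x, N (M x) = x := by
  have h1 : IsUnit M :=
    ContinuousLinearMap.isUnit_of_forall_le_norm_inner_map M (c := ⟨c, hc.le⟩) hc fun x => by
      have := (h x).trans (Complex.re_le_norm _)
      rw [mul_comm]
      exact this
  obtain ⟨u, rfl⟩ := h1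
  refine ⟨↑u⁻¹, fun x => ?_, fun x => ?_⟩
  · rw [← mul_apply_eq_comp, Units.mul_inv, one_apply_eq_self]
  · rw [← mul_apply_eq_comp, Units.inv_mul, one_apply_eq_self]

omit [CompleteSpace H] in
/-- A functional dominated by `h ↦ ‖A h‖` factors through `A`. -/
lemma exists_inner_eq_of_norm_inner_le (A : H →L[ℂ] K) (p : H) {C : ℝ}
    (hC : ∀ h, ‖⟪p, h⟫_ℂ‖ ≤ C * ‖A h‖) : ∃ k : K, ∀ h, ⟪p, h⟫_ℂ = ⟪k, A h⟫_ℂ := by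
  set P := LinearMap.range (A : H →ₗ[ℂ] K) with hP
  have hex : ∀ y : P, ∃ h : H, A h = y := fun y => y.2
  choose s hs using hex
  have hwd : ∀ h h' : H, A h = A h' → ⟪p, h⟫_ℂ = ⟪p, h'⟫_ℂ := by
    intro h h' e
    have := hC (h - h')
    rw [map_sub, e, sub_self, norm_zero, mul_zero, inner_sub_right] at this
    exact sub_eq_zero.1 (norm_le_zero_iff.1 this)
  let φ : P →ₗ[ℂ] ℂ :=
    { toFun := fun y => ⟪p, s y⟫_ℂ
      map_add' := fun y z => by
        rw [← inner_add_right]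
        exact hwd _ _ (by rw [map_add, hs, hs, hs]; rfl)
      map_smul' := fun a y => by
        rw [RingHom.id_apply, smul_eq_mul, ← inner_smul_right]
        exact hwd _ _ (by rw [map_smul, hs, hs]; rfl) }
  obtain ⟨g, hg, -⟩ := exists_extension_norm_eq P (φ.mkContinuous C fun y => by
    have := hC (s y)
    rwa [hs] at this)
  refine ⟨(InnerProductSpace.toDual ℂ K).symm g, fun h => ?_⟩
  rw [InnerProductSpace.toDual_symm_apply]
  have h1 := hg ⟨A h, ⟨h, rfl⟩⟩
  rw [h1]
  exact hwd _ _ (hs ⟨A h, ⟨h, rfl⟩⟩).symm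

/-- A symmetric form on `K`, given by `(x, y) ↦ ⟪y, M x⟫` with a coercive operator `M` dominating
`j : K → H`, defines a nonnegative self-adjoint operator on `H` with form domain `j K`. Here `M`
represents the form `a + ⟪·, ·⟫_H`. -/
lemma exists_isResolvent_of_coercive (j : K →L[ℂ] H) (hj : DenseRange j) (M : K →L[ℂ] K)
    (hM : ∀ x y, ⟪M x, y⟫_ℂ = ⟪x, M y⟫_ℂ) {c : ℝ} (hc : 0 < c)
    (h : ∀ x, c * ‖x‖ ^ 2 ≤ (⟪M x, x⟫_ℂ).re) (hj1 : ∀ x, ‖j x‖ ^ 2 ≤ (⟪M x, x⟫_ℂ).re) :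
    ∃ R : H →L[ℂ] H, IsResolvent R ∧
      (∀ f u, u = R f ↔ ∃ k, j k = u ∧ ∀ y, ⟪y, M k⟫_ℂ = ⟪j y, f⟫_ℂ) ∧
      ∀ p, IsFormBounded R p ↔ ∃ k, j k = p := by
  obtain ⟨N, hMN, hNM⟩ := exists_inverse_of_coercive M hc h
  set A := ContinuousLinearMap.adjoint j with hA
  let R : H →L[ℂ] H := j.comp (N.comp A)
  have hR : ∀ f, R f = j (N (A f)) := fun f => rfl
  have hN : ∀ x y, ⟪N x, y⟫_ℂ = ⟪x, N y⟫_ℂ := by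
    intro x y
    conv_lhs => rw [← hMN y, ← hM, hMN]
  have hRi : ∀ f g, ⟪R f, g⟫_ℂ = ⟪N (A f), A g⟫_ℂ := by
    intro f g
    rw [hR, hA, ContinuousLinearMap.adjoint_inner_right]
  have hRM : ∀ f, (⟪R f, f⟫_ℂ).re = (⟪M (N (A f)), N (A f)⟫_ℂ).re := by
    intro f
    rw [hRi, hM, hMN]
  have hpos : ∀ f, 0 ≤ (⟪R f, f⟫_ℂ).re := fun f => by
    rw [hRM]
    exact le_trans (by positivity) (h _)
  refine ⟨R, ⟨?_, ?_, ?_⟩, ?_, ?_⟩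
  · refine ⟨fun x y => ?_, hpos⟩
    change ⟪R x, y⟫_ℂ = ⟪x, R y⟫_ℂ
    rw [hRi, hN, ← inner_conj_symm x, hRi, inner_conj_symm]
  · refine ContinuousLinearMap.opNorm_le_bound _ zero_le_one fun f => ?_
    have h1 := hj1 (N (A f))
    rw [← hRM, ← hR] at h1
    have h2 : (⟪R f, f⟫_ℂ).re ≤ ‖R f‖ * ‖f‖ :=
      (Complex.re_le_norm _).trans (norm_inner_le_norm _ _)
    rw [one_mul]
    by_contra! hlt
    nlinarith [norm_nonneg (R f), norm_nonneg f]
  · refine (injective_iff_map_eq_zero R).2 fun f hf => ?_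
    have h1 := h (N (A f))
    rw [← hRM, hf, inner_zero_left, Complex.zero_re] at h1
    have h2 : ‖N (A f)‖ ^ 2 ≤ 0 := by nlinarith
    have h3 : N (A f) = 0 := by
      rw [← norm_eq_zero]; nlinarith [norm_nonneg (N (A f))]
    have h4 : A f = 0 := by rw [← hMN (A f), h3, map_zero]
    rw [← inner_self_eq_zero (𝕜 := ℂ)]
    have h5 : (fun y : H => ⟪y, f⟫_ℂ) = fun _ => 0 := by
      refine hj.equalizer (by fun_prop) continuous_const (funext fun y => ?_)
      simp only [Function.comp]
      rw [← ContinuousLinearMap.adjoint_inner_right, ← hA, h4, inner_zero_right]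
    exact congrFun h5 f
  · intro f u
    constructor
    · rintro rfl
      refine ⟨N (A f), rfl, fun y => ?_⟩
      rw [hMN, hA, ContinuousLinearMap.adjoint_inner_right]
    · rintro ⟨k, rfl, hk⟩
      have h1 : M k = A f := ext_inner_left ℂ fun y => by
        rw [hk, hA, ContinuousLinearMap.adjoint_inner_right]
      rw [hR, ← h1, hNM]
  · intro p
    constructor
    · rintro ⟨C, hC0, hC⟩
      have h1 : ∀ g, ‖⟪p, g⟫_ℂ‖ ≤ Real.sqrt (C * ‖N‖) * ‖A g‖ := by
        intro g
        refine abs_le_of_sq_le_sq' ?_ (by positivity) |>.2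
        rw [mul_pow, Real.sq_sqrt (by positivity)]
        refine (hC g).trans ?_
        have h2 : (⟪R g, g⟫_ℂ).re ≤ ‖N‖ * ‖A g‖ * ‖A g‖ := by
          rw [hRi]
          refine (Complex.re_le_norm _).trans ((norm_inner_le_norm _ _).trans ?_)
          gcongr
          exact N.le_opNorm _
        calc _ ≤ C * (‖N‖ * ‖A g‖ * ‖A g‖) := by gcongr
          _ = _ := by ring
      obtain ⟨k, hk⟩ := exists_inner_eq_of_norm_inner_le A p h1
      refine ⟨k, ext_inner_right ℂ fun g => ?_⟩
      rw [hk, hA, ContinuousLinearMap.adjoint_inner_right]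
    · rintro ⟨k, rfl⟩
      refine ⟨‖k‖ ^ 2 * (‖M‖ ^ 2 / c), by positivity, fun g => ?_⟩
      have h1 : ‖⟪j k, g⟫_ℂ‖ ≤ ‖k‖ * (‖M‖ * ‖N (A g)‖) := by
        rw [← ContinuousLinearMap.adjoint_inner_right, ← hA]
        refine (norm_inner_le_norm _ _).trans ?_
        gcongr
        conv_lhs => rw [← hMN (A g)]
        exact M.le_opNorm _
      have h2 : ‖N (A g)‖ ^ 2 ≤ (⟪R g, g⟫_ℂ).re / c := by
        rw [le_div_iff₀ hc, hRM, mul_comm]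
        exact h _
      calc _ ≤ (‖k‖ * (‖M‖ * ‖N (A g)‖)) ^ 2 := by gcongr
        _ = ‖k‖ ^ 2 * ‖M‖ ^ 2 * ‖N (A g)‖ ^ 2 := by ring
        _ ≤ ‖k‖ ^ 2 * ‖M‖ ^ 2 * ((⟪R g, g⟫_ℂ).re / c) := by gcongr
        _ = _ := by ring

end Coercive

end

noncomputable section

/-! ### The trace inequality on Lipschitz domains -/

lemma LipschitzWith.euclideanHausdorffMeasure_image_le {X Y : Type*} [EMetricSpace X]
    [MeasurableSpace X] [BorelSpace X] [EMetricSpace Y] [MeasurableSpace Y] [BorelSpace Y]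
    {K : ℝ≥0} {f : X → Y} (hf : LipschitzWith K f) (n : ℕ) (s : Set X) :
    Measure.euclideanHausdorffMeasure n (f '' s) ≤
      (K : ℝ≥0∞) ^ n * Measure.euclideanHausdorffMeasure n s := by
  have h := hf.hausdorffMeasure_image_le (d := n) (by positivity) s
  rw [ENNReal.rpow_natCast] at h
  rw [Measure.euclideanHausdorffMeasure_def, Measure.euclideanHausdorffMeasure_def,
    Measure.smul_apply, Measure.smul_apply, ENNReal.smul_def, ENNReal.smul_def, smul_eq_mul,
    smul_eq_mul, mul_left_comm]
  gcongr

lemma sq_lintegral_le {α : Type*} [MeasurableSpace α] (μ : Measure α) {f : α → ℝ≥0∞}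
    (hf : AEMeasurable f μ) : (∫⁻ x, f x ∂μ) ^ 2 ≤ μ univ * ∫⁻ x, f x ^ 2 ∂μ := by
  have h := ENNReal.lintegral_mul_le_Lp_mul_Lq μ (p := 2) (q := 2)
    (by rw [Real.holderConjugate_iff]; norm_num) (f := f) (g := fun _ => 1) hf aemeasurable_const
  simp only [Pi.mul_apply, mul_one, ENNReal.one_rpow, lintegral_const, one_mul] at h
  calc (∫⁻ x, f x ∂μ) ^ 2
      ≤ ((∫⁻ x, f x ^ (2 : ℝ) ∂μ) ^ (1 / 2 : ℝ) * μ univ ^ (1 / 2 : ℝ)) ^ 2 := by gcongr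
    _ = μ univ * ∫⁻ x, f x ^ 2 ∂μ := by
        rw [mul_pow, ← ENNReal.rpow_natCast, ← ENNReal.rpow_mul, ← ENNReal.rpow_natCast,
          ← ENNReal.rpow_mul]
        norm_num
        rw [mul_comm]

/-- A value of a function on an interval is controlled by the `H¹` norm on the interval. -/
lemma mul_enorm_sq_le_lintegral {f : ℝ → ℂ} (hf : ContDiff ℝ 1 f) (h : ℝ) :
    ENNReal.ofReal h * ‖f 0‖ₑ ^ 2 ≤ ∫⁻ t in Ioo 0 h,
      (2 * ‖f t‖ₑ ^ 2 + 2 * ENNReal.ofReal h ^ 2 * ‖deriv f t‖ₑ ^ 2) := by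
  have hd : Continuous (deriv f) := hf.continuous_deriv le_rfl
  set I := ∫⁻ t in Ioo 0 h, ‖deriv f t‖ₑ with hI
  have h1 : I ^ 2 ≤ ENNReal.ofReal h * ∫⁻ t in Ioo 0 h, ‖deriv f t‖ₑ ^ 2 := by
    have := sq_lintegral_le (volume.restrict (Ioo 0 h)) (f := fun t => ‖deriv f t‖ₑ)
      hd.enorm.measurable.aemeasurable
    simpa using this
  have h2 : ∀ t ∈ Ioo 0 h, ‖f 0‖ₑ ^ 2 ≤ 2 * ‖f t‖ₑ ^ 2 + 2 * I ^ 2 := by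
    intro t ht
    have h3 := enorm_sub_le_lintegral_deriv_of_contDiffOn_Icc (f := f) (a := 0) (b := t)
      hf.contDiffOn ht.1.le
    have h4 : ∫⁻ x in Icc 0 t, ‖deriv f x‖ₑ ≤ I := by
      rw [hI, ← restrict_Ioo_eq_restrict_Icc]
      exact lintegral_mono_set (Ioo_subset_Ioo_right ht.2.le)
    have h5 : ‖f 0‖ₑ ≤ ‖f t‖ₑ + I := by
      calc ‖f 0‖ₑ = ‖f t - (f t - f 0)‖ₑ := by rw [sub_sub_cancel]
        _ ≤ ‖f t‖ₑ + ‖f t - f 0‖ₑ := enorm_sub_le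
        _ ≤ _ := by gcongr; exact h3.trans h4
    calc _ ≤ (‖f t‖ₑ + I) ^ 2 := by gcongr
      _ ≤ 2 * (‖f t‖ₑ ^ 2 + I ^ 2) := by
        have := ENNReal.rpow_add_le_mul_rpow_add_rpow ‖f t‖ₑ I (p := 2) (by norm_num)
        norm_num at this
        exact this
      _ = _ := by ring
  have h6 : ∫⁻ _ in Ioo 0 h, ‖f 0‖ₑ ^ 2 = ENNReal.ofReal h * ‖f 0‖ₑ ^ 2 := by
    simp [mul_comm]
  rw [← h6]
  calc ∫⁻ _ in Ioo 0 h, ‖f 0‖ₑ ^ 2 ≤ ∫⁻ t in Ioo 0 h, (2 * ‖f t‖ₑ ^ 2 + 2 * I ^ 2) :=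
        setLIntegral_mono' measurableSet_Ioo h2
    _ = (∫⁻ t in Ioo 0 h, 2 * ‖f t‖ₑ ^ 2) + 2 * I ^ 2 * ENNReal.ofReal h := by
        have hm : Measurable fun t => 2 * ‖f t‖ₑ ^ 2 :=
          ((hf.continuous.enorm.measurable).pow_const 2).const_mul 2
        rw [lintegral_add_left hm]
        simp
    _ ≤ (∫⁻ t in Ioo 0 h, 2 * ‖f t‖ₑ ^ 2) +
        2 * ENNReal.ofReal h ^ 2 * ∫⁻ t in Ioo 0 h, ‖deriv f t‖ₑ ^ 2 := by
        refine add_le_add le_rfl ?_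
        calc 2 * I ^ 2 * ENNReal.ofReal h ≤
            2 * (ENNReal.ofReal h * ∫⁻ t in Ioo 0 h, ‖deriv f t‖ₑ ^ 2) * ENNReal.ofReal h := by
              gcongr
          _ = _ := by ring
    _ = _ := by
        have hm : Measurable fun t => 2 * ‖f t‖ₑ ^ 2 :=
          ((hf.continuous.enorm.measurable).pow_const 2).const_mul 2
        have hm2 : Measurable fun t => ‖deriv f t‖ₑ ^ 2 := hd.enorm.measurable.pow_const 2
        rw [lintegral_add_left hm, lintegral_const_mul _ hm2]

variable {d : ℕ}

/-- A directional derivative is controlled by the partial derivatives. -/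
lemma enorm_fderiv_apply_sq_le (φ : Sp d → ℂ) (x e : Sp d) (he : ‖e‖ = 1) :
    ‖fderiv ℝ φ x e‖ₑ ^ 2 ≤ d * ∑ i, ‖partialDeriv i φ x‖ₑ ^ 2 := by
  have h1 : fderiv ℝ φ x e = ∑ i, e i • partialDeriv i φ x := by
    have h2 : e = ∑ i, e i • EuclideanSpace.single i (1 : ℝ) := by
      have := (EuclideanSpace.basisFun (Fin d) ℝ).sum_repr e
      simpa using this.symm
    conv_lhs => rw [h2]
    rw [map_sum]
    exact Finset.sum_congr rfl fun i _ => by rw [map_smul]; rfl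
  have h3 : ‖fderiv ℝ φ x e‖ ≤ ∑ i, ‖partialDeriv i φ x‖ := by
    rw [h1]
    refine (norm_sum_le _ _).trans (Finset.sum_le_sum fun i _ => ?_)
    rw [norm_smul]
    have : ‖e i‖ ≤ 1 := (PiLp.norm_apply_le e i).trans he.le
    exact mul_le_of_le_one_left (norm_nonneg _) this
  have h4 : ‖fderiv ℝ φ x e‖ ^ 2 ≤ d * ∑ i, ‖partialDeriv i φ x‖ ^ 2 := by
    calc _ ≤ (∑ i, ‖partialDeriv i φ x‖) ^ 2 := by gcongr
      _ ≤ _ := by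
        have := sq_sum_le_card_mul_sum_sq (s := Finset.univ) (f := fun i => ‖partialDeriv i φ x‖)
        simpa using this
  have h5 : ∀ z : ℂ, ‖z‖ₑ ^ 2 = ENNReal.ofReal (‖z‖ ^ 2) := fun z => by
    rw [ENNReal.ofReal_pow (norm_nonneg _), ofReal_norm]
  simp only [h5]
  rw [← ENNReal.ofReal_sum_of_nonneg (fun i _ => by positivity), ← ENNReal.ofReal_natCast,
    ← ENNReal.ofReal_mul (by positivity)]
  exact ENNReal.ofReal_le_ofReal h4

/-- The density of the squared `H¹` norm. -/
def sobolevDensity (φ : Sp d → ℂ) (x : Sp d) : ℝ≥0∞ :=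
  ‖φ x‖ₑ ^ 2 + ∑ i, ‖partialDeriv i φ x‖ₑ ^ 2

lemma continuous_partialDeriv {F : Type*} [NormedAddCommGroup F] [NormedSpace ℝ F] {φ : Sp d → F}
    (hφ : ContDiff ℝ 1 φ) (i : Fin d) : Continuous (partialDeriv i φ) :=
  (hφ.continuous_fderiv one_ne_zero).clm_apply continuous_const

lemma measurable_sobolevDensity {φ : Sp d → ℂ} (hφ : ContDiff ℝ 1 φ) :
    Measurable (sobolevDensity φ) := by
  unfold sobolevDensity
  refine (hφ.continuous.enorm.measurable.pow_const 2).add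
    (Finset.measurable_sum _ fun i _ => ?_)
  exact (continuous_partialDeriv hφ i).enorm.measurable.pow_const 2

/-- A value of a smooth function is controlled by its `H¹` norm on a segment. -/
lemma exists_enorm_sq_le_lintegral_line {h : ℝ} (hh : 0 < h) : ∃ C : ℝ≥0∞, C ≠ ⊤ ∧
    ∀ φ : Sp d → ℂ, ContDiff ℝ 1 φ → ∀ x e : Sp d, ‖e‖ = 1 →
      ‖φ x‖ₑ ^ 2 ≤ C * ∫⁻ t in Ioo 0 h, sobolevDensity φ (x + t • e) := by
  set A : ℝ≥0∞ := 2 + 2 * ENNReal.ofReal h ^ 2 * d with hA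
  have hh' : ENNReal.ofReal h ≠ 0 := by simpa using hh
  refine ⟨(ENNReal.ofReal h)⁻¹ * A, ?_, fun φ hφ x e he => ?_⟩
  · refine ENNReal.mul_ne_top (ENNReal.inv_ne_top.2 hh') ?_
    rw [hA]
    finiteness
  · have hf : ContDiff ℝ 1 fun t : ℝ => φ (x + t • e) := by fun_prop
    have h1 := mul_enorm_sq_le_lintegral hf h
    simp only [zero_smul, add_zero] at h1
    have h2 : ∀ t : ℝ, deriv (fun t : ℝ => φ (x + t • e)) t = fderiv ℝ φ (x + t • e) e := by
      intro t
      have h3 : HasDerivAt (fun t : ℝ => x + t • e) e t := by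
        simpa using ((hasDerivAt_id t).smul_const e).const_add x
      exact ((hφ.differentiable one_ne_zero _).hasFDerivAt.comp_hasDerivAt t h3).deriv
    have h4 : ∀ t : ℝ, 2 * ‖φ (x + t • e)‖ₑ ^ 2 + 2 * ENNReal.ofReal h ^ 2 *
        ‖deriv (fun t : ℝ => φ (x + t • e)) t‖ₑ ^ 2 ≤ A * sobolevDensity φ (x + t • e) := by
      intro t
      rw [h2]
      have h5 := enorm_fderiv_apply_sq_le φ (x + t • e) e he
      calc _ ≤ 2 * ‖φ (x + t • e)‖ₑ ^ 2 + 2 * ENNReal.ofReal h ^ 2 *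
            (d * ∑ i, ‖partialDeriv i φ (x + t • e)‖ₑ ^ 2) := by gcongr
        _ = 2 * ‖φ (x + t • e)‖ₑ ^ 2 + 2 * ENNReal.ofReal h ^ 2 * d *
            ∑ i, ‖partialDeriv i φ (x + t • e)‖ₑ ^ 2 := by ring
        _ ≤ A * ‖φ (x + t • e)‖ₑ ^ 2 + A * ∑ i, ‖partialDeriv i φ (x + t • e)‖ₑ ^ 2 := by
            gcongr
            · exact le_self_add
            · exact le_add_self
        _ = _ := by rw [sobolevDensity, mul_add]
    have h6 : ENNReal.ofReal h * ‖φ x‖ₑ ^ 2 ≤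
        A * ∫⁻ t in Ioo 0 h, sobolevDensity φ (x + t • e) := by
      refine h1.trans ((lintegral_mono h4).trans (le_of_eq ?_))
      refine lintegral_const_mul _ ?_
      exact (measurable_sobolevDensity hφ).comp (by fun_prop)
    calc ‖φ x‖ₑ ^ 2 = (ENNReal.ofReal h)⁻¹ * (ENNReal.ofReal h * ‖φ x‖ₑ ^ 2) := by
          rw [← mul_assoc, ENNReal.inv_mul_cancel hh' ENNReal.ofReal_ne_top, one_mul]
      _ ≤ _ := by rw [mul_assoc]; gcongr

/-- Fubini's theorem for the decomposition of `ℝ^d` into lines parallel to `e`. -/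
lemma lintegral_eq_lintegral_orthogonal {e : Sp d} (he : ‖e‖ = 1) {F : Sp d → ℝ≥0∞}
    (hF : Measurable F) :
    ∫⁻ x, F x = ∫⁻ y : ((Submodule.span ℝ {e})ᗮ : Submodule ℝ (Sp d)),
      ∫⁻ t : ℝ, F ((y : Sp d) + t • e) := by
  set s := Submodule.span ℝ {e}
  have h1 := (s.measurePreserving_measurableEquivProd (0 : Sp d)).symm
  rw [InnerProductSpace.euclideanHausdorffMeasure_eq_volume] at h1
  have h2 : MeasurePreserving (LinearIsometryEquiv.toSpanUnitSingleton (𝕜 := ℝ) e he) :=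
    LinearIsometryEquiv.measurePreserving _
  have h3 := h1.comp (h2.prod (MeasurePreserving.id (volume : Measure sᗮ)))
  rw [← h3.lintegral_comp hF]
  refine (lintegral_prod_symm' _ (hF.comp h3.measurable)).trans ?_
  refine lintegral_congr fun y => lintegral_congr fun t => ?_
  simp [add_comm]

/-- Near a boundary point, the surface measure is dominated by a multiple of the image of Lebesgue
measure under the graph map, so integrals over the part of the boundary and over a segment in the
direction `e` pointing into `Ω` are dominated by integrals over `Ω`. -/
lemma exists_nhds_lintegral_le {Ω : Set (Sp d)} (hΩ : IsOpen Ω)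
    (hL : HasLipschitzBoundary Ω) {p : Sp d} (hp : p ∈ frontier Ω) :
    ∃ e : Sp d, ‖e‖ = 1 ∧ ∃ r > 0, ∃ C : ℝ≥0∞, C ≠ ⊤ ∧ surf Ω (Metric.ball p r) ≤ C ∧
      ∀ F : Sp d → ℝ≥0∞, Measurable F →
        ∫⁻ x in Metric.ball p r, (∫⁻ t in Ioo 0 r, F (x + t • e)) ∂surf Ω ≤
          C * ∫⁻ x, F x ∂vol Ω := by
  obtain ⟨e, he, K, ψ, hψ, U, hU, hUΩ⟩ := hL p hp
  obtain ⟨ρ, hρ, hρU⟩ := Metric.mem_nhds_iff.1 hU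
  set W : Submodule ℝ (Sp d) := (Submodule.span ℝ {e})ᗮ with hW
  have hee : inner ℝ e e = (1 : ℝ) := by rw [real_inner_self_eq_norm_sq, he]; norm_num
  have heW : ∀ y : W, inner ℝ e (y : Sp d) = (0 : ℝ) := fun y =>
    Submodule.mem_orthogonal_singleton_iff_inner_right.1 y.2
  have hfin : Module.finrank ℝ W = d - 1 := by
    have h1 := (Submodule.span ℝ {e}).finrank_add_finrank_orthogonal
    rw [finrank_span_singleton (by rintro rfl; simp at he), finrank_euclideanSpace,
      Fintype.card_fin] at h1
    change 1 + Module.finrank ℝ W = d at h1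
    omega
  let g : W → Sp d := fun y => (y : Sp d) + ψ y • e
  have hg : LipschitzWith (1 + K) g := by
    refine LipschitzWith.of_dist_le_mul fun y z => ?_
    have h1 := hψ.dist_le_mul y z
    have h2 : g y - g z = ((y : Sp d) - z) + (ψ y - ψ z) • e := by
      simp only [g, sub_smul]; abel
    rw [dist_eq_norm, h2]
    refine (norm_add_le _ _).trans ?_
    rw [norm_smul, he, mul_one, ← dist_eq_norm, ← dist_eq_norm]
    push_cast
    have h3 : dist (y : Sp d) z = dist y z := rfl
    rw [h3] at h1 ⊢
    linarith
  have hgm : Measurable g := hg.continuous.measurable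
  -- In the chart, the boundary is the graph of `ψ`.
  have hgraph : ∀ x ∈ frontier Ω ∩ Metric.ball p ρ, ψ (x - inner ℝ e x • e) = inner ℝ e x := by
    rintro x ⟨hx, hxb⟩
    have hc1 : Continuous fun x : Sp d => ψ (x - inner ℝ e x • e) :=
      hψ.continuous.comp (by fun_prop)
    have hc2 : Continuous fun x : Sp d => (inner ℝ e x : ℝ) := by fun_prop
    have hxΩ : x ∉ Ω := by
      rw [hΩ.frontier_eq] at hx
      exact hx.2
    apply le_antisymm
    · by_contra! hlt
      have h1 : ∀ᶠ y in 𝓝 x, y ∉ Ω := by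
        filter_upwards [hc2.continuousAt.eventually_lt hc1.continuousAt hlt,
          Metric.isOpen_ball.mem_nhds hxb] with y hy hyb hyΩ
        exact lt_asymm hy ((hUΩ y (hρU hyb)).1 hyΩ)
      have h2 : ∃ᶠ y in 𝓝 x, y ∈ Ω := mem_closure_iff_frequently.1 (frontier_subset_closure hx)
      exact h2 h1
    · by_contra! hlt
      exact hxΩ ((hUΩ x (hρU hxb)).2 hlt)
  have hrange : frontier Ω ∩ Metric.ball p ρ ⊆ range g := by
    intro x hx
    refine ⟨⟨x - (inner ℝ e x : ℝ) • e, ?_⟩, ?_⟩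
    · rw [hW, Submodule.mem_orthogonal_singleton_iff_inner_right, inner_sub_right,
        inner_smul_right, hee]
      ring
    · change (x - (inner ℝ e x : ℝ) • e) + ψ (x - (inner ℝ e x : ℝ) • e) • e = x
      rw [hgraph x hx]
      abel
  set r := ρ / 2 with hr
  have hr0 : 0 < r := by positivity
  have hrρ : r ≤ ρ := by rw [hr]; linarith
  set B := Metric.ball p r with hB
  have hBρ : B ⊆ Metric.ball p ρ := Metric.ball_subset_ball hrρ
  set L : ℝ≥0∞ := ((1 + K : ℝ≥0) : ℝ≥0∞) ^ (d - 1) with hL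
  have hLtop : L ≠ ⊤ := by rw [hL]; finiteness
  -- The area bound for the graph.
  have harea : ∀ A : Set (Sp d), A ⊆ frontier Ω ∩ Metric.ball p ρ →
      Measure.euclideanHausdorffMeasure (d - 1) A ≤ L * volume (g ⁻¹' A) := by
    intro A hA
    have h1 : g '' (g ⁻¹' A) = A := image_preimage_eq_of_subset (hA.trans hrange)
    have h2 := LipschitzWith.euclideanHausdorffMeasure_image_le hg (d - 1) (g ⁻¹' A)
    rw [h1] at h2
    refine h2.trans ?_
    rw [← InnerProductSpace.euclideanHausdorffMeasure_eq_volume, hfin]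
  have hfm : MeasurableSet (frontier Ω) := isClosed_frontier.measurableSet
  have hsurf : (surf Ω).restrict B ≤ L • Measure.map g volume := by
    refine Measure.le_iff.2 fun A hA => ?_
    rw [Measure.restrict_apply hA, surf, Measure.restrict_apply (hA.inter measurableSet_ball),
      Measure.smul_apply, Measure.map_apply hgm hA, smul_eq_mul]
    refine (harea _ fun x hx => ⟨hx.2, hBρ hx.1.2⟩).trans ?_
    gcongr
    exact fun x hx => hx.1.1
  have hfinite : L * volume (g ⁻¹' B) < ⊤ := by
    refine ENNReal.mul_lt_top hLtop.lt_top ?_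
    have hbdd : Bornology.IsBounded (g ⁻¹' B) := by
      refine (Metric.isBounded_iff_subset_closedBall (0 : W)).2 ⟨‖p‖ + r, fun y hy => ?_⟩
      have h1 : ‖(y : Sp d)‖ ≤ ‖g y‖ := by
        have h2 : ‖g y‖ ^ 2 = ‖(y : Sp d)‖ ^ 2 + (ψ y) ^ 2 := by
          simp only [g]
          rw [@norm_add_sq_real, inner_smul_right, real_inner_comm, heW, norm_smul, he]
          simp
        refine abs_le_of_sq_le_sq' ?_ (norm_nonneg _) |>.2
        rw [h2]
        nlinarith [sq_nonneg (ψ y)]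
      have h3 : ‖g y‖ ≤ ‖p‖ + r := by
        have h4 : dist (g y) p < r := hy
        rw [dist_eq_norm] at h4
        have := norm_add_le p (g y - p)
        rw [add_sub_cancel] at this
        linarith
      simpa using h1.trans h3
    exact hbdd.measure_lt_top
  refine ⟨e, he, r, hr0, L + L * volume (g ⁻¹' B), ?_, ?_, fun F hF => ?_⟩
  · exact ENNReal.add_ne_top.2 ⟨hLtop, hfinite.ne⟩
  · have h1 := hsurf B
    rw [Measure.restrict_apply_self, Measure.smul_apply, Measure.map_apply hgm measurableSet_ball,
      smul_eq_mul] at h1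
    exact h1.trans le_add_self
  · set F₁ : Sp d → ℝ≥0∞ := Ω.indicator F with hF₁
    have hF₁m : Measurable F₁ := hF.indicator hΩ.measurableSet
    have hin : ∀ x ∈ frontier Ω ∩ B, ∀ t ∈ Ioo 0 r, x + t • e ∈ Ω := by
      rintro x ⟨hx, hxB⟩ t ht
      have h1 : x + t • e ∈ Metric.ball p ρ := by
        rw [Metric.mem_ball, dist_eq_norm]
        have h2 : x + t • e - p = (x - p) + t • e := by abel
        have h3 : ‖x - p‖ < r := by rw [← dist_eq_norm]; exact hxB
        rw [h2]
        refine (norm_add_le _ _).trans_lt ?_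
        rw [norm_smul, he, Real.norm_eq_abs, abs_of_pos ht.1]
        linarith [ht.2]
      refine (hUΩ _ (hρU h1)).2 ?_
      have h4 : inner ℝ e (x + t • e) = (inner ℝ e x : ℝ) + t := by
        rw [inner_add_right, inner_smul_right, hee, mul_one]
      have h5 : x + t • e - ((inner ℝ e x : ℝ) + t) • e = x - (inner ℝ e x : ℝ) • e := by
        rw [add_smul]; abel
      rw [h4, h5, hgraph x ⟨hx, hBρ hxB⟩]
      linarith [ht.1]
    set G : Sp d → ℝ≥0∞ := fun x => ∫⁻ t : ℝ, F₁ (x + t • e) with hG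
    have hGm : Measurable G := by
      refine Measurable.lintegral_prod_right' (f := fun z : Sp d × ℝ => F₁ (z.1 + z.2 • e)) ?_
      exact hF₁m.comp (by fun_prop)
    have hstep1 : ∫⁻ x in B, (∫⁻ t in Ioo 0 r, F (x + t • e)) ∂surf Ω ≤
        ∫⁻ x in B, G x ∂surf Ω := by
      rw [surf, Measure.restrict_restrict measurableSet_ball]
      refine setLIntegral_mono' (measurableSet_ball.inter hfm) fun x hx => ?_
      calc ∫⁻ t in Ioo 0 r, F (x + t • e) ≤ ∫⁻ t in Ioo 0 r, F₁ (x + t • e) :=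
            setLIntegral_mono' measurableSet_Ioo fun t ht => by
              rw [hF₁, indicator_of_mem (hin x ⟨hx.2, hx.1⟩ t ht)]
        _ ≤ G x := setLIntegral_le_lintegral _ _
    have hstep2 : ∫⁻ x in B, G x ∂surf Ω ≤ L * ∫⁻ y : W, G (g y) := by
      refine (lintegral_mono' hsurf le_rfl).trans (le_of_eq ?_)
      rw [lintegral_smul_measure, lintegral_map hGm hgm, smul_eq_mul]
    have hstep3 : ∫⁻ y : W, G (g y) = ∫⁻ x, F x ∂vol Ω := by
      rw [vol, ← lintegral_indicator hΩ.measurableSet, ← hF₁,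
        lintegral_eq_lintegral_orthogonal he hF₁m]
      refine lintegral_congr fun y => ?_
      rw [← lintegral_add_left_eq_self (fun t : ℝ => F₁ ((y : Sp d) + t • e)) (ψ y)]
      refine lintegral_congr fun t => ?_
      simp only [g, add_smul, add_assoc]
    refine hstep1.trans (hstep2.trans ?_)
    rw [hstep3]
    gcongr
    exact le_self_add

/-- The surface measure of a bounded Lipschitz domain is finite, and the trace operator is bounded
on smooth functions. -/
lemma exists_trace_bound {Ω : Set (Sp d)} (hΩ : IsBoundedLipschitzDomain Ω) :
    surf Ω univ < ⊤ ∧ ∃ C : ℝ≥0∞, C ≠ ⊤ ∧ ∀ φ : Sp d → ℂ, ContDiff ℝ 1 φ →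
      ∫⁻ x, ‖φ x‖ₑ ^ 2 ∂surf Ω ≤ C * ∫⁻ x, sobolevDensity φ x ∂vol Ω := by
  have hcomp : IsCompact (frontier Ω) :=
    Metric.isCompact_of_isClosed_isBounded isClosed_frontier
      (hΩ.isBounded.closure.subset frontier_subset_closure)
  have key : surf Ω (frontier Ω) < ⊤ ∧ ∃ C : ℝ≥0∞, C ≠ ⊤ ∧ ∀ φ : Sp d → ℂ, ContDiff ℝ 1 φ →
      ∫⁻ x in frontier Ω, ‖φ x‖ₑ ^ 2 ∂surf Ω ≤ C * ∫⁻ x, sobolevDensity φ x ∂vol Ω := by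
    refine hcomp.induction_on (p := fun s => surf Ω s < ⊤ ∧ ∃ C : ℝ≥0∞, C ≠ ⊤ ∧
      ∀ φ : Sp d → ℂ, ContDiff ℝ 1 φ →
        ∫⁻ x in s, ‖φ x‖ₑ ^ 2 ∂surf Ω ≤ C * ∫⁻ x, sobolevDensity φ x ∂vol Ω) ?_ ?_ ?_ ?_
    · exact ⟨by simp, 0, by simp, by simp⟩
    · rintro s t hst ⟨h1, C, hC, h2⟩
      exact ⟨(measure_mono hst).trans_lt h1, C, hC, fun φ hφ =>
        (lintegral_mono_set hst).trans (h2 φ hφ)⟩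
    · rintro s t ⟨h1, C, hC, h2⟩ ⟨h1', C', hC', h2'⟩
      refine ⟨measure_union_lt_top h1 h1', C + C', ENNReal.add_ne_top.2 ⟨hC, hC'⟩, fun φ hφ => ?_⟩
      rw [add_mul]
      exact (lintegral_union_le _ _ _).trans (add_le_add (h2 φ hφ) (h2' φ hφ))
    · intro p hp
      obtain ⟨e, he, r, hr, C, hC, h1, h2⟩ :=
        exists_nhds_lintegral_le hΩ.isOpen hΩ.lipschitz hp
      obtain ⟨C', hC', h3⟩ := exists_enorm_sq_le_lintegral_line (d := d) hr
      refine ⟨Metric.ball p r, mem_nhdsWithin_of_mem_nhds (Metric.ball_mem_nhds p hr),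
        h1.trans_lt hC.lt_top, C' * C, ENNReal.mul_ne_top hC' hC, fun φ hφ => ?_⟩
      calc ∫⁻ x in Metric.ball p r, ‖φ x‖ₑ ^ 2 ∂surf Ω
          ≤ ∫⁻ x in Metric.ball p r,
              (C' * ∫⁻ t in Ioo 0 r, sobolevDensity φ (x + t • e)) ∂surf Ω :=
            lintegral_mono fun x => h3 φ hφ x e he
        _ = C' * ∫⁻ x in Metric.ball p r,
              (∫⁻ t in Ioo 0 r, sobolevDensity φ (x + t • e)) ∂surf Ω :=
            lintegral_const_mul' _ _ hC'
        _ ≤ _ := by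
            rw [mul_assoc]
            gcongr
            exact h2 _ (measurable_sobolevDensity hφ)
  have hself : (surf Ω).restrict (frontier Ω) = surf Ω := by
    rw [surf, Measure.restrict_restrict isClosed_frontier.measurableSet, inter_self]
  rw [hself, ← Measure.restrict_apply_univ, hself] at key
  exact key

end

noncomputable section

/-! ### Multiplication operators on `L²` -/

section Multiplication

variable {X : Type*} [MeasurableSpace X] {μ : Measure X}

lemma inner_eq_integral {f g : Lp ℂ 2 μ} {f' g' : X → ℂ} (hf : f =ᵐ[μ] f') (hg : g =ᵐ[μ] g') :
    ⟪f, g⟫_ℂ = ∫ x, g' x * star (f' x) ∂μ := by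
  rw [L2.inner_def]
  refine integral_congr_ae ?_
  filter_upwards [hf, hg] with x h1 h2
  rw [h1, h2, RCLike.inner_apply]
  rfl

lemma memLp_ofReal {m : X → ℝ} {p : ℝ≥0∞} (hm : MemLp m p μ) :
    MemLp (fun x => (m x : ℂ)) p μ :=
  hm.ofReal

/-- Multiplication by the bounded function `m` on `L²(μ)`. -/
def mulOp (m : X → ℝ) (hm : MemLp m ∞ μ) : Lp ℂ 2 μ →L[ℂ] Lp ℂ 2 μ :=
  (ContinuousLinearMap.mul ℂ ℂ).holderL μ ∞ 2 2 (memLp_ofReal hm).toLp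

lemma coeFn_mulOp {m : X → ℝ} (hm : MemLp m ∞ μ) (f : Lp ℂ 2 μ) :
    mulOp m hm f =ᵐ[μ] fun x => (m x : ℂ) * f x := by
  refine (ContinuousLinearMap.coeFn_holder (ContinuousLinearMap.mul ℂ ℂ)
    (memLp_ofReal hm).toLp f).trans ?_
  filter_upwards [(memLp_ofReal hm).coeFn_toLp] with x hx
  simp only [ContinuousLinearMap.mul_apply', hx]

lemma inner_mulOp {m : X → ℝ} (hm : MemLp m ∞ μ) {f g : Lp ℂ 2 μ} {f' g' : X → ℂ}
    (hf : f =ᵐ[μ] f') (hg : g =ᵐ[μ] g') :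
    ⟪f, mulOp m hm g⟫_ℂ = ∫ x, (m x : ℂ) * g' x * star (f' x) ∂μ := by
  refine inner_eq_integral hf ((coeFn_mulOp hm g).trans ?_)
  filter_upwards [hg] with x hx
  rw [hx]

lemma mulOp_inner_left {m : X → ℝ} (hm : MemLp m ∞ μ) (f g : Lp ℂ 2 μ) :
    ⟪mulOp m hm f, g⟫_ℂ = ⟪f, mulOp m hm g⟫_ℂ := by
  rw [inner_eq_integral (coeFn_mulOp hm f) EventuallyEq.rfl,
    inner_eq_integral EventuallyEq.rfl (coeFn_mulOp hm g)]
  congr 1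
  funext x
  simp only [star_mul', RCLike.star_def, Complex.conj_ofReal]
  ring

lemma re_inner_mulOp {m : X → ℝ} (hm : MemLp m ∞ μ) (f : Lp ℂ 2 μ) :
    (⟪f, mulOp m hm f⟫_ℂ).re = ∫ x, m x * ‖f x‖ ^ 2 ∂μ ∧
      Integrable (fun x => m x * ‖f x‖ ^ 2) μ := by
  have h : (fun x => ⟪f x, mulOp m hm f x⟫_ℂ) =ᵐ[μ] fun x => ((m x * ‖f x‖ ^ 2 : ℝ) : ℂ) := by
    filter_upwards [coeFn_mulOp hm f] with x hx
    rw [hx, RCLike.inner_apply, mul_assoc, Complex.mul_conj, Complex.normSq_eq_norm_sq]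
    push_cast
    rfl
  have h1 := L2.integrable_inner f (mulOp m hm f) (𝕜 := ℂ)
  have h2 := (integrable_congr h).1 h1
  constructor
  · rw [L2.inner_def, integral_congr_ae h, integral_complex_ofReal, Complex.ofReal_re]
  · have h3 := h2.re
    exact h3

lemma le_re_inner_mulOp {m : X → ℝ} (hm : MemLp m ∞ μ) {c : ℝ} (hc : ∀ᵐ x ∂μ, c ≤ m x)
    (f : Lp ℂ 2 μ) : c * ‖f‖ ^ 2 ≤ (⟪f, mulOp m hm f⟫_ℂ).re := by
  obtain ⟨h1, h2⟩ := re_inner_mulOp hm f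
  have h3 : ‖f‖ ^ 2 = ∫ x, ‖f x‖ ^ 2 ∂μ := by
    rw [← inner_self_eq_norm_sq (𝕜 := ℂ), L2.inner_def]
    have : ∀ x, ⟪f x, f x⟫_ℂ = ((‖f x‖ ^ 2 : ℝ) : ℂ) := fun x => by
      rw [inner_self_eq_norm_sq_to_K]; push_cast; rfl
    simp_rw [this]
    rw [integral_complex_ofReal]
    rfl
  rw [h1, h3, ← integral_const_mul]
  have h4 : Integrable (fun x => ‖f x‖ ^ 2) μ := (Lp.memLp f).integrable_norm_pow (by norm_num)
  refine integral_mono_ae (h4.const_mul c) h2 ?_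
  filter_upwards [hc] with x hx
  gcongr

end Multiplication

/-! ### Sobolev functions with their gradients and traces -/

variable {d : ℕ}

lemma memLp_of_continuous {E : Type*} [NormedAddCommGroup E] {s : Set (Sp d)}
    (hs : Bornology.IsBounded s) {μ : Measure (Sp d)} [IsFiniteMeasure μ] (hμ : ∀ᵐ x ∂μ, x ∈ s)
    {φ : Sp d → E} (hφ : Continuous φ) (p : ℝ≥0∞) : MemLp φ p μ := by
  obtain ⟨C, hC⟩ := hs.isCompact_closure.exists_bound_of_continuousOn hφ.continuousOn
  refine MemLp.of_bound hφ.aestronglyMeasurable C ?_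
  filter_upwards [hμ] with x hx using hC x (subset_closure hx)

section Domain

variable {Ω : Set (Sp d)}

lemma IsBoundedLipschitzDomain.isFiniteMeasure_vol (hΩ : IsBoundedLipschitzDomain Ω) :
    IsFiniteMeasure (vol Ω) :=
  ⟨by rw [vol, Measure.restrict_apply_univ]; exact hΩ.isBounded.measure_lt_top⟩

lemma IsBoundedLipschitzDomain.isFiniteMeasure_surf (hΩ : IsBoundedLipschitzDomain Ω) :
    IsFiniteMeasure (surf Ω) :=
  ⟨(exists_trace_bound hΩ).1⟩

lemma ae_vol_mem (hΩ : IsBoundedLipschitzDomain Ω) : ∀ᵐ x ∂vol Ω, x ∈ Ω :=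
  ae_restrict_mem hΩ.isOpen.measurableSet

lemma ae_surf_mem : ∀ᵐ x ∂surf Ω, x ∈ frontier Ω :=
  ae_restrict_mem isClosed_frontier.measurableSet

lemma memLp_vol (hΩ : IsBoundedLipschitzDomain Ω) {E : Type*} [NormedAddCommGroup E]
    {φ : Sp d → E} (hφ : Continuous φ) (p : ℝ≥0∞) : MemLp φ p (vol Ω) :=
  have := hΩ.isFiniteMeasure_vol
  memLp_of_continuous hΩ.isBounded (ae_vol_mem hΩ) hφ p

lemma memLp_surf (hΩ : IsBoundedLipschitzDomain Ω) {E : Type*} [NormedAddCommGroup E]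
    {φ : Sp d → E} (hφ : Continuous φ) (p : ℝ≥0∞) : MemLp φ p (surf Ω) :=
  have := hΩ.isFiniteMeasure_surf
  memLp_of_continuous (hΩ.isBounded.closure.subset frontier_subset_closure) ae_surf_mem hφ p

end Domain

/-- The Hilbert space `L²(Ω) × L²(Ω)^d × L²(Γ)` of candidates for `(u, ∇u, tr u)`. -/
abbrev SobolevAmbient (Ω : Set (Sp d)) : Type :=
  WithLp 2 (Lp ℂ 2 (vol Ω) ×
    WithLp 2 (PiLp 2 (fun _ : Fin d => Lp ℂ 2 (vol Ω)) × Lp ℂ 2 (surf Ω)))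

lemma partialDeriv_add {i : Fin d} {φ χ : Sp d → ℂ} (hφ : ContDiff ℝ ∞ φ) (hχ : ContDiff ℝ ∞ χ) :
    partialDeriv i (φ + χ) = partialDeriv i φ + partialDeriv i χ := by
  funext x
  simp only [partialDeriv, Pi.add_apply]
  rw [fderiv_add (hφ.differentiable (by simp) x) (hχ.differentiable (by simp) x)]
  rfl

lemma partialDeriv_const_smul {i : Fin d} (c : ℂ) {φ : Sp d → ℂ} (hφ : ContDiff ℝ ∞ φ) :
    partialDeriv i (c • φ) = c • partialDeriv i φ := by
  funext x
  simp only [partialDeriv, Pi.smul_apply]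
  rw [fderiv_const_smul (hφ.differentiable (by simp) x)]
  rfl

/-- The triples `(φ, ∇φ, φ|_Γ)` for smooth functions `φ` on `ℝ^d`. -/
def smoothTriples (Ω : Set (Sp d)) : Submodule ℂ (SobolevAmbient Ω) where
  carrier := {x | ∃ φ : Sp d → ℂ, ContDiff ℝ ∞ φ ∧ x.fst =ᵐ[vol Ω] φ ∧
    (∀ i, x.snd.fst i =ᵐ[vol Ω] partialDeriv i φ) ∧ x.snd.snd =ᵐ[surf Ω] φ}
  add_mem' := by
    rintro x y ⟨φ, h1, h2, h3, h4⟩ ⟨χ, h1', h2', h3', h4'⟩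
    refine ⟨φ + χ, h1.add h1', (Lp.coeFn_add _ _).trans (h2.add h2'), fun i => ?_,
      (Lp.coeFn_add _ _).trans (h4.add h4')⟩
    rw [partialDeriv_add h1 h1']
    exact (Lp.coeFn_add _ _).trans ((h3 i).add (h3' i))
  zero_mem' := by
    refine ⟨0, contDiff_const, Lp.coeFn_zero _ _ _, fun i => ?_, Lp.coeFn_zero _ _ _⟩
    have : partialDeriv i (0 : Sp d → ℂ) = 0 := by
      funext x
      simp [partialDeriv]
    rw [this]
    exact Lp.coeFn_zero _ _ _
  smul_mem' := by
    rintro c x ⟨φ, h1, h2, h3, h4⟩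
    refine ⟨c • φ, h1.const_smul c, (Lp.coeFn_smul _ _).trans (h2.const_smul c), fun i => ?_,
      (Lp.coeFn_smul _ _).trans (h4.const_smul c)⟩
    rw [partialDeriv_const_smul c h1]
    exact (Lp.coeFn_smul _ _).trans ((h3 i).const_smul c)

/-- The space of all triples `(u, ∇u, tr u)`, where `u` is in `H¹(Ω)`, as a subspace of the space of
candidates. -/
def sobolevSubmodule (Ω : Set (Sp d)) : Submodule ℂ (SobolevAmbient Ω) :=
  (smoothTriples Ω).topologicalClosure

/-- The Sobolev space `H¹(Ω)`, with the norm `(‖u‖² + ‖∇u‖² + ‖tr u‖²)^(1/2)`. -/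
def sobolev (Ω : Set (Sp d)) : Type := sobolevSubmodule Ω

instance (Ω : Set (Sp d)) : NormedAddCommGroup (sobolev Ω) :=
  inferInstanceAs (NormedAddCommGroup (sobolevSubmodule Ω))

instance (Ω : Set (Sp d)) : InnerProductSpace ℂ (sobolev Ω) :=
  inferInstanceAs (InnerProductSpace ℂ (sobolevSubmodule Ω))

instance (Ω : Set (Sp d)) : CompleteSpace (sobolev Ω) :=
  (smoothTriples Ω).isClosed_topologicalClosure.completeSpace_coe

/-- The triple `(u, ∇u, tr u)` of a Sobolev function `u`. -/
def sobTriple (Ω : Set (Sp d)) : sobolev Ω →L[ℂ] SobolevAmbient Ω :=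
  (sobolevSubmodule Ω).subtypeL

/-- The function itself, as an element of `L²(Ω)`. -/
def sobFun (Ω : Set (Sp d)) : sobolev Ω →L[ℂ] Lp ℂ 2 (vol Ω) :=
  (WithLp.fstL 2 ℂ _ _).comp (sobTriple Ω)

/-- The `i`-th weak partial derivative. -/
def sobGrad (Ω : Set (Sp d)) (i : Fin d) : sobolev Ω →L[ℂ] Lp ℂ 2 (vol Ω) :=
  (PiLp.proj 2 _ i).comp ((WithLp.fstL 2 ℂ _ _).comp
    ((WithLp.sndL 2 ℂ _ _).comp (sobTriple Ω)))

/-- The trace, as an element of `L²(Γ)`. -/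
def sobTrace (Ω : Set (Sp d)) : sobolev Ω →L[ℂ] Lp ℂ 2 (surf Ω) :=
  (WithLp.sndL 2 ℂ _ _).comp ((WithLp.sndL 2 ℂ _ _).comp (sobTriple Ω))

section Sobolev

variable {Ω : Set (Sp d)}

lemma norm_sobolev_sq (x : sobolev Ω) :
    ‖x‖ ^ 2 = ‖sobFun Ω x‖ ^ 2 + ∑ i, ‖sobGrad Ω i x‖ ^ 2 + ‖sobTrace Ω x‖ ^ 2 := by
  have h1 : ‖x‖ = ‖sobTriple Ω x‖ := rfl
  rw [h1, WithLp.prod_norm_sq_eq_of_L2, WithLp.prod_norm_sq_eq_of_L2, PiLp.norm_sq_eq_of_L2,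
    ← add_assoc]
  rfl

lemma sobolev_ext {x y : sobolev Ω} (h1 : sobFun Ω x = sobFun Ω y)
    (h2 : ∀ i, sobGrad Ω i x = sobGrad Ω i y) (h3 : sobTrace Ω x = sobTrace Ω y) : x = y := by
  rw [← sub_eq_zero, ← norm_eq_zero, ← sq_eq_zero_iff, norm_sobolev_sq]
  simp [map_sub, h1, h2, h3]

/-- To prove a closed condition for all Sobolev functions, it suffices to prove it for smooth
functions. -/
lemma sobolev_induction {P : sobolev Ω → Prop} (hP : IsClosed {x | P x})
    (h : ∀ x : sobolev Ω, ∀ φ : Sp d → ℂ, ContDiff ℝ ∞ φ → sobFun Ω x =ᵐ[vol Ω] φ →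
      (∀ i, sobGrad Ω i x =ᵐ[vol Ω] partialDeriv i φ) → sobTrace Ω x =ᵐ[surf Ω] φ → P x)
    (x : sobolev Ω) : P x := by
  have hind : Topology.IsInducing (sobTriple Ω) :=
    Topology.IsInducing.subtypeVal (t := (sobolevSubmodule Ω : Set (SobolevAmbient Ω)))
  have hx : x ∈ closure {y : sobolev Ω | sobTriple Ω y ∈ smoothTriples Ω} := by
    rw [hind.closure_eq_preimage_closure_image]
    have h1 : (sobTriple Ω '' {y : sobolev Ω | sobTriple Ω y ∈ smoothTriples Ω}) =
        (smoothTriples Ω : Set (SobolevAmbient Ω)) := by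
      ext z
      constructor
      · rintro ⟨y, hy, rfl⟩
        exact hy
      · intro hz
        exact ⟨⟨z, (smoothTriples Ω).le_topologicalClosure hz⟩, hz, rfl⟩
    exact (congrArg (fun s => sobTriple Ω x ∈ closure s) h1).mpr x.2
  refine closure_minimal ?_ hP hx
  rintro y ⟨φ, h1, h2, h3, h4⟩
  exact h y φ h1 h2 h3 h4

/-- Smooth functions as elements of the Sobolev space. -/
lemma exists_sobolev_of_contDiff (hΩ : IsBoundedLipschitzDomain Ω) {φ : Sp d → ℂ}
    (hφ : ContDiff ℝ ∞ φ) : ∃ x : sobolev Ω, sobFun Ω x =ᵐ[vol Ω] φ ∧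
      (∀ i, sobGrad Ω i x =ᵐ[vol Ω] partialDeriv i φ) ∧ sobTrace Ω x =ᵐ[surf Ω] φ := by
  have hφ1 : ContDiff ℝ 1 φ := hφ.of_le (by simp)
  have hu : MemLp φ 2 (vol Ω) := memLp_vol hΩ hφ.continuous 2
  have hg : MemLp φ 2 (surf Ω) := memLp_surf hΩ hφ.continuous 2
  have hG : ∀ i, MemLp (partialDeriv i φ) 2 (vol Ω) := fun i =>
    memLp_vol hΩ (continuous_partialDeriv hφ1 i) 2
  let x : SobolevAmbient Ω :=
    WithLp.toLp 2 (hu.toLp, WithLp.toLp 2 (WithLp.toLp 2 fun i => (hG i).toLp, hg.toLp))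
  have h1 : x.fst =ᵐ[vol Ω] φ := hu.coeFn_toLp
  have h2 : ∀ i, x.snd.fst i =ᵐ[vol Ω] partialDeriv i φ := fun i => (hG i).coeFn_toLp
  have h3 : x.snd.snd =ᵐ[surf Ω] φ := hg.coeFn_toLp
  exact ⟨⟨x, (smoothTriples Ω).le_topologicalClosure ⟨φ, hφ, h1, h2, h3⟩⟩, h1, h2, h3⟩

lemma norm_sq_toReal_lintegral {X : Type*} [MeasurableSpace X] {μ : Measure X} {f : Lp ℂ 2 μ}
    {φ : X → ℂ} (h : f =ᵐ[μ] φ) : ‖f‖ₑ ^ 2 = ∫⁻ x, ‖φ x‖ₑ ^ 2 ∂μ := by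
  have h1 := eLpNorm_nnreal_pow_eq_lintegral (f := f) (μ := μ) (p := 2) (by norm_num)
  rw [Lp.enorm_def]
  norm_num at h1
  rw [h1]
  refine lintegral_congr_ae ?_
  filter_upwards [h] with x hx
  rw [hx]

/-- The trace inequality. -/
lemma exists_norm_sobTrace_le (hΩ : IsBoundedLipschitzDomain Ω) : ∃ C : ℝ, 0 ≤ C ∧
    ∀ x : sobolev Ω, ‖sobTrace Ω x‖ ^ 2 ≤ C * (‖sobFun Ω x‖ ^ 2 + ∑ i, ‖sobGrad Ω i x‖ ^ 2) := by
  obtain ⟨-, C, hC, h⟩ := exists_trace_bound hΩ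
  refine ⟨C.toReal, ENNReal.toReal_nonneg, sobolev_induction ?_ ?_⟩
  · exact isClosed_le (by fun_prop) (by fun_prop)
  · intro x φ hφ h1 h2 h3
    have hφ1 : ContDiff ℝ 1 φ := hφ.of_le (by simp)
    have h4 := h φ hφ1
    have h5 : ∫⁻ y, sobolevDensity φ y ∂vol Ω =
        ‖sobFun Ω x‖ₑ ^ 2 + ∑ i, ‖sobGrad Ω i x‖ₑ ^ 2 := by
      unfold sobolevDensity
      rw [lintegral_add_left (hφ.continuous.enorm.measurable.pow_const 2),
        lintegral_finsetSum _ fun i _ =>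
          (continuous_partialDeriv hφ1 i).enorm.measurable.pow_const 2,
        norm_sq_toReal_lintegral h1]
      congr 1
      exact Finset.sum_congr rfl fun i _ => (norm_sq_toReal_lintegral (h2 i)).symm
    rw [h5, ← norm_sq_toReal_lintegral h3] at h4
    have hfin : ∑ i, ‖sobGrad Ω i x‖ₑ ^ 2 ≠ ⊤ := ENNReal.sum_ne_top.2 fun i _ => by finiteness
    have h6 := ENNReal.toReal_mono
      (ENNReal.mul_ne_top hC (ENNReal.add_ne_top.2 ⟨by finiteness, hfin⟩)) h4
    rw [ENNReal.toReal_mul, ENNReal.toReal_add (by finiteness) hfin,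
      ENNReal.toReal_sum (fun i _ => by finiteness)] at h6
    simpa only [ENNReal.toReal_pow, toReal_enorm] using h6

/-- Integration by parts for a Sobolev function and a compactly supported `C¹` function. -/
lemma integral_partialDeriv_mul (hΩ : IsBoundedLipschitzDomain Ω) (x : sobolev Ω) (i : Fin d)
    {ψ : Sp d → ℝ} (hψ : ContDiff ℝ 1 ψ) (hc : HasCompactSupport ψ) (hs : tsupport ψ ⊆ Ω) :
    ∫ y, ((partialDeriv i ψ y : ℝ) : ℂ) * sobFun Ω x y ∂vol Ω =
      -∫ y, ((ψ y : ℝ) : ℂ) * sobGrad Ω i x y ∂vol Ω := by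
  have ha : MemLp (fun y => ((partialDeriv i ψ y : ℝ) : ℂ)) 2 (vol Ω) :=
    memLp_ofReal (memLp_vol hΩ (continuous_partialDeriv hψ i) 2)
  have hb : MemLp (fun y => ((ψ y : ℝ) : ℂ)) 2 (vol Ω) :=
    memLp_ofReal (memLp_vol hΩ hψ.continuous 2)
  have key : ∀ x : sobolev Ω, ⟪ha.toLp, sobFun Ω x⟫_ℂ = -⟪hb.toLp, sobGrad Ω i x⟫_ℂ := by
    refine sobolev_induction ?_ ?_
    · exact isClosed_eq (by fun_prop) (by fun_prop)
    · intro x φ hφ h1 h2 _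
      rw [inner_eq_integral ha.coeFn_toLp h1, inner_eq_integral hb.coeFn_toLp (h2 i)]
      simp only [RCLike.star_def, Complex.conj_ofReal]
      have hφ1 : ContDiff ℝ 1 φ := hφ.of_le (by simp)
      have hψ' : ContDiff ℝ 1 fun y => ((ψ y : ℝ) : ℂ) := Complex.ofRealCLM.contDiff.comp hψ
      have hd : ∀ y, fderiv ℝ (fun y => ((ψ y : ℝ) : ℂ)) y (EuclideanSpace.single i 1) =
          ((partialDeriv i ψ y : ℝ) : ℂ) := fun y => by
        have h3 := Complex.ofRealCLM.hasFDerivAt.comp y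
          (hψ.differentiable one_ne_zero y).hasFDerivAt
        have h4 : fderiv ℝ (fun y => ((ψ y : ℝ) : ℂ)) y = _ := h3.fderiv
        rw [h4]
        rfl
      have hc' : HasCompactSupport fun y => ((ψ y : ℝ) : ℂ) := hc.comp_left Complex.ofReal_zero
      have hcd : HasCompactSupport fun y => ((partialDeriv i ψ y : ℝ) : ℂ) :=
        (hc.fderiv_apply (𝕜 := ℝ) (EuclideanSpace.single i 1)).comp_left
          (g := fun r : ℝ => (r : ℂ)) Complex.ofReal_zero
      have hdc : Continuous fun y => ((partialDeriv i ψ y : ℝ) : ℂ) :=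
        Complex.continuous_ofReal.comp (continuous_partialDeriv hψ i)
      have hsub : ∀ y, y ∉ Ω → ψ y = 0 := fun y hy =>
        image_eq_zero_of_notMem_tsupport fun h => hy (hs h)
      have hsub' : ∀ y, y ∉ Ω → partialDeriv i ψ y = 0 := fun y hy => by
        have : fderiv ℝ ψ y = 0 := by
          by_contra hne
          exact hy (hs (support_fderiv_subset ℝ hne))
        rw [partialDeriv, this]
        rfl
      have e1 : ∫ y, φ y * ((partialDeriv i ψ y : ℝ) : ℂ) ∂vol Ω =
          ∫ y, φ y * ((partialDeriv i ψ y : ℝ) : ℂ) :=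
        setIntegral_eq_integral_of_forall_compl_eq_zero fun y hy => by simp [hsub' y hy]
      have e2 : ∫ y, partialDeriv i φ y * ((ψ y : ℝ) : ℂ) ∂vol Ω =
          ∫ y, partialDeriv i φ y * ((ψ y : ℝ) : ℂ) :=
        setIntegral_eq_integral_of_forall_compl_eq_zero fun y hy => by simp [hsub y hy]
      rw [e1, e2]
      have e3 := integral_mul_fderiv_eq_neg_fderiv_mul_of_integrable (μ := volume) (𝕜 := ℂ)
        (f := φ) (g := fun y => ((ψ y : ℝ) : ℂ)) (v := EuclideanSpace.single i 1)
        (((continuous_partialDeriv hφ1 i).mul hψ'.continuous).integrable_of_hasCompactSupport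
          hc'.mul_left)
        (by
          simp only [hd]
          exact (hφ.continuous.mul hdc).integrable_of_hasCompactSupport hcd.mul_left)
        ((hφ.continuous.mul hψ'.continuous).integrable_of_hasCompactSupport hc'.mul_left)
        (fun y _ => hφ1.differentiable one_ne_zero y)
        (fun y _ => hψ'.differentiable one_ne_zero y)
      simp only [hd] at e3
      exact e3
  have h := key x
  rw [inner_eq_integral ha.coeFn_toLp EventuallyEq.rfl,
    inner_eq_integral hb.coeFn_toLp EventuallyEq.rfl] at h
  simpa only [RCLike.star_def, Complex.conj_ofReal, mul_comm] using h

/-- Weak gradients are unique. -/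
lemma HasWeakGradient.ae_eq (hΩ : IsBoundedLipschitzDomain Ω) {u u' : Sp d → ℂ}
    {G G' : Fin d → Sp d → ℂ} (h : HasWeakGradient Ω u G) (h' : HasWeakGradient Ω u' G')
    (hu : u =ᵐ[vol Ω] u') (i : Fin d) : G i =ᵐ[vol Ω] G' i := by
  have hfin := hΩ.isFiniteMeasure_vol
  have hint : Integrable (G i - G' i) (vol Ω) :=
    ((h.memLp_grad i).sub (h'.memLp_grad i)).integrable (by norm_num)
  have key := hΩ.isOpen.ae_eq_zero_of_integral_contDiff_smul_eq_zero (μ := vol Ω)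
    (f := G i - G' i) (hint.locallyIntegrable.locallyIntegrableOn Ω) fun g hg hc hs => by
    have h1 := h.weak i g hg hc hs
    have h2 := h'.weak i g hg hc hs
    have h3 : ∫ x, ((partialDeriv i g x : ℝ) : ℂ) * u x ∂vol Ω =
        ∫ x, ((partialDeriv i g x : ℝ) : ℂ) * u' x ∂vol Ω := by
      refine integral_congr_ae ?_
      filter_upwards [hu] with x hx
      rw [hx]
    have hb : MemLp (fun y => ((g y : ℝ) : ℂ)) 2 (vol Ω) :=
      memLp_ofReal (memLp_vol hΩ hg.continuous 2)
    have h4 : ∫ x, g x • (G i - G' i) x ∂vol Ω =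
        ∫ x, ((g x : ℝ) : ℂ) * G i x ∂vol Ω - ∫ x, ((g x : ℝ) : ℂ) * G' i x ∂vol Ω := by
      rw [← integral_sub]
      · congr 1
        funext x
        rw [Pi.sub_apply, Complex.real_smul, mul_sub]
      · exact hb.integrable_mul (h.memLp_grad i)
      · exact hb.integrable_mul (h'.memLp_grad i)
    rw [h4]
    rw [h3, h2] at h1
    linear_combination h1
  filter_upwards [key, ae_vol_mem hΩ] with x hx hxΩ
  exact sub_eq_zero.1 (hx hxΩ)

lemma HasWeakGradient.congr {u u' : Sp d → ℂ} {G : Fin d → Sp d → ℂ} (h : HasWeakGradient Ω u G)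
    (hu : u =ᵐ[vol Ω] u') : HasWeakGradient Ω u' G where
  memLp := (memLp_congr_ae hu).1 h.memLp
  memLp_grad := h.memLp_grad
  weak i φ a b c := by
    rw [← h.weak i φ a b c]
    refine integral_congr_ae ?_
    filter_upwards [hu] with y hy
    rw [hy]

lemma HasTrace.congr {u u' g g' : Sp d → ℂ} (h : HasTrace Ω u g) (hu : u =ᵐ[vol Ω] u')
    (hg : g =ᵐ[surf Ω] g') : HasTrace Ω u' g' := by
  obtain ⟨hg2, G, hG, φ, h1, h2, h3, h4⟩ := h
  exact ⟨(memLp_congr_ae hg).1 hg2, G, hG.congr hu, φ, h1,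
    h2.congr fun n => eLpNorm_congr_ae (EventuallyEq.rfl.sub hu), h3,
    h4.congr fun n => eLpNorm_congr_ae (EventuallyEq.rfl.sub hg)⟩

lemma hasWeakGradient_sobolev (hΩ : IsBoundedLipschitzDomain Ω) (x : sobolev Ω) :
    HasWeakGradient Ω (sobFun Ω x) fun i => sobGrad Ω i x where
  memLp := Lp.memLp _
  memLp_grad _ := Lp.memLp _
  weak i _ hφ hc hs := integral_partialDeriv_mul hΩ x i (hφ.of_le (by simp)) hc hs

lemma hasTrace_sobolev (hΩ : IsBoundedLipschitzDomain Ω) (x : sobolev Ω) :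
    HasTrace Ω (sobFun Ω x) (sobTrace Ω x) := by
  refine ⟨Lp.memLp _, fun i => sobGrad Ω i x, hasWeakGradient_sobolev hΩ x, ?_⟩
  obtain ⟨s, hs, hlim⟩ := mem_closure_iff_seq_limit.1 x.2
  choose φ h1 h2 h3 h4 using hs
  refine ⟨φ, h1, ?_, fun i => ?_, ?_⟩
  · have h5 := ((WithLp.fstL 2 ℂ _ _).continuous.tendsto _).comp hlim
    have h6 := (Lp.tendsto_Lp_iff_tendsto_eLpNorm' _ _).1 h5
    refine h6.congr fun n => eLpNorm_congr_ae ?_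
    exact (h2 n).sub EventuallyEq.rfl
  · have h5 := (((PiLp.proj 2 _ i).comp ((WithLp.fstL 2 ℂ _ _).comp
      (WithLp.sndL 2 ℂ (Lp ℂ 2 (vol Ω)) (WithLp 2 (PiLp 2 (fun _ : Fin d => Lp ℂ 2 (vol Ω)) ×
        Lp ℂ 2 (surf Ω)))))).continuous.tendsto _).comp hlim
    have h6 := (Lp.tendsto_Lp_iff_tendsto_eLpNorm' _ _).1 h5
    refine h6.congr fun n => eLpNorm_congr_ae ?_
    exact (h3 n i).sub EventuallyEq.rfl
  · have h5 := (((WithLp.sndL 2 ℂ _ _).comp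
      (WithLp.sndL 2 ℂ (Lp ℂ 2 (vol Ω)) (WithLp 2 (PiLp 2 (fun _ : Fin d => Lp ℂ 2 (vol Ω)) ×
        Lp ℂ 2 (surf Ω))))).continuous.tendsto _).comp hlim
    have h6 := (Lp.tendsto_Lp_iff_tendsto_eLpNorm' _ _).1 h5
    refine h6.congr fun n => eLpNorm_congr_ae ?_
    exact (h4 n).sub EventuallyEq.rfl

/-- Every function with a weak gradient and a trace comes from the Sobolev space. -/
lemma exists_sobolev (hΩ : IsBoundedLipschitzDomain Ω) {u g : Sp d → ℂ} {G : Fin d → Sp d → ℂ}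
    (hG : HasWeakGradient Ω u G) (hg : HasTrace Ω u g) : ∃ x : sobolev Ω,
      sobFun Ω x =ᵐ[vol Ω] u ∧ (∀ i, sobGrad Ω i x =ᵐ[vol Ω] G i) ∧
        sobTrace Ω x =ᵐ[surf Ω] g := by
  obtain ⟨hg2, G', hG', φ, hφ, h1, h2, h3⟩ := hg
  have hGG : ∀ i, G' i =ᵐ[vol Ω] G i := fun i => hG'.ae_eq hΩ hG EventuallyEq.rfl i
  let x : SobolevAmbient Ω := WithLp.toLp 2 (hG.memLp.toLp,
    WithLp.toLp 2 (WithLp.toLp 2 fun i => (hG'.memLp_grad i).toLp, hg2.toLp))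
  choose s hs1 hs2 hs3 using fun n => exists_sobolev_of_contDiff hΩ (hφ n)
  have hlim : Tendsto (fun n => sobTriple Ω (s n)) atTop (𝓝 x) := by
    refine ((WithLp.prod_continuous_toLp 2 _ _).tendsto _).comp (Tendsto.prodMk_nhds ?_
      (((WithLp.prod_continuous_toLp 2 _ _).tendsto _).comp (Tendsto.prodMk_nhds
        (((PiLp.continuous_toLp 2 _).tendsto _).comp (tendsto_pi_nhds.2 fun i => ?_)) ?_)))
    · refine (Lp.tendsto_Lp_iff_tendsto_eLpNorm _ _ _).2 (h1.congr fun n => eLpNorm_congr_ae ?_)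
      exact (hs1 n).symm.sub EventuallyEq.rfl
    · refine (Lp.tendsto_Lp_iff_tendsto_eLpNorm _ _ _).2 ((h2 i).congr fun n => eLpNorm_congr_ae ?_)
      exact (hs2 n i).symm.sub EventuallyEq.rfl
    · refine (Lp.tendsto_Lp_iff_tendsto_eLpNorm _ _ _).2 (h3.congr fun n => eLpNorm_congr_ae ?_)
      exact (hs3 n).symm.sub EventuallyEq.rfl
  have hx : x ∈ sobolevSubmodule Ω :=
    (smoothTriples Ω).isClosed_topologicalClosure.mem_of_tendsto hlim
      (Eventually.of_forall fun n => (s n).2)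
  refine ⟨⟨x, hx⟩, hG.memLp.coeFn_toLp, fun i => ?_, hg2.coeFn_toLp⟩
  exact (MemLp.coeFn_toLp (hG'.memLp_grad i)).trans (hGG i)

/-- A Sobolev function determines its gradient and its trace. -/
lemma sobFun_injective (hΩ : IsBoundedLipschitzDomain Ω) : Function.Injective (sobFun Ω) := by
  refine (injective_iff_map_eq_zero _).2 fun x hx => ?_
  have h1 : ∀ i, sobGrad Ω i x = 0 := fun i => by
    have h2 := (hasWeakGradient_sobolev hΩ x).ae_eq hΩ (hasWeakGradient_sobolev hΩ 0)
      (by rw [hx, map_zero]) i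
    rw [Lp.ext h2, map_zero]
  obtain ⟨C, hC, h3⟩ := exists_norm_sobTrace_le hΩ
  have h4 := h3 x
  simp only [hx, h1, norm_zero] at h4
  have h5 : ‖sobTrace Ω x‖ ^ 2 = 0 := le_antisymm (by simpa using h4) (sq_nonneg _)
  refine sobolev_ext (by rw [hx, map_zero]) (fun i => by rw [h1, map_zero]) ?_
  rw [map_zero, ← norm_eq_zero]
  exact pow_eq_zero_iff (by norm_num) |>.1 h5

end Sobolev

end

noncomputable section

/-! ### Change of measure -/

section ChangeOfMeasure

variable {X : Type*} [MeasurableSpace X] {μ ν : Measure X}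

/-- The canonical map `L²(μ) → L²(ν)` if `ν ≤ c • μ`. -/
def lpOfMeasureLE (h : ∃ c : ℝ≥0∞, c ≠ ⊤ ∧ ν ≤ c • μ) : Lp ℂ 2 μ →L[ℂ] Lp ℂ 2 ν :=
  have hac : ν ≪ μ := h.elim fun _ hc => Measure.absolutelyContinuous_of_le_smul hc.2
  have hmem : ∀ f : Lp ℂ 2 μ, MemLp f 2 ν := fun f =>
    h.elim fun _ hc => (Lp.memLp f).of_measure_le_smul hc.1 hc.2
  LinearMap.mkContinuousOfExistsBound
    { toFun := fun f => (hmem f).toLp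
      map_add' := fun f g => Lp.ext <| by
        refine (hmem (f + g)).coeFn_toLp.trans ?_
        refine (hac.ae_eq (Lp.coeFn_add f g)).trans ?_
        refine EventuallyEq.trans ?_ (Lp.coeFn_add _ _).symm
        exact (hmem f).coeFn_toLp.symm.add (hmem g).coeFn_toLp.symm
      map_smul' := fun c f => Lp.ext <| by
        refine (hmem (c • f)).coeFn_toLp.trans ?_
        refine (hac.ae_eq (Lp.coeFn_smul c f)).trans ?_
        refine EventuallyEq.trans ?_ (Lp.coeFn_smul _ _).symm
        exact (hmem f).coeFn_toLp.symm.const_smul c }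
    (by
      obtain ⟨c, hc, hle⟩ := h
      refine ⟨(c ^ (1 / (2 : ℝ≥0∞).toReal)).toReal, fun f => ?_⟩
      change ‖(hmem f).toLp‖ ≤ _
      rw [Lp.norm_toLp, Lp.norm_def, ← ENNReal.toReal_mul]
      refine ENNReal.toReal_mono ?_ ?_
      · exact ENNReal.mul_ne_top (by finiteness) (Lp.eLpNorm_ne_top f)
      · refine (eLpNorm_mono_measure _ hle).trans ?_
        rw [eLpNorm_smul_measure_of_ne_top (by norm_num), smul_eq_mul]
        norm_num)

lemma coeFn_lpOfMeasureLE (h : ∃ c : ℝ≥0∞, c ≠ ⊤ ∧ ν ≤ c • μ) (f : Lp ℂ 2 μ) :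
    lpOfMeasureLE h f =ᵐ[ν] f :=
  h.elim fun _ hc => ((Lp.memLp f).of_measure_le_smul hc.1 hc.2).coeFn_toLp

end ChangeOfMeasure

variable {d : ℕ}

/-- The adjoint of the embedding of the Sobolev space into `L²(Ω)`. -/
def sobFunAdj (Ω : Set (Sp d)) : Lp ℂ 2 (vol Ω) →L[ℂ] sobolev Ω :=
  ContinuousLinearMap.adjoint (sobFun Ω)

lemma inner_sobFunAdj {Ω : Set (Sp d)} (x : sobolev Ω) (f : Lp ℂ 2 (vol Ω)) :
    ⟪x, sobFunAdj Ω f⟫_ℂ = ⟪sobFun Ω x, f⟫_ℂ :=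
  ContinuousLinearMap.adjoint_inner_right _ _ _

/-- The properties of the domain and of the coefficients that the construction of the operators
uses. The weighted surface measure `β⁻¹ dS` is comparable to the surface measure. -/
structure FormData (Ω : Set (Sp d)) (Q : Sp d → Matrix (Fin d) (Fin d) ℝ) (α β γ δ : Sp d → ℝ) :
    Prop where
  domain : IsBoundedLipschitzDomain Ω
  memQ : ∀ i j, MemLp (fun x => Q x i j) ∞ (vol Ω)
  contDiffAtQ : ∀ i j, ∀ x ∈ Ω, ContDiffAt ℝ 1 (fun x => Q x i j) x
  symmQ : ∀ x ∈ Ω, (Q x).IsSymm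
  elliptic : ∃ κ : ℝ, 0 < κ ∧ ∀ x ∈ Ω, ∀ ξ : Fin d → ℝ,
    κ * ∑ i, ξ i ^ 2 ≤ ξ ⬝ᵥ (Q x).mulVec ξ
  memα : MemLp α ∞ (vol Ω)
  lowerα : ∃ η : ℝ, 0 < η ∧ ∀ᵐ x ∂vol Ω, η ≤ α x
  memγ : MemLp γ ∞ (wsurf Ω β)
  nonnegγ : ∀ᵐ x ∂wsurf Ω β, 0 ≤ γ x
  memδ : MemLp δ ∞ (surf Ω)
  nonnegδ : ∀ᵐ x ∂surf Ω, 0 ≤ δ x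
  wsurf_le : ∃ c : ℝ≥0∞, c ≠ ⊤ ∧ wsurf Ω β ≤ c • surf Ω
  surf_le : ∃ c : ℝ≥0∞, c ≠ ⊤ ∧ surf Ω ≤ c • wsurf Ω β

lemma memLp_of_isEllipticCoeff {Ω : Set (Sp d)} (hΩ : IsBoundedLipschitzDomain Ω)
    {Q : Sp d → Matrix (Fin d) (Fin d) ℝ} (hQ : IsEllipticCoeff Ω Q) (i j : Fin d) :
    MemLp (fun x => Q x i j) ∞ (vol Ω) := by
  obtain ⟨U, -, hUΩ, hreg, -⟩ := hQ
  have hc : ContinuousOn (fun x => Q x i j) (closure Ω) := (hreg i j).1.continuousOn.mono hUΩ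
  obtain ⟨C, hC⟩ := hΩ.isBounded.isCompact_closure.exists_bound_of_continuousOn hc
  have := hΩ.isFiniteMeasure_vol
  refine MemLp.of_bound ?_ C ?_
  · exact (hc.mono subset_closure).aestronglyMeasurable hΩ.isOpen.measurableSet
  · filter_upwards [ae_vol_mem hΩ] with x hx using hC x (subset_closure hx)

lemma formData_of_isAdmissibleCoeff {Ω : Set (Sp d)} (hΩ : IsBoundedLipschitzDomain Ω)
    {Q : Sp d → Matrix (Fin d) (Fin d) ℝ} (hQ : IsEllipticCoeff Ω Q) {α β γ δ : Sp d → ℝ}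
    (h : IsAdmissibleCoeff Ω α β γ δ) (hγ : ∀ᵐ x ∂surf Ω, 0 ≤ γ x) : FormData Ω Q α β γ δ := by
  obtain ⟨η, hη, hα, hβ⟩ := h.lower
  have hle : wsurf Ω β ≤ ENNReal.ofReal η⁻¹ • surf Ω := by
    rw [wsurf, ← withDensity_const]
    refine withDensity_mono ?_
    filter_upwards [hβ] with x hx
    gcongr
  have hac : wsurf Ω β ≪ surf Ω := Measure.absolutelyContinuous_of_le_smul hle
  have hge : ∃ c : ℝ≥0∞, c ≠ ⊤ ∧ surf Ω ≤ c • wsurf Ω β := by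
    set b : ℝ := max (eLpNorm β ∞ (surf Ω)).toReal η with hb
    have hb0 : 0 < b := lt_max_of_lt_right hη
    refine ⟨ENNReal.ofReal b, ENNReal.ofReal_ne_top, ?_⟩
    rw [wsurf, ← withDensity_smul' _ _ ENNReal.ofReal_ne_top]
    conv_lhs => rw [← withDensity_one (μ := surf Ω)]
    refine withDensity_mono ?_
    have h1 : ∀ᵐ x ∂surf Ω, ‖β x‖ ≤ b := by
      filter_upwards [ae_le_eLpNormEssSup (f := β) (μ := surf Ω)] with x hx
      refine le_max_of_le_left ?_
      have h2 : eLpNormEssSup β (surf Ω) ≠ ⊤ := by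
        have := h.memβ.eLpNorm_ne_top
        rwa [eLpNorm_exponent_top] at this
      rw [eLpNorm_exponent_top, ← toReal_enorm]
      exact ENNReal.toReal_mono h2 hx
    filter_upwards [hβ, h1] with x hx hx1
    have hx0 : 0 < β x := hη.trans_le hx
    rw [Pi.one_apply, Pi.smul_apply, smul_eq_mul, ← ENNReal.ofReal_mul hb0.le,
      ENNReal.one_le_ofReal, ← div_eq_mul_inv, one_le_div hx0]
    exact (le_abs_self _).trans hx1
  obtain ⟨U, hU, hUΩ, hreg, hsymm, κ, hκ, hell⟩ := id hQ
  exact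
    { domain := hΩ
      memQ := memLp_of_isEllipticCoeff hΩ hQ
      contDiffAtQ := fun i j x hx =>
        (hreg i j).1.contDiffAt (hU.mem_nhds (hUΩ (subset_closure hx)))
      symmQ := fun x hx => hsymm x (hUΩ (subset_closure hx))
      elliptic := ⟨κ, hκ, fun x hx => hell x (hUΩ (subset_closure hx))⟩
      memα := h.memα
      lowerα := ⟨η, hη, hα⟩
      memγ := h.memγ.of_measure_le_smul ENNReal.ofReal_ne_top hle
      nonnegγ := hac.ae_le hγ
      memδ := h.memδ
      nonnegδ := h.nonnegδ
      wsurf_le := ⟨_, ENNReal.ofReal_ne_top, hle⟩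
      surf_le := hge }

namespace FormData

variable {Ω : Set (Sp d)} {Q : Sp d → Matrix (Fin d) (Fin d) ℝ} {α β γ δ : Sp d → ℝ}
variable (D : FormData Ω Q α β γ δ)

/-! ### The second-order operator -/

/-- The bounded operator on the Sobolev space that represents the form `b_δ`. -/
def subOp (D : FormData Ω Q α β γ δ) : sobolev Ω →L[ℂ] sobolev Ω :=
  ∑ i, ∑ j, (ContinuousLinearMap.adjoint (sobGrad Ω i)).comp
    ((mulOp (fun x => Q x i j) (D.memQ i j)).comp (sobGrad Ω j)) +
  (ContinuousLinearMap.adjoint (sobTrace Ω)).comp ((mulOp δ D.memδ).comp (sobTrace Ω))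

lemma inner_subOp_eq_sum (x y : sobolev Ω) :
    ⟪y, D.subOp x⟫_ℂ =
      ∑ i, ∑ j, ⟪sobGrad Ω i y, mulOp (fun x => Q x i j) (D.memQ i j) (sobGrad Ω j x)⟫_ℂ +
        ⟪sobTrace Ω y, mulOp δ D.memδ (sobTrace Ω x)⟫_ℂ := by
  simp only [subOp, add_apply, sum_apply, ContinuousLinearMap.comp_apply, inner_add_right,
    inner_sum, ContinuousLinearMap.adjoint_inner_right]

include D in
lemma integrable_mul_mul_star {i j : Fin d} (f g : Lp ℂ 2 (vol Ω)) :
    Integrable (fun x => (Q x i j : ℂ) * f x * star (g x)) (vol Ω) := by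
  have h := L2.integrable_inner g (mulOp (fun x => Q x i j) (D.memQ i j) f) (𝕜 := ℂ)
  refine h.congr ?_
  filter_upwards [coeFn_mulOp (D.memQ i j) f] with x hx
  rw [hx, RCLike.inner_apply]
  rfl

lemma inner_subOp (x y : sobolev Ω) {G G' : Fin d → Sp d → ℂ} {g g' : Sp d → ℂ}
    (hG : ∀ i, sobGrad Ω i x =ᵐ[vol Ω] G i) (hg : sobTrace Ω x =ᵐ[surf Ω] g)
    (hG' : ∀ i, sobGrad Ω i y =ᵐ[vol Ω] G' i) (hg' : sobTrace Ω y =ᵐ[surf Ω] g') :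
    ⟪y, D.subOp x⟫_ℂ = subForm Ω Q δ G g G' g' := by
  rw [inner_subOp_eq_sum, subForm, inner_mulOp _ hg' hg]
  congr 1
  have hint : ∀ i j, Integrable (fun x => (Q x i j : ℂ) * G j x * star (G' i x)) (vol Ω) := by
    intro i j
    refine (D.integrable_mul_mul_star (i := i) (j := j) (sobGrad Ω j x) (sobGrad Ω i y)).congr ?_
    filter_upwards [hG j, hG' i] with z h1 h2
    rw [h1, h2]
  rw [integral_finsetSum _ fun i _ => integrable_finsetSum _ fun j _ => hint i j]
  refine Finset.sum_congr rfl fun i _ => ?_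
  rw [integral_finsetSum _ fun j _ => hint i j]
  exact Finset.sum_congr rfl fun j _ => inner_mulOp _ (hG' i) (hG j)

/-- The ellipticity condition for complex vectors. -/
lemma re_sum_sum_ge {A : Matrix (Fin d) (Fin d) ℝ} {κ : ℝ}
    (h : ∀ ξ : Fin d → ℝ, κ * ∑ i, ξ i ^ 2 ≤ ξ ⬝ᵥ A.mulVec ξ) (z : Fin d → ℂ) :
    κ * ∑ i, ‖z i‖ ^ 2 ≤ (∑ i, ∑ j, (A i j : ℂ) * z j * star (z i)).re := by
  have h1 := h fun i => (z i).re
  have h2 := h fun i => (z i).im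
  have h3 : (∑ i, ∑ j, (A i j : ℂ) * z j * star (z i)).re =
      (fun i => (z i).re) ⬝ᵥ A.mulVec (fun i => (z i).re) +
        (fun i => (z i).im) ⬝ᵥ A.mulVec (fun i => (z i).im) := by
    simp only [dotProduct, Matrix.mulVec, Complex.re_sum, Finset.mul_sum]
    rw [← Finset.sum_add_distrib]
    refine Finset.sum_congr rfl fun i _ => ?_
    rw [← Finset.sum_add_distrib]
    refine Finset.sum_congr rfl fun j _ => ?_
    simp [Complex.mul_re, Complex.mul_im]
    ring
  have h4 : ∑ i, ‖z i‖ ^ 2 = ∑ i, (z i).re ^ 2 + ∑ i, (z i).im ^ 2 := by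
    rw [← Finset.sum_add_distrib]
    refine Finset.sum_congr rfl fun i _ => ?_
    rw [← Complex.normSq_eq_norm_sq, Complex.normSq_apply]
    ring
  rw [h3, h4, mul_add]
  linarith

/-- The Gårding inequality for the form `b_δ`. -/
lemma exists_le_re_inner_subOp : ∃ κ : ℝ, 0 < κ ∧ ∀ x : sobolev Ω,
    κ * ∑ i, ‖sobGrad Ω i x‖ ^ 2 ≤ (⟪x, D.subOp x⟫_ℂ).re := by
  obtain ⟨κ, hκ, hell⟩ := D.elliptic
  refine ⟨κ, hκ, fun x => ?_⟩
  have h0 : 0 ≤ (⟪sobTrace Ω x, mulOp δ D.memδ (sobTrace Ω x)⟫_ℂ).re := by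
    simpa using le_re_inner_mulOp D.memδ (c := 0) D.nonnegδ (sobTrace Ω x)
  rw [inner_subOp_eq_sum, Complex.add_re]
  refine le_add_of_le_of_nonneg ?_ h0
  set G := fun i => sobGrad Ω i x with hG
  have hint : ∀ i j, Integrable (fun y => (Q y i j : ℂ) * G j y * star (G i y)) (vol Ω) :=
    fun i j => D.integrable_mul_mul_star _ _
  have hint' : Integrable (fun y => ∑ i, ∑ j, (Q y i j : ℂ) * G j y * star (G i y)) (vol Ω) :=
    integrable_finsetSum _ fun i _ => integrable_finsetSum _ fun j _ => hint i j
  have h1 : ∑ i, ∑ j, ⟪G i, mulOp (fun x => Q x i j) (D.memQ i j) (G j)⟫_ℂ =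
      ∫ y, ∑ i, ∑ j, (Q y i j : ℂ) * G j y * star (G i y) ∂vol Ω := by
    rw [integral_finsetSum _ fun i _ => integrable_finsetSum _ fun j _ => hint i j]
    refine Finset.sum_congr rfl fun i _ => ?_
    rw [integral_finsetSum _ fun j _ => hint i j]
    exact Finset.sum_congr rfl fun j _ => inner_mulOp _ EventuallyEq.rfl EventuallyEq.rfl
  have h2 : ∀ i, ‖G i‖ ^ 2 = ∫ y, ‖G i y‖ ^ 2 ∂vol Ω := fun i => by
    have h3 := (re_inner_mulOp (memLp_top_const (1 : ℝ)) (G i)).1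
    have h4 : mulOp (fun _ => (1 : ℝ)) (memLp_top_const (1 : ℝ)) (G i) = G i := Lp.ext <| by
      refine (coeFn_mulOp _ _).trans (Eventually.of_forall fun y => ?_)
      simp
    rw [h4] at h3
    rw [← inner_self_eq_norm_sq (𝕜 := ℂ)]
    simpa using h3
  have h5 : ∀ i, Integrable (fun y => ‖G i y‖ ^ 2) (vol Ω) := fun i =>
    (Lp.memLp (G i)).integrable_norm_pow (by norm_num)
  have h6 : κ * ∑ i, ‖G i‖ ^ 2 = ∫ y, κ * ∑ i, ‖G i y‖ ^ 2 ∂vol Ω := by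
    rw [integral_const_mul, integral_finsetSum _ fun i _ => h5 i]
    simp only [h2]
  have h7 : (∫ y, ∑ i, ∑ j, (Q y i j : ℂ) * G j y * star (G i y) ∂vol Ω).re =
      ∫ y, (∑ i, ∑ j, (Q y i j : ℂ) * G j y * star (G i y)).re ∂vol Ω :=
    (integral_re hint').symm
  have h8 : κ * ∑ i, ‖G i‖ ^ 2 ≤ (∑ i, ∑ j,
      ⟪G i, mulOp (fun x => Q x i j) (D.memQ i j) (G j)⟫_ℂ).re := by
    rw [h6, h1, h7]
    refine integral_mono_ae ((integrable_finsetSum _ fun i _ => h5 i).const_mul κ) hint'.re ?_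
    filter_upwards [ae_vol_mem D.domain] with y hy
    exact re_sum_sum_ge (hell y hy) fun i => G i y
  exact h8

/-- The operator `B_{N,δ}` in terms of the Sobolev space. -/
lemma isB_iff {u w : Sp d → ℂ} : IsB Ω Q δ u w ↔ ∃ (hw : MemLp w 2 (vol Ω)) (x : sobolev Ω),
    sobFun Ω x =ᵐ[vol Ω] u ∧
      D.subOp x = sobFunAdj Ω hw.toLp := by
  constructor
  · rintro ⟨hw, G, g, hG, hg, h⟩
    obtain ⟨x, h1, h2, h3⟩ := exists_sobolev D.domain hG hg
    refine ⟨hw, x, h1, ext_inner_left ℂ fun y => ?_⟩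
    rw [D.inner_subOp x y h2 h3 (fun _ => EventuallyEq.rfl) EventuallyEq.rfl,
      inner_sobFunAdj, inner_eq_integral EventuallyEq.rfl hw.coeFn_toLp]
    exact h _ _ _ (hasWeakGradient_sobolev D.domain y) (hasTrace_sobolev D.domain y)
  · rintro ⟨hw, x, h1, h2⟩
    refine ⟨hw, fun i => sobGrad Ω i x, sobTrace Ω x,
      (hasWeakGradient_sobolev D.domain x).congr h1,
      (hasTrace_sobolev D.domain x).congr h1 EventuallyEq.rfl, fun v G' g' hG' hg' => ?_⟩
    obtain ⟨y, k1, k2, k3⟩ := exists_sobolev D.domain hG' hg'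
    rw [← D.inner_subOp x y (fun _ => EventuallyEq.rfl) EventuallyEq.rfl k2 k3, h2,
      inner_sobFunAdj, inner_eq_integral k1 hw.coeFn_toLp]

/-- The form norm of `b_δ` is equivalent to the norm of the Sobolev space; this is where the trace
inequality enters. -/
lemma exists_mul_norm_sq_le : ∃ c : ℝ, 0 < c ∧ ∀ x : sobolev Ω,
    c * ‖x‖ ^ 2 ≤ ‖sobFun Ω x‖ ^ 2 + (⟪x, D.subOp x⟫_ℂ).re := by
  obtain ⟨κ, hκ, h1⟩ := D.exists_le_re_inner_subOp
  obtain ⟨C, hC, h2⟩ := exists_norm_sobTrace_le D.domain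
  have hm : 0 < min κ 1 := lt_min hκ one_pos
  have hC1 : 0 < 1 + C := by linarith
  have key : ∀ a b t s : ℝ, 0 ≤ a → 0 ≤ b → κ * b ≤ s → t ≤ C * (a + b) →
      min κ 1 / (1 + C) * (a + b + t) ≤ a + s := by
    intro a b t s ha hb h3 h4
    rw [div_mul_eq_mul_div, div_le_iff₀ hC1]
    have e1 : min κ 1 * (a + b + t) ≤ min κ 1 * ((1 + C) * (a + b)) :=
      mul_le_mul_of_nonneg_left (by linarith) hm.le
    have e2 : min κ 1 * a ≤ a := mul_le_of_le_one_left ha (min_le_right _ _)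
    have e3 : min κ 1 * b ≤ κ * b := mul_le_mul_of_nonneg_right (min_le_left _ _) hb
    have e4 : (min κ 1 * a + min κ 1 * b) * (1 + C) ≤ (a + s) * (1 + C) :=
      mul_le_mul_of_nonneg_right (by linarith) hC1.le
    linarith
  refine ⟨min κ 1 / (1 + C), div_pos hm hC1, fun x => ?_⟩
  rw [norm_sobolev_sq]
  exact key _ _ _ _ (sq_nonneg _) (Finset.sum_nonneg fun i _ => sq_nonneg _) (h1 x) (h2 x)

end FormData

end

noncomputable section

variable {d : ℕ}

namespace FormData

variable {Ω : Set (Sp d)} {Q : Sp d → Matrix (Fin d) (Fin d) ℝ} {α β γ δ : Sp d → ℝ}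

/-! ### The form domain of the fourth-order operator -/

/-- The graph of `B_{N,δ}`: the pairs `(u, w)` with `B_{N,δ} u = w`. -/
def formSubmodule (D : FormData Ω Q α β γ δ) :
    Submodule ℂ (WithLp 2 (sobolev Ω × Lp ℂ 2 (vol Ω))) :=
  (D.subOp.comp (WithLp.fstL 2 ℂ _ _) - (sobFunAdj Ω).comp (WithLp.sndL 2 ℂ _ _)).ker

/-- The form domain of `𝒜`, as the Hilbert space of all `(u, B_{N,δ} u)`. -/
def FormSpace (D : FormData Ω Q α β γ δ) : Type := D.formSubmodule

variable (D : FormData Ω Q α β γ δ)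

instance : NormedAddCommGroup D.FormSpace :=
  inferInstanceAs (NormedAddCommGroup D.formSubmodule)

instance : InnerProductSpace ℂ D.FormSpace :=
  inferInstanceAs (InnerProductSpace ℂ D.formSubmodule)

instance : CompleteSpace D.FormSpace := by
  have h : IsClosed (D.formSubmodule : Set (WithLp 2 (sobolev Ω × Lp ℂ 2 (vol Ω)))) :=
    ContinuousLinearMap.isClosed_ker _
  exact h.completeSpace_coe

/-- The pair `(u, B_{N,δ} u)`. -/
def formPair : D.FormSpace →L[ℂ] WithLp 2 (sobolev Ω × Lp ℂ 2 (vol Ω)) :=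
  D.formSubmodule.subtypeL

/-- The Sobolev function `u` of an element of the form domain. -/
def formFun : D.FormSpace →L[ℂ] sobolev Ω :=
  (WithLp.fstL 2 ℂ _ _).comp D.formPair

/-- The function `B_{N,δ} u` of an element `u` of the form domain. -/
def formOp : D.FormSpace →L[ℂ] Lp ℂ 2 (vol Ω) :=
  (WithLp.sndL 2 ℂ _ _).comp D.formPair

lemma norm_formSpace_sq (k : D.FormSpace) : ‖k‖ ^ 2 = ‖D.formFun k‖ ^ 2 + ‖D.formOp k‖ ^ 2 := by
  have h1 : ‖k‖ = ‖D.formPair k‖ := rfl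
  rw [h1, WithLp.prod_norm_sq_eq_of_L2]
  rfl

lemma subOp_formFun (k : D.FormSpace) : D.subOp (D.formFun k) = sobFunAdj Ω (D.formOp k) :=
  sub_eq_zero.1 (LinearMap.mem_ker.1 k.2)

lemma exists_formSpace {x : sobolev Ω} {w : Lp ℂ 2 (vol Ω)} (h : D.subOp x = sobFunAdj Ω w) :
    ∃ k : D.FormSpace, D.formFun k = x ∧ D.formOp k = w :=
  ⟨⟨WithLp.toLp 2 (x, w), LinearMap.mem_ker.2 (sub_eq_zero.2 h)⟩, rfl, rfl⟩

/-- The map `u ↦ (u, tr u)` from the Sobolev space to `ℋ`. -/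
def sobEmb : sobolev Ω →L[ℂ] HSpace Ω β :=
  (WithLp.prodContinuousLinearEquiv 2 ℂ _ _).symm.toContinuousLinearMap.comp
    ((sobFun Ω).prod ((lpOfMeasureLE D.wsurf_le).comp (sobTrace Ω)))

lemma wsurf_ac (D : FormData Ω Q α β γ δ) : wsurf Ω β ≪ surf Ω :=
  D.wsurf_le.elim fun _ hc => Measure.absolutelyContinuous_of_le_smul hc.2

lemma surf_ac (D : FormData Ω Q α β γ δ) : surf Ω ≪ wsurf Ω β :=
  D.surf_le.elim fun _ hc => Measure.absolutelyContinuous_of_le_smul hc.2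

lemma coeFn_snd_sobEmb (x : sobolev Ω) : (D.sobEmb x).snd =ᵐ[wsurf Ω β] sobTrace Ω x :=
  coeFn_lpOfMeasureLE D.wsurf_le _

lemma inner_sobEmb (x : sobolev Ω) (f : HSpace Ω β) :
    ⟪D.sobEmb x, f⟫_ℂ = ⟪sobFun Ω x, f.fst⟫_ℂ + ⟪(D.sobEmb x).snd, f.snd⟫_ℂ :=
  rfl

/-- The embedding of the form domain into `ℋ`. -/
def formEmb : D.FormSpace →L[ℂ] HSpace Ω β := D.sobEmb.comp D.formFun

/-- The boundary component of an element of the form domain. -/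
def formBdry : D.FormSpace →L[ℂ] Lp ℂ 2 (wsurf Ω β) := (WithLp.sndL 2 ℂ _ _).comp D.formEmb

/-- The form domain of `𝒜` in terms of the Hilbert space `FormSpace`. -/
lemma inFormDomain_iff {p : HSpace Ω β} {w : Sp d → ℂ} : InFormDomain Ω Q β δ p w ↔
    ∃ k : D.FormSpace, D.formEmb k = p ∧ D.formOp k =ᵐ[vol Ω] w := by
  constructor
  · rintro ⟨hB, htr⟩
    obtain ⟨hw, x, h1, h2⟩ := D.isB_iff.1 hB
    obtain ⟨k, hk1, hk2⟩ := D.exists_formSpace h2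
    obtain ⟨-, G, hG, -⟩ := id htr
    obtain ⟨y, h3, -, h4⟩ := exists_sobolev D.domain hG htr
    have hxy : y = x := sobFun_injective D.domain (Lp.ext (h3.trans h1.symm))
    subst hxy
    refine ⟨k, ?_, by rw [hk2]; exact hw.coeFn_toLp⟩
    have e1 : (D.sobEmb y).fst = p.fst := Lp.ext h1
    have e2 : (D.sobEmb y).snd = p.snd :=
      Lp.ext ((D.coeFn_snd_sobEmb y).trans (D.wsurf_ac.ae_eq h4))
    change D.sobEmb (D.formFun k) = p
    rw [hk1]
    exact (WithLp.ofLp_injective 2) (Prod.ext e1 e2)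
  · rintro ⟨k, rfl, hw⟩
    have hw2 : MemLp w 2 (vol Ω) := (memLp_congr_ae hw).1 (Lp.memLp _)
    have h1 : D.formOp k = hw2.toLp := Lp.ext (hw.trans hw2.coeFn_toLp.symm)
    refine ⟨D.isB_iff.2 ⟨hw2, D.formFun k, EventuallyEq.rfl, ?_⟩, ?_⟩
    · rw [D.subOp_formFun, h1]
    · exact (hasTrace_sobolev D.domain (D.formFun k)).congr EventuallyEq.rfl
        (D.surf_ac.ae_eq (D.coeFn_snd_sobEmb _).symm)

/-- The bounded operator on the form domain that represents `⟨u, v⟩ + 𝔞(u, v)`. -/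
def primOp : D.FormSpace →L[ℂ] D.FormSpace :=
  D.formEmb.adjoint.comp D.formEmb + D.formOp.adjoint.comp ((mulOp α D.memα).comp D.formOp) +
    D.formBdry.adjoint.comp ((mulOp γ D.memγ).comp D.formBdry)

lemma inner_primOp (l k : D.FormSpace) :
    ⟪l, D.primOp k⟫_ℂ = ⟪D.formEmb l, D.formEmb k⟫_ℂ +
      ⟪D.formOp l, mulOp α D.memα (D.formOp k)⟫_ℂ +
        ⟪D.formBdry l, mulOp γ D.memγ (D.formBdry k)⟫_ℂ := by
  simp only [primOp, add_apply, ContinuousLinearMap.comp_apply, inner_add_right,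
    ContinuousLinearMap.adjoint_inner_right]

lemma inner_primOp_eq_primForm {l k : D.FormSpace} {w z : Sp d → ℂ}
    (hw : D.formOp k =ᵐ[vol Ω] w) (hz : D.formOp l =ᵐ[vol Ω] z) :
    ⟪l, D.primOp k⟫_ℂ = ⟪D.formEmb l, D.formEmb k⟫_ℂ +
      primForm Ω α β γ (D.formEmb k) w (D.formEmb l) z := by
  have h : ⟪D.formBdry l, mulOp γ D.memγ (D.formBdry k)⟫_ℂ =
      ∫ x, (γ x : ℂ) * (D.formEmb k).snd x * star ((D.formEmb l).snd x) ∂wsurf Ω β :=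
    inner_mulOp D.memγ EventuallyEq.rfl EventuallyEq.rfl
  rw [inner_primOp, primForm, inner_mulOp D.memα hz hw, h, add_assoc]

lemma inner_primOp_left (l k : D.FormSpace) : ⟪D.primOp l, k⟫_ℂ = ⟪l, D.primOp k⟫_ℂ := by
  rw [← inner_conj_symm, inner_primOp, inner_primOp]
  simp only [map_add, inner_conj_symm, mulOp_inner_left]

lemma exists_mul_norm_sq_le_primOp : ∃ c : ℝ, 0 < c ∧ ∀ k : D.FormSpace,
    c * ‖k‖ ^ 2 ≤ (⟪D.primOp k, k⟫_ℂ).re := by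
  obtain ⟨c, hc, h1⟩ := D.exists_mul_norm_sq_le
  obtain ⟨η, hη, hα⟩ := D.lowerα
  have hm : 0 < min η 1 := lt_min hη one_pos
  have hc1 : 0 < 2 / c + 1 := by positivity
  have key : ∀ x u w s a : ℝ, 0 ≤ u → 0 ≤ w → c * x ≤ u + s → s ≤ (u + w) / 2 →
      u + η * w ≤ a → min η 1 / (2 / c + 1) * (x + w) ≤ a := by
    intro x u w s a hu hw h2 h3 h4
    rw [div_mul_eq_mul_div, div_le_iff₀ hc1]
    have e1 : min η 1 * w ≤ η * w := mul_le_mul_of_nonneg_right (min_le_left _ _) hw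
    have e2 : min η 1 * u ≤ u := mul_le_of_le_one_left hu (min_le_right _ _)
    have e3 : x ≤ 2 / c * (u + w) := by
      rw [div_mul_eq_mul_div, le_div_iff₀ hc]
      linarith
    calc min η 1 * (x + w) ≤ min η 1 * ((2 / c + 1) * (u + w)) :=
          mul_le_mul_of_nonneg_left (by linarith) hm.le
      _ = (min η 1 * u + min η 1 * w) * (2 / c + 1) := by ring
      _ ≤ a * (2 / c + 1) := mul_le_mul_of_nonneg_right (by linarith) hc1.le
  refine ⟨min η 1 / (2 / c + 1), div_pos hm hc1, fun k => ?_⟩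
  have h2 : (⟪D.formFun k, D.subOp (D.formFun k)⟫_ℂ).re ≤
      (‖sobFun Ω (D.formFun k)‖ ^ 2 + ‖D.formOp k‖ ^ 2) / 2 := by
    rw [subOp_formFun, inner_sobFunAdj]
    have e1 := (Complex.re_le_norm _).trans
      (norm_inner_le_norm (𝕜 := ℂ) (sobFun Ω (D.formFun k)) (D.formOp k))
    have e2 := two_mul_le_add_sq ‖sobFun Ω (D.formFun k)‖ ‖D.formOp k‖
    linarith
  have h3 : ‖sobFun Ω (D.formFun k)‖ ^ 2 + η * ‖D.formOp k‖ ^ 2 ≤ (⟪D.primOp k, k⟫_ℂ).re := by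
    rw [inner_primOp_left, inner_primOp, Complex.add_re, Complex.add_re]
    have e1 : ‖sobFun Ω (D.formFun k)‖ ^ 2 ≤ (⟪D.formEmb k, D.formEmb k⟫_ℂ).re := by
      have e2 : (⟪D.formEmb k, D.formEmb k⟫_ℂ).re = ‖D.formEmb k‖ ^ 2 :=
        inner_self_eq_norm_sq (𝕜 := ℂ) (D.formEmb k)
      rw [e2, WithLp.prod_norm_sq_eq_of_L2]
      exact le_add_of_nonneg_right (sq_nonneg _)
    have e2 := le_re_inner_mulOp D.memα hα (D.formOp k)
    have e3 := le_re_inner_mulOp D.memγ (c := 0) D.nonnegγ (D.formBdry k)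
    linarith
  rw [norm_formSpace_sq]
  exact key _ _ _ _ _ (sq_nonneg _) (sq_nonneg _) (h1 _) h2 h3

lemma norm_formEmb_sq_le (k : D.FormSpace) : ‖D.formEmb k‖ ^ 2 ≤ (⟪D.primOp k, k⟫_ℂ).re := by
  rw [inner_primOp_left, inner_primOp, Complex.add_re, Complex.add_re]
  obtain ⟨η, hη, hα⟩ := D.lowerα
  have e1 : (⟪D.formEmb k, D.formEmb k⟫_ℂ).re = ‖D.formEmb k‖ ^ 2 :=
    inner_self_eq_norm_sq (𝕜 := ℂ) (D.formEmb k)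
  have e2 := le_re_inner_mulOp D.memα (c := 0) (hα.mono fun x hx => hη.le.trans hx) (D.formOp k)
  have e3 := le_re_inner_mulOp D.memγ (c := 0) D.nonnegγ (D.formBdry k)
  linarith

/-! ### Density of the form domain -/

/-- The domain of `B_{N,δ}` is dense in the Sobolev space: it contains the range of
`(1 + B_{N,δ})⁻¹`. -/
lemma denseRange_formFun : DenseRange D.formFun := by
  obtain ⟨c, hc, h⟩ := D.exists_mul_norm_sq_le
  obtain ⟨N, hN1, hN2⟩ := exists_inverse_of_coercive ((sobFunAdj Ω).comp (sobFun Ω) + D.subOp) hc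
    fun x => by
      rw [← inner_conj_symm, Complex.conj_re]
      have h1 : ⟪x, ((sobFunAdj Ω).comp (sobFun Ω) + D.subOp) x⟫_ℂ =
          ⟪sobFun Ω x, sobFun Ω x⟫_ℂ + ⟪x, D.subOp x⟫_ℂ := by
        rw [add_apply, inner_add_right, ContinuousLinearMap.comp_apply, inner_sobFunAdj]
      have h2 : (⟪sobFun Ω x, sobFun Ω x⟫_ℂ).re = ‖sobFun Ω x‖ ^ 2 :=
        inner_self_eq_norm_sq (𝕜 := ℂ) _
      rw [h1, Complex.add_re, h2]
      exact h x
  have hdense : DenseRange (sobFunAdj Ω) := by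
    have h3 : (sobFunAdj Ω).range.topologicalClosure = ⊤ := by
      rw [Submodule.topologicalClosure_eq_top_iff, Submodule.eq_bot_iff]
      intro y hy
      refine sobFun_injective D.domain ?_
      rw [map_zero]
      refine ext_inner_right ℂ fun f => ?_
      have h4 : ⟪sobFunAdj Ω f, y⟫_ℂ = 0 := (Submodule.mem_orthogonal _ _).1 hy _ ⟨f, rfl⟩
      rw [← inner_sobFunAdj, inner_zero_left, ← inner_conj_symm, h4, map_zero]
    have h4 := Submodule.dense_iff_topologicalClosure_eq_top.2 h3
    exact h4
  have hsurj : Function.Surjective N := fun x => ⟨_, hN2 x⟩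
  have h5 : DenseRange (N ∘ sobFunAdj Ω) := hsurj.denseRange.comp hdense N.continuous
  refine h5.mono ?_
  rintro _ ⟨f, rfl⟩
  have h6 : D.subOp (N (sobFunAdj Ω f)) = sobFunAdj Ω (f - sobFun Ω (N (sobFunAdj Ω f))) := by
    have h7 := hN1 (sobFunAdj Ω f)
    rw [add_apply, ContinuousLinearMap.comp_apply] at h7
    rw [map_sub, eq_sub_iff_add_eq, add_comm]
    exact h7
  obtain ⟨k, hk, -⟩ := D.exists_formSpace h6
  exact ⟨k, hk⟩

/-- The range of `u ↦ (u, tr u)` is dense in `ℋ`. Testing with functions supported in `Ω` detects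
the first component, and testing with arbitrary smooth functions detects the second one. -/
lemma denseRange_sobEmb : DenseRange D.sobEmb := by
  have hΩ := D.domain
  have hfin := hΩ.isFiniteMeasure_vol
  have hfin' := hΩ.isFiniteMeasure_surf
  have hfinw : IsFiniteMeasure (wsurf Ω β) := by
    obtain ⟨c, hc, hle⟩ := D.wsurf_le
    have := Measure.smul_finite (surf Ω) hc
    exact isFiniteMeasure_of_le _ hle
  have h3 : D.sobEmb.range.topologicalClosure = ⊤ := by
    rw [Submodule.topologicalClosure_eq_top_iff, Submodule.eq_bot_iff]
    intro f hf
    have key : ∀ g : Sp d → ℝ, ContDiff ℝ ∞ g →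
        ∫ x, g x • f.fst x ∂vol Ω + ∫ x, g x • f.snd x ∂wsurf Ω β = 0 := by
      intro g hg
      obtain ⟨x, h1, -, h2⟩ := exists_sobolev_of_contDiff hΩ (Complex.ofRealCLM.contDiff.comp hg)
      have h4 := (Submodule.mem_orthogonal _ _).1 hf _ ⟨x, rfl⟩
      have h5 : (D.sobEmb x).snd =ᵐ[wsurf Ω β] _ :=
        (D.coeFn_snd_sobEmb x).trans (D.wsurf_ac.ae_eq h2)
      have h6 : ⟪D.sobEmb x, f⟫_ℂ = _ := D.inner_sobEmb x f
      rw [inner_eq_integral h1 EventuallyEq.rfl, inner_eq_integral h5 EventuallyEq.rfl] at h6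
      rw [← h4]
      refine Eq.trans ?_ h6.symm
      simp [mul_comm]
    have hf1 : f.fst =ᵐ[vol Ω] (0 : Sp d → ℂ) := by
      have hint : Integrable f.fst (vol Ω) := (Lp.memLp f.fst).integrable (by norm_num)
      have := hΩ.isOpen.ae_eq_zero_of_integral_contDiff_smul_eq_zero
        (hint.locallyIntegrable.locallyIntegrableOn Ω) fun g hg hc hs => by
          have h4 := key g hg
          have h5 : ∫ x, g x • f.snd x ∂wsurf Ω β = 0 := by
            refine integral_eq_zero_of_ae ?_
            filter_upwards [D.wsurf_ac.ae_le ae_surf_mem] with x hx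
            have h6 : x ∉ Ω := fun h7 => by
              rw [hΩ.isOpen.frontier_eq] at hx
              exact hx.2 h7
            simp [image_eq_zero_of_notMem_tsupport fun h7 => h6 (hs h7)]
          rwa [h5, add_zero] at h4
      filter_upwards [this, ae_vol_mem hΩ] with x h4 h5 using h4 h5
    have hf2 : f.snd =ᵐ[wsurf Ω β] (0 : Sp d → ℂ) := by
      have hint : Integrable f.snd (wsurf Ω β) := (Lp.memLp f.snd).integrable (by norm_num)
      refine ae_eq_zero_of_integral_contDiff_smul_eq_zero hint.locallyIntegrable
        fun g hg hc => ?_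
      have h4 := key g hg
      have h5 : ∫ x, g x • f.fst x ∂vol Ω = 0 := by
        refine integral_eq_zero_of_ae ?_
        filter_upwards [hf1] with x hx
        simp [hx]
      rwa [h5, zero_add] at h4
    refine (WithLp.ofLp_injective 2) (Prod.ext ?_ ?_)
    · exact Lp.ext (hf1.trans (Lp.coeFn_zero _ _ _).symm)
    · exact Lp.ext (hf2.trans (Lp.coeFn_zero _ _ _).symm)
  exact Submodule.dense_iff_topologicalClosure_eq_top.2 h3

lemma denseRange_formEmb : DenseRange D.formEmb :=
  D.denseRange_sobEmb.comp D.denseRange_formFun D.sobEmb.continuous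

/-- The resolvent `(1 + 𝒜)⁻¹`. -/
lemma exists_isResolvent : ∃ R : HSpace Ω β →L[ℂ] HSpace Ω β, IsResolvent R ∧
    (∀ u f, IsA Ω Q α β γ δ u (-f) ↔ u = R (u - f)) ∧
      ∀ p, IsFormBounded R p ↔ ∃ k, D.formEmb k = p := by
  obtain ⟨c, hc, hcoer⟩ := D.exists_mul_norm_sq_le_primOp
  obtain ⟨R, hR, hR1, hR2⟩ := exists_isResolvent_of_coercive D.formEmb D.denseRange_formEmb
    D.primOp D.inner_primOp_left hc hcoer D.norm_formEmb_sq_le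
  refine ⟨R, hR, fun u f => ?_, hR2⟩
  rw [hR1]
  constructor
  · rintro ⟨w, hu, h⟩
    obtain ⟨k, rfl, hk⟩ := D.inFormDomain_iff.1 hu
    refine ⟨k, rfl, fun l => ?_⟩
    rw [D.inner_primOp_eq_primForm hk EventuallyEq.rfl,
      h _ _ (D.inFormDomain_iff.2 ⟨l, rfl, EventuallyEq.rfl⟩), inner_sub_right, inner_neg_right,
      sub_eq_add_neg]
  · rintro ⟨k, rfl, h⟩
    refine ⟨D.formOp k, D.inFormDomain_iff.2 ⟨k, rfl, EventuallyEq.rfl⟩, fun v z hv => ?_⟩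
    obtain ⟨l, rfl, hl⟩ := D.inFormDomain_iff.1 hv
    have h1 := h l
    rw [D.inner_primOp_eq_primForm EventuallyEq.rfl hl, inner_sub_right] at h1
    rw [inner_neg_right]
    linear_combination h1

end FormData

end

noncomputable section

variable {d : ℕ}

/-! ### Smooth functions with compact support in the form domain -/

/-- The `i`-th component of the conormal field `Q ∇u`. -/
def flux (Q : Sp d → Matrix (Fin d) (Fin d) ℝ) (u : Sp d → ℝ) (i : Fin d) (x : Sp d) : ℝ :=
  ∑ j, Q x i j * partialDeriv j u x

/-- The function `div Q ∇u`. -/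
def fluxDiv (Q : Sp d → Matrix (Fin d) (Fin d) ℝ) (u : Sp d → ℝ) (x : Sp d) : ℝ :=
  ∑ i, partialDeriv i (flux Q u i) x

lemma partialDeriv_eq_zero {u : Sp d → ℝ} {x : Sp d} (hx : x ∉ tsupport u) (i : Fin d) :
    partialDeriv i u x = 0 := by
  have : fderiv ℝ u x = 0 := by
    by_contra hne
    exact hx (support_fderiv_subset ℝ hne)
  rw [partialDeriv, this]
  rfl

lemma tsupport_flux_subset (Q : Sp d → Matrix (Fin d) (Fin d) ℝ) (u : Sp d → ℝ) (i : Fin d) :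
    tsupport (flux Q u i) ⊆ tsupport u := by
  refine closure_minimal (fun x hx => ?_) (isClosed_tsupport u)
  by_contra hne
  exact hx (Finset.sum_eq_zero fun j _ => by rw [partialDeriv_eq_zero hne, mul_zero])

lemma contDiff_partialDeriv {u : Sp d → ℝ} (hu : ContDiff ℝ ∞ u) (i : Fin d) :
    ContDiff ℝ ∞ (partialDeriv i u) :=
  (hu.fderiv_right (m := ∞) (by simp)).clm_apply contDiff_const

lemma contDiff_flux {Q : Sp d → Matrix (Fin d) (Fin d) ℝ} {Ω : Set (Sp d)}
    (hQ : ∀ i j, ∀ x ∈ Ω, ContDiffAt ℝ 1 (fun x => Q x i j) x) {u : Sp d → ℝ}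
    (hu : ContDiff ℝ ∞ u) (hs : tsupport u ⊆ Ω) (i : Fin d) : ContDiff ℝ 1 (flux Q u i) := by
  refine contDiff_iff_contDiffAt.2 fun x => ?_
  by_cases hx : x ∈ tsupport u
  · exact ContDiffAt.sum fun j _ => (hQ i j x (hs hx)).mul
      ((contDiff_partialDeriv hu j).of_le (by simp)).contDiffAt
  · have h1 : flux Q u i =ᶠ[𝓝 x] fun _ => 0 := by
      filter_upwards [(isClosed_tsupport u).isOpen_compl.mem_nhds hx] with y hy
      exact Finset.sum_eq_zero fun j _ => by rw [partialDeriv_eq_zero hy, mul_zero]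
    exact contDiffAt_const.congr_of_eventuallyEq h1

lemma partialDeriv_ofReal {u : Sp d → ℝ} (hu : ContDiff ℝ 1 u) (i : Fin d) (x : Sp d) :
    partialDeriv i (fun y => (u y : ℂ)) x = ((partialDeriv i u x : ℝ) : ℂ) := by
  have h3 := Complex.ofRealCLM.hasFDerivAt.comp x (hu.differentiable one_ne_zero x).hasFDerivAt
  have h4 : fderiv ℝ (fun y => ((u y : ℝ) : ℂ)) x = _ := h3.fderiv
  rw [partialDeriv, h4]
  rfl

lemma coeFn_sum {X ι : Type*} [MeasurableSpace X] {μ : Measure X} (s : Finset ι)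
    (f : ι → Lp ℂ 2 μ) : (∑ i ∈ s, f i : Lp ℂ 2 μ) =ᵐ[μ] fun x => ∑ i ∈ s, f i x := by
  classical
  induction s using Finset.induction_on with
  | empty => exact Lp.coeFn_zero ℂ 2 μ
  | insert a s ha ih =>
    rw [Finset.sum_insert ha]
    filter_upwards [Lp.coeFn_add (f a) (∑ i ∈ s, f i), ih] with x h1 h2
    rw [h1, Pi.add_apply, h2, Finset.sum_insert ha]

namespace FormData

variable {Ω : Set (Sp d)} {Q : Sp d → Matrix (Fin d) (Fin d) ℝ} {α β γ δ : Sp d → ℝ}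
variable (D : FormData Ω Q α β γ δ)

include D in
lemma continuous_fluxDiv {u : Sp d → ℝ} (hu : ContDiff ℝ ∞ u) (hs : tsupport u ⊆ Ω) :
    Continuous (fluxDiv Q u) :=
  continuous_finsetSum _ fun i _ =>
    continuous_partialDeriv (contDiff_flux D.contDiffAtQ hu hs i) i

/-- Smooth functions with compact support in `Ω` are in `D(B_{N,δ})`, and `B_{N,δ}` acts on them as
`-div Q∇`. -/
lemma exists_formSpace_of_contDiff {u : Sp d → ℝ} (hu : ContDiff ℝ ∞ u) (hc : HasCompactSupport u)
    (hs : tsupport u ⊆ Ω) : ∃ k : D.FormSpace,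
      sobFun Ω (D.formFun k) =ᵐ[vol Ω] (fun x => (u x : ℂ)) ∧
      sobTrace Ω (D.formFun k) = 0 ∧
      D.formOp k =ᵐ[vol Ω] fun x => ((-fluxDiv Q u x : ℝ) : ℂ) := by
  have hΩ := D.domain
  have hu1 : ContDiff ℝ 1 u := hu.of_le (by simp)
  obtain ⟨x, h1, h2, h3⟩ := exists_sobolev_of_contDiff hΩ (Complex.ofRealCLM.contDiff.comp hu)
  have h3' : sobTrace Ω x = 0 := by
    refine Lp.ext (h3.trans ?_)
    filter_upwards [Lp.coeFn_zero ℂ 2 (surf Ω), ae_surf_mem] with y hy hy1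
    have h6 : y ∉ Ω := fun h7 => by
      rw [hΩ.isOpen.frontier_eq] at hy1
      exact hy1.2 h7
    rw [hy]
    simp [image_eq_zero_of_notMem_tsupport fun h7 => h6 (hs h7)]
  have hψ := contDiff_flux D.contDiffAtQ hu hs
  have hψs : ∀ i, tsupport (flux Q u i) ⊆ Ω := fun i => (tsupport_flux_subset Q u i).trans hs
  have hψc : ∀ i, HasCompactSupport (flux Q u i) := fun i =>
    hc.of_isClosed_subset (isClosed_tsupport _) (tsupport_flux_subset Q u i)
  have ha : ∀ i, MemLp (fun y => ((flux Q u i y : ℝ) : ℂ)) 2 (vol Ω) := fun i =>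
    memLp_ofReal (memLp_vol hΩ (hψ i).continuous 2)
  have hb : ∀ i, MemLp (fun y => ((partialDeriv i (flux Q u i) y : ℝ) : ℂ)) 2 (vol Ω) := fun i =>
    memLp_ofReal (memLp_vol hΩ (continuous_partialDeriv (hψ i) i) 2)
  have hw : MemLp (fun y => ((-fluxDiv Q u y : ℝ) : ℂ)) 2 (vol Ω) :=
    memLp_ofReal (memLp_vol hΩ (D.continuous_fluxDiv hu hs).neg 2)
  have hsum : hw.toLp = -∑ i, (hb i).toLp := by
    refine Lp.ext (hw.coeFn_toLp.trans (EventuallyEq.trans ?_ (Lp.coeFn_neg _).symm))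
    have h4 : ∀ᵐ y ∂vol Ω, ∀ i, ((hb i).toLp : Lp ℂ 2 (vol Ω)) y =
        ((partialDeriv i (flux Q u i) y : ℝ) : ℂ) :=
      ae_all_iff.2 fun i => (hb i).coeFn_toLp
    filter_upwards [h4, coeFn_sum Finset.univ fun i => (hb i).toLp] with y h5 h6
    simp only [Pi.neg_apply, h6, h5, fluxDiv]
    push_cast
    rfl
  have hflux : ∀ i, ∑ j, mulOp (fun x => Q x i j) (D.memQ i j) (sobGrad Ω j x) = (ha i).toLp := by
    intro i
    refine Lp.ext (EventuallyEq.trans ?_ (ha i).coeFn_toLp.symm)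
    have h4 : ∀ᵐ y ∂vol Ω, ∀ j, mulOp (fun x => Q x i j) (D.memQ i j) (sobGrad Ω j x) y =
        (Q y i j : ℂ) * sobGrad Ω j x y := ae_all_iff.2 fun j => coeFn_mulOp _ _
    have h5 : ∀ᵐ y ∂vol Ω, ∀ j, sobGrad Ω j x y = ((partialDeriv j u y : ℝ) : ℂ) :=
      ae_all_iff.2 fun j => (h2 j).trans (Eventually.of_forall fun y => partialDeriv_ofReal hu1 j y)
    filter_upwards [h4, h5, coeFn_sum Finset.univ fun j =>
      mulOp (fun x => Q x i j) (D.memQ i j) (sobGrad Ω j x)] with y h6 h7 h8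
    simp only [h8, h6, h7, flux]
    push_cast
    rfl
  have hparts : ∀ (y : sobolev Ω) i, ⟪sobGrad Ω i y, (ha i).toLp⟫_ℂ =
      -⟪sobFun Ω y, (hb i).toLp⟫_ℂ := by
    intro y i
    rw [← inner_conj_symm, ← inner_conj_symm (sobFun Ω y), ← map_neg,
      inner_eq_integral (ha i).coeFn_toLp EventuallyEq.rfl,
      inner_eq_integral (hb i).coeFn_toLp EventuallyEq.rfl]
    have h4 := integral_partialDeriv_mul hΩ y i (hψ i) (hψc i) (hψs i)
    simp only [RCLike.star_def, Complex.conj_ofReal, mul_comm] at h4 ⊢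
    rw [h4, neg_neg]
  have hx : D.subOp x = sobFunAdj Ω hw.toLp := by
    refine ext_inner_left ℂ fun y => ?_
    rw [D.inner_subOp_eq_sum, h3', map_zero, inner_zero_right, add_zero, inner_sobFunAdj, hsum,
      inner_neg_right, inner_sum, ← Finset.sum_neg_distrib]
    refine Finset.sum_congr rfl fun i _ => ?_
    rw [← inner_sum, hflux, hparts]
  obtain ⟨k, hk1, hk2⟩ := D.exists_formSpace hx
  refine ⟨k, ?_, ?_, ?_⟩
  · rw [hk1]
    exact h1
  · rw [hk1, h3']
  · rw [hk2]
    exact hw.coeFn_toLp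

lemma inner_subOp_left (x y : sobolev Ω) : ⟪D.subOp x, y⟫_ℂ = ⟪x, D.subOp y⟫_ℂ := by
  rw [← inner_conj_symm, inner_subOp_eq_sum, inner_subOp_eq_sum, map_add, inner_conj_symm,
    mulOp_inner_left, map_sum, Finset.sum_comm]
  congr 1
  refine Finset.sum_congr rfl fun i _ => ?_
  rw [map_sum]
  refine Finset.sum_congr rfl fun j _ => ?_
  rw [inner_conj_symm, mulOp_inner_left]
  congr 1
  refine Lp.ext ((coeFn_mulOp _ _).trans (EventuallyEq.trans ?_ (coeFn_mulOp _ _).symm))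
  filter_upwards [ae_vol_mem D.domain] with z hz
  rw [(D.symmQ z hz).apply]

/-- The very weak form of the equation `B_{N,δ} u = w`. -/
lemma integral_mul_formOp (k : D.FormSpace) {v : Sp d → ℝ} (hv : ContDiff ℝ ∞ v)
    (hc : HasCompactSupport v) (hs : tsupport v ⊆ Ω) :
    ∫ x, (v x : ℂ) * D.formOp k x ∂vol Ω =
      -∫ x, (fluxDiv Q v x : ℂ) * sobFun Ω (D.formFun k) x ∂vol Ω := by
  obtain ⟨l, h1, -, h2⟩ := D.exists_formSpace_of_contDiff hv hc hs
  have h3 : ⟪sobFun Ω (D.formFun l), D.formOp k⟫_ℂ = ⟪D.formOp l, sobFun Ω (D.formFun k)⟫_ℂ := by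
    rw [← inner_sobFunAdj, ← subOp_formFun, ← inner_subOp_left, subOp_formFun, ← inner_conj_symm,
      inner_sobFunAdj, inner_conj_symm]
  rw [inner_eq_integral h1 EventuallyEq.rfl, inner_eq_integral h2 EventuallyEq.rfl] at h3
  simp only [RCLike.star_def, Complex.conj_ofReal, mul_comm (D.formOp k _), mul_comm
    (sobFun Ω _ _)] at h3
  rw [h3, ← integral_neg]
  congr 1
  funext x
  push_cast
  ring

end FormData

end

noncomputable section

variable {d : ℕ}

/-! ### Functions with a kink along a hyperplane -/

/-- The volume of the part of a ball in the layer `ε / 2 < y i - x i < ε` is at least proportional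
to `ε`: this part contains a box. -/
lemma exists_le_volume_layer (x : Sp d) (i : Fin d) {r : ℝ} (hr : 0 < r) : ∃ C : ℝ, 0 < C ∧
    ∀ᶠ ε in 𝓝[>] (0 : ℝ),
      C * ε ≤ volume.real {y | y ∈ Metric.ball x r ∧ ε / 2 < y i - x i ∧ y i - x i < ε} := by
  have hopen : IsOpen ((WithLp.toLp 2 : (Fin d → ℝ) → Sp d) ⁻¹' Metric.ball x r) :=
    Metric.isOpen_ball.preimage (PiLp.continuous_toLp 2 _)
  obtain ⟨s, hs, hsub⟩ := Metric.isOpen_iff.1 hopen x.ofLp (by simpa using hr)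
  refine ⟨1 / 2 * ∏ _j ∈ Finset.univ.erase i, (2 * s), by positivity, ?_⟩
  -- The box has the side length `ε / 2` in direction `i` and `2 s` in the other directions.
  filter_upwards [Ioo_mem_nhdsGT hs] with ε hε
  set A : Fin d → Set ℝ := fun j => if j = i then Ioo (x i + ε / 2) (x i + ε)
    else Ioo (x j - s) (x j + s) with hA
  have hvol : volume (Set.pi univ A) =
      ENNReal.ofReal (1 / 2 * (∏ _j ∈ Finset.univ.erase i, (2 * s)) * ε) := by
    rw [volume_pi_pi, ← Finset.mul_prod_erase _ _ (Finset.mem_univ i)]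
    have h1 : volume (A i) = ENNReal.ofReal (ε / 2) := by
      simp only [hA, if_true, Real.volume_Ioo]
      congr 1
      ring
    have h2 : ∏ j ∈ Finset.univ.erase i, volume (A j) =
        ∏ j ∈ Finset.univ.erase i, ENNReal.ofReal (2 * s) := by
      refine Finset.prod_congr rfl fun j hj => ?_
      simp only [hA, if_neg (Finset.ne_of_mem_erase hj), Real.volume_Ioo]
      congr 1
      ring
    rw [h1, h2, ← ENNReal.ofReal_prod_of_nonneg fun j _ => by positivity,
      ← ENNReal.ofReal_mul (by linarith [hε.1])]
    congr 1
    ring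
  have hsub2 : (WithLp.ofLp : Sp d → Fin d → ℝ) ⁻¹' (Set.pi univ A) ⊆
      {y | y ∈ Metric.ball x r ∧ ε / 2 < y i - x i ∧ y i - x i < ε} := by
    intro y hy
    have h1 : y i ∈ Ioo (x i + ε / 2) (x i + ε) := by
      have := hy i (mem_univ i)
      simpa [hA] using this
    refine ⟨?_, by linarith [h1.1], by linarith [h1.2]⟩
    have h2 : y.ofLp ∈ Metric.ball x.ofLp s := by
      rw [Metric.mem_ball, dist_pi_lt_iff hs]
      intro j
      rw [Real.dist_eq, abs_lt]
      by_cases hj : j = i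
      · subst hj
        constructor <;> linarith [h1.1, h1.2, hε.1, hε.2]
      · have := hy j (mem_univ j)
        simp only [hA, if_neg hj] at this
        constructor <;> linarith [this.1, this.2]
    exact hsub h2
  have hmeas : MeasurableSet (Set.pi univ A) := by
    refine MeasurableSet.univ_pi fun j => ?_
    simp only [hA]
    split_ifs <;> exact measurableSet_Ioo
  have h3 := (PiLp.volume_preserving_ofLp (Fin d)).measure_preimage hmeas.nullMeasurableSet
  have h4 := measure_mono (μ := volume) hsub2
  rw [h3, hvol] at h4
  refine (ENNReal.ofReal_le_iff_le_toReal ?_).1 h4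
  refine ne_top_of_le_ne_top (measure_ball_lt_top (μ := volume) (x := x) (r := r)).ne
    (measure_mono fun y hy => hy.1)

lemma volume_hyperplane (x : Sp d) (i : Fin d) : ∀ᵐ y : Sp d, y i - x i ≠ 0 := by
  have h1 := Measure.pi_hyperplane (fun _ : Fin d => (volume : Measure ℝ)) i (x i)
  have h2 := (PiLp.volume_preserving_ofLp (Fin d)).quasiMeasurePreserving.preimage_null h1
  refine measure_mono_null (fun y hy => ?_) h2
  simpa [sub_eq_zero] using hy

/-- The derivatives of `c + b |y i - x i|` in the sense of distributions. -/
lemma integral_kink_mul_partialDeriv (x : Sp d) (i j : Fin d) (c b : ℝ) {ψ : Sp d → ℝ}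
    (hψ : ContDiff ℝ 1 ψ) (hc : HasCompactSupport ψ) :
    ∫ y, (c + b * |y i - x i|) * partialDeriv j ψ y =
      -if j = i then b * ∫ y, (SignType.sign (y i - x i) : ℝ) * ψ y else 0 := by
  obtain ⟨C, hC⟩ := ContDiff.lipschitzWith_of_hasCompactSupport hc hψ one_ne_zero
  have hf : ∃ K, LipschitzWith K fun y : Sp d => c + b * |y i - x i| := by
    refine ⟨‖b‖₊, LipschitzWith.of_dist_le_mul fun y z => ?_⟩
    rw [Real.dist_eq, coe_nnnorm]
    have h1 : c + b * |y i - x i| - (c + b * |z i - x i|) = b * (|y i - x i| - |z i - x i|) := by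
      ring
    rw [h1, abs_mul, Real.norm_eq_abs]
    gcongr
    refine (abs_abs_sub_abs_le_abs_sub _ _).trans ?_
    rw [sub_sub_sub_cancel_right, EuclideanSpace.dist_eq, ← Real.sqrt_sq_eq_abs]
    refine Real.sqrt_le_sqrt ?_
    refine le_trans ?_ (Finset.single_le_sum (f := fun j => dist (y j) (z j) ^ 2)
      (fun j _ => sq_nonneg _) (Finset.mem_univ i))
    rw [Real.dist_eq, sq_abs]
  obtain ⟨K, hK⟩ := hf
  have h1 := hK.integral_lineDeriv_mul_eq (μ := volume) hC hc (EuclideanSpace.single j 1)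
  have h2 : ∀ y, lineDeriv ℝ ψ y (-EuclideanSpace.single j 1) = -partialDeriv j ψ y := fun y => by
    rw [(hψ.differentiable one_ne_zero y).lineDeriv_eq_fderiv, map_neg]
    rfl
  have h3 : ∀ y : Sp d, lineDeriv ℝ (fun y : Sp d => c + b * |y i - x i|) y
      (EuclideanSpace.single j 1) = if j = i then b * (SignType.sign (y i - x i) : ℝ) else 0 := by
    intro y
    rw [lineDeriv]
    split_ifs with hij
    · subst hij
      have h4 : (fun t : ℝ => c + b * |(y + t • EuclideanSpace.single j (1 : ℝ)) j - x j|) =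
          fun t => c + b * |(y j - x j) + t| := by
        funext t
        congr 3
        simp
        ring
      rw [h4, deriv_const_add, deriv_const_mul_field, deriv_comp_const_add (f := fun s => |s|),
        add_zero, deriv_abs]
    · have h4 : (fun t : ℝ => c + b * |(y + t • EuclideanSpace.single j (1 : ℝ)) i - x i|) =
          fun t => c + b * |y i - x i| := by
        funext t
        simp [Ne.symm hij]
      rw [h4, deriv_const]
  simp only [h2, h3] at h1
  have h5 : ∫ y, (c + b * |y i - x i|) * partialDeriv j ψ y =
      -∫ y, -partialDeriv j ψ y * (c + b * |y i - x i|) := by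
    rw [← integral_neg]
    congr 1
    funext y
    ring
  rw [h5, ← h1]
  split_ifs with hij
  · rw [← integral_const_mul]
    congr 2
    funext y
    ring
  · simp

lemma measurable_sign_coord (x : Sp d) (i : Fin d) :
    Measurable fun y : Sp d => (SignType.sign (y i - x i) : ℝ) := by
  have h1 : (fun y : Sp d => (SignType.sign (y i - x i) : ℝ)) =
      deriv (fun s : ℝ => |s|) ∘ fun y => y i - x i := by
    funext y
    simp [deriv_abs]
  rw [h1]
  exact (measurable_deriv _).comp (by fun_prop)

/-- A smooth approximation of the indicator function of the hyperplane `y i = x i`. -/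
def layer (x : Sp d) (i : Fin d) (ε : ℝ) (y : Sp d) : ℝ := ε ^ 2 / (ε ^ 2 + (y i - x i) ^ 2)

lemma contDiff_layer (x : Sp d) (i : Fin d) {ε : ℝ} (hε : 0 < ε) : ContDiff ℝ ∞ (layer x i ε) := by
  unfold layer
  refine contDiff_const.div ?_ fun y => by positivity
  exact contDiff_const.add (((EuclideanSpace.proj (𝕜 := ℝ) i).contDiff.sub contDiff_const).pow 2)

lemma abs_layer_le (x : Sp d) (i : Fin d) {ε : ℝ} (hε : 0 < ε) (y : Sp d) :
    |layer x i ε y| ≤ 1 := by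
  have h : 0 < ε ^ 2 + (y i - x i) ^ 2 := by positivity
  rw [layer, abs_of_nonneg (by positivity), div_le_one h]
  linarith [sq_nonneg (y i - x i)]

lemma tendsto_layer {x : Sp d} {i : Fin d} {y : Sp d} (h : y i - x i ≠ 0) :
    Tendsto (fun ε => layer x i ε y) (𝓝[>] 0) (𝓝 0) := by
  have h1 : ContinuousAt (fun ε => layer x i ε y) 0 := by
    unfold layer
    exact ContinuousAt.div (by fun_prop) (by fun_prop) (by positivity)
  have h2 : layer x i 0 y = 0 := by simp [layer]
  have h3 := h1.tendsto
  rw [h2] at h3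
  exact h3.mono_left nhdsWithin_le_nhds

lemma partialDeriv_layer (x : Sp d) (i j : Fin d) {ε : ℝ} (hε : 0 < ε) (y : Sp d) :
    partialDeriv j (layer x i ε) y =
      if j = i then -(2 * (y i - x i) * ε ^ 2 / (ε ^ 2 + (y i - x i) ^ 2) ^ 2) else 0 := by
  have h : ε ^ 2 + (y i - x i) ^ 2 ≠ 0 := by positivity
  have h1 : HasFDerivAt (fun z : Sp d => z i) (EuclideanSpace.proj (𝕜 := ℝ) i : Sp d →L[ℝ] ℝ) y :=
    (EuclideanSpace.proj (𝕜 := ℝ) i : Sp d →L[ℝ] ℝ).hasFDerivAt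
  have h2 : HasDerivAt (fun s : ℝ => ε ^ 2 / (ε ^ 2 + (s - x i) ^ 2))
      (-(2 * (y i - x i) * ε ^ 2 / (ε ^ 2 + (y i - x i) ^ 2) ^ 2)) (y i) := by
    have h3 := (((hasDerivAt_id (y i)).sub_const (x i)).pow 2).const_add (ε ^ 2)
    have h4 := (hasDerivAt_const (y i) (ε ^ 2)).div h3 h
    refine h4.congr_deriv ?_
    simp
    ring
  have h3 := h2.comp_hasFDerivAt y h1
  have h4 : fderiv ℝ (layer x i ε) y = _ := h3.fderiv
  rw [partialDeriv, h4]
  by_cases hij : j = i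
  · subst hij
    simp
  · simp [hij, Ne.symm hij]

lemma flux_mul (Q : Sp d → Matrix (Fin d) (Fin d) ℝ) {χ η : Sp d → ℝ} (hχ : ContDiff ℝ ∞ χ)
    (hη : ContDiff ℝ ∞ η) (i : Fin d) (y : Sp d) :
    flux Q (fun z => χ z * η z) i y = η y * flux Q χ i y + χ y * flux Q η i y := by
  simp only [flux, Finset.mul_sum, ← Finset.sum_add_distrib]
  refine Finset.sum_congr rfl fun j _ => ?_
  have h1 : partialDeriv j (fun z => χ z * η z) y =
      χ y * partialDeriv j η y + η y * partialDeriv j χ y := by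
    have h2 := ((hχ.differentiable (by simp) y).hasFDerivAt.mul
      (hη.differentiable (by simp) y).hasFDerivAt).fderiv
    have h3 : fderiv ℝ (fun z => χ z * η z) y = _ := h2
    rw [partialDeriv, h3]
    rfl
  rw [h1]
  ring

namespace FormData

variable {Ω : Set (Sp d)} {Q : Sp d → Matrix (Fin d) (Fin d) ℝ} {α β γ δ : Sp d → ℝ}
variable (D : FormData Ω Q α β γ δ)

/-- The equation `B_{N,δ} u = w`, tested with a function supported where `u` is
`c + b |y i - x i|`. -/
lemma integral_mul_formOp_of_kink (k : D.FormSpace) {x : Sp d} {i : Fin d} {s : Set (Sp d)}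
    {c b : ℝ}
    (hk : ∀ᵐ y ∂vol Ω, y ∈ s →
      sobFun Ω (D.formFun k) y = ((c + b * |y i - x i| : ℝ) : ℂ)) (hsΩ : s ⊆ Ω) {v : Sp d → ℝ}
    (hv : ContDiff ℝ ∞ v) (hc : HasCompactSupport v) (hs : tsupport v ⊆ s) :
    ∫ y, (v y : ℂ) * D.formOp k y ∂vol Ω =
      ((b * ∫ y, (SignType.sign (y i - x i) : ℝ) * flux Q v i y : ℝ) : ℂ) := by
  have hψ := contDiff_flux D.contDiffAtQ hv (hs.trans hsΩ)
  have hψs : ∀ j, tsupport (flux Q v j) ⊆ tsupport v := fun j => tsupport_flux_subset Q v j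
  have hψc : ∀ j, HasCompactSupport (flux Q v j) := fun j =>
    hc.of_isClosed_subset (isClosed_tsupport _) (hψs j)
  have h0 : ∀ y, y ∉ tsupport v → fluxDiv Q v y = 0 := fun y hy =>
    Finset.sum_eq_zero fun j _ => partialDeriv_eq_zero (fun h => hy (hψs j h)) j
  rw [D.integral_mul_formOp k hv hc (hs.trans hsΩ)]
  have h1 : ∫ y, (fluxDiv Q v y : ℂ) * sobFun Ω (D.formFun k) y ∂vol Ω =
      ∫ y, (((c + b * |y i - x i|) * fluxDiv Q v y : ℝ) : ℂ) ∂vol Ω := by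
    refine integral_congr_ae ?_
    filter_upwards [hk] with y hy
    by_cases hyv : y ∈ tsupport v
    · rw [hy (hs hyv)]
      push_cast
      ring
    · simp [h0 y hyv]
  have h2 : ∫ y, (c + b * |y i - x i|) * fluxDiv Q v y ∂vol Ω =
      ∫ y, (c + b * |y i - x i|) * fluxDiv Q v y :=
    setIntegral_eq_integral_of_forall_compl_eq_zero fun y hy => by
      rw [h0 y fun h => hy (hsΩ (hs h)), mul_zero]
  have h3 : ∫ y, (c + b * |y i - x i|) * fluxDiv Q v y =
      ∑ j, ∫ y, (c + b * |y i - x i|) * partialDeriv j (flux Q v j) y := by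
    simp only [fluxDiv, Finset.mul_sum]
    refine integral_finsetSum _ fun j _ => ?_
    have h4 : HasCompactSupport fun y => partialDeriv j (flux Q v j) y :=
      (hψc j).fderiv_apply (𝕜 := ℝ) (EuclideanSpace.single j 1)
    refine Continuous.integrable_of_hasCompactSupport ?_ h4.mul_left
    exact Continuous.mul (by fun_prop) (continuous_partialDeriv (hψ j) j)
  rw [h1, integral_complex_ofReal, h2, h3, ← Complex.ofReal_neg]
  congr 1
  simp only [integral_kink_mul_partialDeriv x i _ c b (hψ _) (hψc _), Finset.sum_neg_distrib,
    Finset.sum_ite_eq', Finset.mem_univ, if_true, neg_neg]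

/-- Functions in `D(B_{N,δ})` have no kinks: if `u = c + b |y i - x i|` near a point `x`, then
`b = 0`. Indeed, `-div Q∇u` contains the surface measure on the hyperplane `y i = x i`, with density
`-2 b Q i i`, unless `b = 0`. -/
lemma kink_eq_zero (k : D.FormSpace) {x : Sp d} {i : Fin d} {ρ c b : ℝ} (hρ : 0 < ρ)
    (hball : Metric.ball x ρ ⊆ Ω)
    (hk : ∀ᵐ y ∂vol Ω, y ∈ Metric.ball x ρ →
      sobFun Ω (D.formFun k) y = ((c + b * |y i - x i| : ℝ) : ℂ)) : b = 0 := by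
  by_contra hb
  obtain ⟨κ, hκ, hell⟩ := D.elliptic
  have hΩ := D.domain
  let χ : ContDiffBump x := ⟨ρ / 4, ρ / 2, by positivity, by linarith⟩
  have hχ : ContDiff ℝ ∞ χ := χ.contDiff
  have hχc : HasCompactSupport χ := χ.hasCompactSupport
  have hχs : tsupport χ ⊆ Metric.ball x ρ := by
    rw [χ.tsupport_eq]
    exact Metric.closedBall_subset_ball (by simp only [χ]; linarith)
  set v : ℝ → Sp d → ℝ := fun ε y => χ y * layer x i ε y with hv
  have hvs : ∀ ε, tsupport (v ε) ⊆ tsupport χ := fun ε => tsupport_mul_subset_left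
  have hvc : ∀ ε, HasCompactSupport (v ε) := fun ε => hχc.mul_right
  have hvd : ∀ ε, 0 < ε → ContDiff ℝ ∞ (v ε) := fun ε hε => hχ.mul (contDiff_layer x i hε)
  have hpos : ∀ᶠ ε in 𝓝[>] (0 : ℝ), 0 < ε := self_mem_nhdsWithin
  set sg : Sp d → ℝ := fun y => (SignType.sign (y i - x i) : ℝ) with hsg
  have hsg1 : ∀ y, |sg y| ≤ 1 := fun y => by
    simp only [hsg]
    rcases lt_trichotomy (y i - x i) 0 with h | h | h <;> simp [h]
  have hsgm : Measurable sg := measurable_sign_coord x i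
  have hfi : ∀ {u : Sp d → ℝ}, ContDiff ℝ ∞ u → tsupport u ⊆ tsupport χ →
      Integrable (flux Q u i) := fun {u} hu hs =>
    (contDiff_flux D.contDiffAtQ hu (hs.trans (hχs.trans hball)) i).continuous
      |>.integrable_of_hasCompactSupport
      (hχc.of_isClosed_subset (isClosed_tsupport _) ((tsupport_flux_subset Q u i).trans hs))
  -- The right-hand side of the tested equation and the part of the left-hand side in which the
  -- derivative falls on the cut-off function `χ` vanish in the limit.
  have hA : Tendsto (fun ε => ∫ y, (v ε y : ℂ) * D.formOp k y ∂vol Ω) (𝓝[>] 0) (𝓝 0) := by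
    rw [← integral_zero (Sp d) ℂ (μ := vol Ω)]
    refine tendsto_integral_filter_of_dominated_convergence (fun y => ‖(χ y : ℂ) * D.formOp k y‖)
      ?_ ?_ ?_ ?_
    · filter_upwards [hpos] with ε hε
      exact (Complex.continuous_ofReal.comp
        (hvd ε hε).continuous).aestronglyMeasurable.mul (Lp.aestronglyMeasurable _)
    · filter_upwards [hpos] with ε hε
      refine Eventually.of_forall fun y => ?_
      rw [norm_mul, norm_mul, Complex.norm_real, Complex.norm_real]
      gcongr
      rw [hv, norm_mul]
      exact mul_le_of_le_one_right (norm_nonneg _) (abs_layer_le x i hε y)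
    · have h1 : MemLp (fun y => (χ y : ℂ)) 2 (vol Ω) := memLp_ofReal (memLp_vol hΩ χ.continuous 2)
      exact (h1.integrable_mul (Lp.memLp (D.formOp k))).norm
    · filter_upwards [ae_restrict_of_ae (volume_hyperplane x i)] with y hy
      have h1 := ((tendsto_layer hy).const_mul (χ y)).ofReal.mul_const (D.formOp k y)
      simpa [hv] using h1
  have hB : Tendsto (fun ε => ∫ y, sg y * (layer x i ε y * flux Q χ i y)) (𝓝[>] 0) (𝓝 0) := by
    rw [show 𝓝 (0 : ℝ) = 𝓝 (∫ _ : Sp d, (0 : ℝ)) by rw [integral_zero]]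
    refine tendsto_integral_filter_of_dominated_convergence (fun y => ‖flux Q χ i y‖) ?_ ?_ ?_ ?_
    · filter_upwards [hpos] with ε hε
      exact hsgm.aestronglyMeasurable.mul
        ((contDiff_layer x i hε).continuous.aestronglyMeasurable.mul
        (hfi hχ subset_rfl).aestronglyMeasurable)
    · filter_upwards [hpos] with ε hε
      refine Eventually.of_forall fun y => ?_
      rw [norm_mul, norm_mul, ← mul_assoc]
      exact mul_le_of_le_one_left (norm_nonneg _)
        (mul_le_one₀ (hsg1 y) (norm_nonneg _) (abs_layer_le x i hε y))
    · exact (hfi hχ subset_rfl).norm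
    · filter_upwards [volume_hyperplane x i] with y hy
      have h1 := ((tendsto_layer hy).mul_const (flux Q χ i y)).const_mul (sg y)
      simpa using h1
  -- The remaining part is bounded from below.
  obtain ⟨C, hC, hvol⟩ := exists_le_volume_layer x i (r := ρ / 4) (by positivity)
  -- This is so because the derivative of `layer` has modulus at least `1 / (4 ε)` for
  -- `ε / 2 < y i - x i < ε`, and this layer has a volume of order `ε`.
  have hlow : ∀ᶠ ε in 𝓝[>] (0 : ℝ), κ * C / 4 ≤ (∫ y, sg y * (layer x i ε y * flux Q χ i y)) -
      ∫ y, sg y * flux Q (v ε) i y := by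
    filter_upwards [hpos, hvol] with ε hε hvolε
    set S := {y | y ∈ Metric.ball x (ρ / 4) ∧ ε / 2 < y i - x i ∧ y i - x i < ε} with hS
    have hi1 : Integrable fun y => sg y * (layer x i ε y * flux Q χ i y) :=
      ((hfi hχ subset_rfl).bdd_mul (c := 1) (contDiff_layer x i hε).continuous.aestronglyMeasurable
        (Eventually.of_forall (abs_layer_le x i hε))).bdd_mul (c := 1) hsgm.aestronglyMeasurable
        (Eventually.of_forall hsg1)
    have hi2 : Integrable fun y => sg y * flux Q (v ε) i y :=
      (hfi (hvd ε hε) (hvs ε)).bdd_mul (c := 1) hsgm.aestronglyMeasurable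
        (Eventually.of_forall hsg1)
    rw [← integral_sub hi1 hi2]
    have hF : ∀ y, sg y * (layer x i ε y * flux Q χ i y) - sg y * flux Q (v ε) i y =
        χ y * (Q y i i * (2 * |y i - x i| * ε ^ 2 / (ε ^ 2 + (y i - x i) ^ 2) ^ 2)) := by
      intro y
      have h1 : flux Q (layer x i ε) i y =
          Q y i i * -(2 * (y i - x i) * ε ^ 2 / (ε ^ 2 + (y i - x i) ^ 2) ^ 2) := by
        simp only [flux, partialDeriv_layer x i _ hε, mul_ite, mul_zero, Finset.sum_ite_eq',
          Finset.mem_univ, if_true]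
      have h2 : |y i - x i| = sg y * (y i - x i) := (sign_mul_self _).symm
      rw [hv, flux_mul Q hχ (contDiff_layer x i hε), h1, h2]
      ring
    have hQ : ∀ y ∈ Ω, κ ≤ Q y i i := fun y hy => by
      have h1 := hell y hy (Pi.single i 1)
      simpa [Pi.single_apply] using h1
    have hF0 : ∀ y, 0 ≤ sg y * (layer x i ε y * flux Q χ i y) - sg y * flux Q (v ε) i y := by
      intro y
      rw [hF]
      by_cases hy : y ∈ tsupport χ
      · have h1 := hκ.le.trans (hQ y (hball (hχs hy)))
        have h2 : 0 ≤ χ y := χ.nonneg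
        positivity
      · rw [image_eq_zero_of_notMem_tsupport hy, zero_mul]
    have hFS : ∀ y ∈ S, κ / (4 * ε) ≤
        sg y * (layer x i ε y * flux Q χ i y) - sg y * flux Q (v ε) i y := by
      intro y hy
      obtain ⟨h1, h2, h3⟩ := hy
      have h4 : χ y = 1 := χ.one_of_mem_closedBall (Metric.ball_subset_closedBall h1)
      have h5 := hQ y (hball (Metric.ball_subset_ball (by linarith) h1))
      have h6 : 0 < y i - x i := by linarith
      rw [hF, h4, one_mul, abs_of_pos h6, div_eq_mul_one_div]
      refine mul_le_mul h5 ?_ (by positivity) (hκ.le.trans h5)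
      have h7 : (y i - x i) ^ 2 ≤ ε ^ 2 := pow_le_pow_left₀ h6.le h3.le 2
      rw [div_le_div_iff₀ (by positivity) (by positivity), one_mul]
      calc (ε ^ 2 + (y i - x i) ^ 2) ^ 2 ≤ (ε ^ 2 + ε ^ 2) ^ 2 := by gcongr
        _ = 2 * (ε / 2) * ε ^ 2 * (4 * ε) := by ring
        _ ≤ 2 * (y i - x i) * ε ^ 2 * (4 * ε) := by gcongr
    have hSm : MeasurableSet S := by
      have h1 : IsOpen {y : Sp d | ε / 2 < y i - x i} := isOpen_lt (by fun_prop) (by fun_prop)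
      have h2 : IsOpen {y : Sp d | y i - x i < ε} := isOpen_lt (by fun_prop) (by fun_prop)
      exact (Metric.isOpen_ball.inter (h1.inter h2)).measurableSet
    have hSfin : volume S ≠ ⊤ :=
      ne_top_of_le_ne_top (measure_ball_lt_top (μ := volume) (x := x) (r := ρ / 4)).ne
        (measure_mono fun y hy => hy.1)
    calc κ * C / 4 = κ / (4 * ε) * (C * ε) := by field_simp
      _ ≤ κ / (4 * ε) * volume.real S := by gcongr
      _ ≤ ∫ y in S, (sg y * (layer x i ε y * flux Q χ i y) - sg y * flux Q (v ε) i y) :=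
          setIntegral_ge_of_const_le_real hSm hSfin hFS (hi1.sub hi2).integrableOn
      _ ≤ _ := setIntegral_le_integral (hi1.sub hi2) (Eventually.of_forall hF0)
  have hA' : Tendsto (fun ε => ∫ y, sg y * flux Q (v ε) i y) (𝓝[>] 0) (𝓝 0) := by
    have h1 : Tendsto (fun ε => b⁻¹ * (∫ y, (v ε y : ℂ) * D.formOp k y ∂vol Ω).re) (𝓝[>] 0)
        (𝓝 0) := by
      have h2 := ((Complex.continuous_re.tendsto 0).comp hA).const_mul b⁻¹
      simpa using h2
    refine h1.congr' ?_
    filter_upwards [hpos] with ε hε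
    rw [D.integral_mul_formOp_of_kink k hk hball (hvd ε hε) (hvc ε) ((hvs ε).trans hχs),
      Complex.ofReal_re, inv_mul_cancel_left₀ hb]
  have h1 := ge_of_tendsto (hB.sub hA') hlow
  have h2 : 0 < κ * C / 4 := by positivity
  linarith

end FormData

end

noncomputable section

/-! ### Complex conjugation -/

section Conjugation

variable {H : Type*} [NormedAddCommGroup H] [InnerProductSpace ℂ H] [CompleteSpace H]

/-- The semigroup commutes with a conjugation if the resolvent does, because its conjugate is
generated by the same operator. -/
lemma IsResolvent.heatSemigroup_conj {R : H →L[ℂ] H} (hR : IsResolvent R) {J : H →L⋆[ℂ] H}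
    (hJ : ∀ x, J (J x) = x) (hRJ : ∀ x, R (J x) = J (R x)) (t : ℝ≥0) (x : H) :
    heatSemigroup R t (J x) = J (heatSemigroup R t x) := by
  obtain ⟨⟨h1, h2, h3⟩, h4⟩ := hR.isGeneratedBy
  let T' : ℝ≥0 → H →L[ℂ] H := fun t => J.comp ((heatSemigroup R t).comp J)
  have hT' : ∀ t x, T' t x = J (heatSemigroup R t (J x)) := fun t x => rfl
  have key : IsGeneratedBy T' fun u f => u = R (u - f) := by
    refine ⟨⟨?_, fun s t => ?_, fun u => J.continuous.comp (h3 _)⟩, fun u f => ?_⟩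
    · ext x
      rw [hT', h1, one_apply_eq_self, hJ, one_apply_eq_self]
    · ext x
      rw [mul_apply_eq_comp, hT', hT', hT', hJ, h2, mul_apply_eq_comp]
    · have h5 : u = R (u - f) ↔ J u = R (J u - J f) := by
        rw [← map_sub, hRJ]
        exact ⟨fun h => congrArg J h, fun h => by simpa only [hJ] using congrArg J h⟩
      have h6 : ∀ t : ℝ≥0, J (((t : ℝ) : ℂ)⁻¹ • (heatSemigroup R t (J u) - J u)) =
          ((t : ℝ) : ℂ)⁻¹ • (T' t u - u) := fun t => by
        rw [map_smulₛₗ, map_sub, hJ, map_inv₀, Complex.conj_ofReal, hT']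
      change u = R (u - f) ↔ _
      rw [h5]
      refine (h4 _ _).trans ?_
      constructor
      · intro h
        have h7 := (J.continuous.tendsto _).comp h
        rw [hJ] at h7
        exact h7.congr h6
      · intro h
        refine ((J.continuous.tendsto _).comp h).congr fun t => ?_
        rw [Function.comp_apply, ← h6, hJ]
  have h5 := congrFun (hR.eq_heatSemigroup key) t
  have h6 := hT' t (J x)
  rwa [h5, hJ] at h6

end Conjugation

variable {d : ℕ} {Ω : Set (Sp d)} {Q : Sp d → Matrix (Fin d) (Fin d) ℝ} {α β γ δ : Sp d → ℝ}

lemma HasWeakGradient.star {u : Sp d → ℂ} {G : Fin d → Sp d → ℂ} (h : HasWeakGradient Ω u G) :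
    HasWeakGradient Ω (star u) fun i => star (G i) where
  memLp := h.memLp.star
  memLp_grad i := (h.memLp_grad i).star
  weak i φ a b c := by
    have h1 := congrArg (starRingEnd ℂ) (h.weak i φ a b c)
    rw [map_neg, ← integral_conj, ← integral_conj] at h1
    simpa using h1

lemma partialDeriv_star {φ : Sp d → ℂ} (hφ : ContDiff ℝ ∞ φ) (i : Fin d) :
    partialDeriv i (star φ) = star (partialDeriv i φ) := by
  funext x
  have h1 := (Complex.conjCLE : ℂ →L[ℝ] ℂ).hasFDerivAt.comp x
    (hφ.differentiable (by simp) x).hasFDerivAt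
  have h2 : fderiv ℝ (star φ) x = _ := h1.fderiv
  rw [partialDeriv, h2]
  rfl

lemma eLpNorm_star_sub_star {μ : Measure (Sp d)} (f g : Sp d → ℂ) :
    eLpNorm (star f - star g) 2 μ = eLpNorm (f - g) 2 μ := by
  rw [← star_sub]
  exact eLpNorm_congr_norm_ae (Eventually.of_forall fun x => norm_star _)

lemma HasTrace.star {u g : Sp d → ℂ} (h : HasTrace Ω u g) : HasTrace Ω (star u) (star g) := by
  obtain ⟨hg, G, hG, φ, h1, h2, h3, h4⟩ := h
  refine ⟨hg.star, _, hG.star, fun n => Star.star (φ n), fun n => ?_, ?_, fun i => ?_, ?_⟩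
  · exact (Complex.conjCLE : ℂ →L[ℝ] ℂ).contDiff.comp (h1 n)
  · simpa only [eLpNorm_star_sub_star] using h2
  · simpa only [partialDeriv_star (h1 _), eLpNorm_star_sub_star] using h3 i
  · simpa only [eLpNorm_star_sub_star] using h4

lemma subForm_star (G : Fin d → Sp d → ℂ) (g : Sp d → ℂ) (G' : Fin d → Sp d → ℂ)
    (g' : Sp d → ℂ) :
    subForm Ω Q δ (fun i => star (G i)) (star g) (fun i => star (G' i)) (star g') =
      starRingEnd ℂ (subForm Ω Q δ G g G' g') := by
  simp only [subForm, map_add, ← integral_conj, map_sum, map_mul, Complex.conj_ofReal,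
    Pi.star_apply, RCLike.star_def]

lemma IsB.star {u w : Sp d → ℂ} (h : IsB Ω Q δ u w) : IsB Ω Q δ (star u) (star w) := by
  obtain ⟨hw, G, g, hG, hg, h⟩ := h
  refine ⟨hw.star, _, _, hG.star, hg.star, fun v G' g' hG' hg' => ?_⟩
  have h1 := subForm_star (Ω := Ω) (Q := Q) (δ := δ) G g (fun i => Star.star (G' i)) (Star.star g')
  rw [h _ _ _ hG'.star hg'.star, ← integral_conj] at h1
  simpa using h1

lemma IsB.congr {u u' w w' : Sp d → ℂ} (h : IsB Ω Q δ u w) (hu : u =ᵐ[vol Ω] u')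
    (hw : w =ᵐ[vol Ω] w') : IsB Ω Q δ u' w' := by
  obtain ⟨hw2, G, g, hG, hg, h⟩ := h
  refine ⟨(memLp_congr_ae hw).1 hw2, G, g, hG.congr hu, hg.congr hu EventuallyEq.rfl,
    fun v G' g' hG' hg' => ?_⟩
  rw [h v G' g' hG' hg']
  refine integral_congr_ae ?_
  filter_upwards [hw] with x hx
  rw [hx]

lemma lp_star_smul {μ : Measure (Sp d)} (c : ℂ) (f : Lp ℂ 2 μ) :
    star (c • f) = starRingEnd ℂ c • star f := by
  refine Lp.ext ((Lp.coeFn_star _).trans ?_)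
  filter_upwards [Lp.coeFn_smul c f, Lp.coeFn_smul (starRingEnd ℂ c) (star f), Lp.coeFn_star f]
    with x h1 h2 h3
  rw [h2, Pi.star_apply, h1, Pi.smul_apply, Pi.smul_apply, h3]
  simp

lemma lp_star_add {μ : Measure (Sp d)} (f g : Lp ℂ 2 μ) : star (f + g) = star f + star g := by
  refine Lp.ext ((Lp.coeFn_star _).trans ?_)
  filter_upwards [Lp.coeFn_add f g, Lp.coeFn_add (star f) (star g), Lp.coeFn_star f,
    Lp.coeFn_star g] with x h1 h2 h3 h4
  rw [h2, Pi.star_apply, h1, Pi.add_apply, Pi.add_apply, h3, h4]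
  simp

lemma lp_norm_star {μ : Measure (Sp d)} (f : Lp ℂ 2 μ) : ‖star f‖ = ‖f‖ := by
  rw [Lp.norm_def, Lp.norm_def, eLpNorm_congr_ae (Lp.coeFn_star f)]
  congr 1
  exact eLpNorm_congr_norm_ae (Eventually.of_forall fun x => norm_star _)

/-- Complex conjugation on `ℋ`, as a semilinear map. -/
def conjLin (Ω : Set (Sp d)) (β : Sp d → ℝ) : HSpace Ω β →ₗ⋆[ℂ] HSpace Ω β where
  toFun f := WithLp.toLp 2 (star f.fst, star f.snd)
  map_add' f g :=
    (WithLp.ofLp_injective 2) (Prod.ext (lp_star_add f.fst g.fst) (lp_star_add f.snd g.snd))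
  map_smul' c f :=
    (WithLp.ofLp_injective 2) (Prod.ext (lp_star_smul c f.fst) (lp_star_smul c f.snd))

lemma norm_conjLin_le (f : HSpace Ω β) : ‖conjLin Ω β f‖ ≤ 1 * ‖f‖ := by
  have h1 : ‖(conjLin Ω β f).fst‖ = ‖f.fst‖ := by
    have h : (conjLin Ω β f).fst = star f.fst := rfl
    rw [h, lp_norm_star]
  have h2 : ‖(conjLin Ω β f).snd‖ = ‖f.snd‖ := by
    have h : (conjLin Ω β f).snd = star f.snd := rfl
    rw [h, lp_norm_star]
  rw [one_mul, ← sq_le_sq₀ (norm_nonneg _) (norm_nonneg _), WithLp.prod_norm_sq_eq_of_L2,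
    WithLp.prod_norm_sq_eq_of_L2, h1, h2]

/-- Complex conjugation on `ℋ`. -/
def conjH (Ω : Set (Sp d)) (β : Sp d → ℝ) : HSpace Ω β →L⋆[ℂ] HSpace Ω β :=
  (conjLin Ω β).mkContinuous 1 norm_conjLin_le

lemma conjH_conjH (f : HSpace Ω β) : conjH Ω β (conjH Ω β f) = f :=
  (WithLp.ofLp_injective 2) (Prod.ext (star_star f.fst) (star_star f.snd))

lemma coeFn_fst_conjH (f : HSpace Ω β) : (conjH Ω β f).fst =ᵐ[vol Ω] star f.fst :=
  Lp.coeFn_star _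

lemma coeFn_snd_conjH (f : HSpace Ω β) : (conjH Ω β f).snd =ᵐ[wsurf Ω β] star f.snd :=
  Lp.coeFn_star _

lemma isRealElt_iff {f : HSpace Ω β} : IsRealElt f ↔ conjH Ω β f = f := by
  constructor
  · rintro ⟨h1, h2⟩
    refine (WithLp.ofLp_injective 2) (Prod.ext (Lp.ext ?_) (Lp.ext ?_))
    · refine (coeFn_fst_conjH f).trans ?_
      filter_upwards [h1] with x hx
      exact Complex.conj_eq_iff_im.2 hx
    · refine (coeFn_snd_conjH f).trans ?_
      filter_upwards [h2] with x hx
      exact Complex.conj_eq_iff_im.2 hx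
  · intro h
    have h1 := coeFn_fst_conjH f
    have h2 := coeFn_snd_conjH f
    rw [h] at h1 h2
    constructor
    · filter_upwards [h1] with x hx
      exact Complex.conj_eq_iff_im.1 hx.symm
    · filter_upwards [h2] with x hx
      exact Complex.conj_eq_iff_im.1 hx.symm

lemma inner_conjH (f g : HSpace Ω β) :
    ⟪conjH Ω β f, conjH Ω β g⟫_ℂ = starRingEnd ℂ ⟪f, g⟫_ℂ := by
  have h : ∀ {μ : Measure (Sp d)} (a b : Lp ℂ 2 μ),
      ⟪star a, star b⟫_ℂ = starRingEnd ℂ ⟪a, b⟫_ℂ := by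
    intro μ a b
    rw [inner_eq_integral (Lp.coeFn_star a) (Lp.coeFn_star b),
      inner_eq_integral EventuallyEq.rfl EventuallyEq.rfl, ← integral_conj]
    simp
  have h1 : ⟪conjH Ω β f, conjH Ω β g⟫_ℂ =
      ⟪star f.fst, star g.fst⟫_ℂ + ⟪star f.snd, star g.snd⟫_ℂ :=
    rfl
  have h2 : ⟪f, g⟫_ℂ = ⟪f.fst, g.fst⟫_ℂ + ⟪f.snd, g.snd⟫_ℂ := rfl
  rw [h1, h2, h, h, map_add]

namespace FormData

variable (D : FormData Ω Q α β γ δ)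

include D in
lemma inFormDomain_conjH {p : HSpace Ω β} {w : Sp d → ℂ} (h : InFormDomain Ω Q β δ p w) :
    InFormDomain Ω Q β δ (conjH Ω β p) (star w) :=
  ⟨h.1.star.congr (coeFn_fst_conjH p).symm EventuallyEq.rfl,
    h.2.star.congr (coeFn_fst_conjH p).symm (D.surf_ac.ae_eq (coeFn_snd_conjH p).symm)⟩

include D in
/-- The operator `𝒜` has real coefficients. -/
lemma isA_conjH {u f : HSpace Ω β} (h : IsA Ω Q α β γ δ u f) :
    IsA Ω Q α β γ δ (conjH Ω β u) (conjH Ω β f) := by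
  obtain ⟨w, hw, h⟩ := h
  refine ⟨star w, D.inFormDomain_conjH hw, fun v z hv => ?_⟩
  have h1 := congrArg (starRingEnd ℂ) (h _ _ (D.inFormDomain_conjH hv))
  rw [← inner_conjH, conjH_conjH] at h1
  rw [← h1]
  simp only [primForm, map_add, ← integral_conj]
  congr 1
  · simp
  · refine integral_congr_ae ?_
    filter_upwards [coeFn_snd_conjH u, coeFn_snd_conjH v] with x h2 h3
    rw [h2, h3]
    simp

/-! ### Positivity and contractivity -/

/-- If the semigroup leaves a set `S` invariant, then the projection onto `S` maps the form
domain to itself. Hence the projection `q` of a smooth function `u` cannot be such that `2 q - u`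
has a kink. -/
lemma kink_eq_zero_of_invariant {R : HSpace Ω β →L[ℂ] HSpace Ω β} (hR : IsResolvent R)
    (hform : ∀ p, IsFormBounded R p ↔ ∃ k, D.formEmb k = p) {S : Set (HSpace Ω β)}
    (hS : ∀ t, ∀ f ∈ S, heatSemigroup R t f ∈ S) {u q : Sp d → ℝ} (hu : ContDiff ℝ ∞ u)
    (hc : HasCompactSupport u) (hs : tsupport u ⊆ Ω) (hq : Continuous q)
    (hqS : ∀ p : HSpace Ω β, p.fst =ᵐ[vol Ω] (fun x => (q x : ℂ)) → p.snd = 0 → p ∈ S)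
    (hproj : ∀ f ∈ S, ∀ᵐ x ∂vol Ω, (u x - q x) * ((f.fst x).re - q x) ≤ 0)
    {x : Sp d} {i : Fin d} {ρ c b : ℝ} (hρ : 0 < ρ) (hball : Metric.ball x ρ ⊆ Ω)
    (h : ∀ y ∈ Metric.ball x ρ, 2 * q y - u y = c + b * |y i - x i|) : b = 0 := by
  obtain ⟨k, hk1, hk2, -⟩ := D.exists_formSpace_of_contDiff hu hc hs
  have hq2 : MemLp (fun x => (q x : ℂ)) 2 (vol Ω) := memLp_ofReal (memLp_vol D.domain hq 2)
  set p : HSpace Ω β := WithLp.toLp 2 (hq2.toLp, 0) with hp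
  have hp1 : p.fst =ᵐ[vol Ω] fun x => (q x : ℂ) := hq2.coeFn_toLp
  have hu1 : (D.formEmb k).fst =ᵐ[vol Ω] fun x => (u x : ℂ) := hk1
  have hu2 : (D.formEmb k).snd = 0 := by
    change lpOfMeasureLE D.wsurf_le (sobTrace Ω (D.formFun k)) = 0
    rw [hk2, map_zero]
  have hpf : IsFormBounded R p := by
    refine hR.isFormBounded_of_invariant hS (hqS p hp1 rfl) (fun f hf => ?_)
      ((hform _).2 ⟨k, rfl⟩)
    have h1 : ⟪f - p, D.formEmb k - p⟫_ℂ =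
        ⟪f.fst - p.fst, (D.formEmb k).fst - p.fst⟫_ℂ +
          ⟪f.snd - p.snd, (D.formEmb k).snd - p.snd⟫_ℂ :=
      rfl
    have h2 : (D.formEmb k).snd - p.snd = 0 := by
      rw [hu2]
      exact sub_zero _
    rw [h1, h2, inner_zero_right, add_zero, L2.inner_def]
    have h3 : (∫ x, ⟪(f.fst - p.fst) x, ((D.formEmb k).fst - p.fst) x⟫_ℂ ∂vol Ω).re =
        ∫ x, (⟪(f.fst - p.fst) x, ((D.formEmb k).fst - p.fst) x⟫_ℂ).re ∂vol Ω :=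
      (integral_re (L2.integrable_inner (𝕜 := ℂ) _ _)).symm
    rw [h3]
    refine integral_nonpos_of_ae ?_
    filter_upwards [hproj f hf, hp1, hu1, Lp.coeFn_sub f.fst p.fst,
      Lp.coeFn_sub (D.formEmb k).fst p.fst] with x e1 e2 e3 e4 e5
    rw [e4, e5, Pi.sub_apply, Pi.sub_apply, e2, e3, RCLike.inner_apply]
    simpa using e1
  obtain ⟨l, hl⟩ := (hform p).1 hpf
  have hl1 : sobFun Ω (D.formFun l) =ᵐ[vol Ω] fun x => (q x : ℂ) := by
    have h1 : sobFun Ω (D.formFun l) = p.fst := congrArg WithLp.fst hl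
    rw [h1]
    exact hp1
  -- The form domain is a vector space, so it contains `2 q - u`.
  refine D.kink_eq_zero ((2 : ℂ) • l - k) hρ hball (c := c) (b := b) (i := i) ?_
  rw [map_sub, map_sub, map_smul, map_smul]
  filter_upwards [hk1, hl1,
    Lp.coeFn_sub ((2 : ℂ) • sobFun Ω (D.formFun l)) (sobFun Ω (D.formFun k)),
    Lp.coeFn_smul (2 : ℂ) (sobFun Ω (D.formFun l))] with y e1 e2 e3 e4 hy
  rw [← h y hy, e3, Pi.sub_apply, e4, Pi.smul_apply, e1, e2]
  push_cast
  rfl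

include D in
/-- A cut-off function at a point of the domain, with support of radius less than one. -/
lemma exists_bump : ∃ (x : Sp d) (χ : ContDiffBump x), χ.rOut < 1 ∧ tsupport χ ⊆ Ω := by
  obtain ⟨x, hx⟩ := D.domain.isConnected.nonempty
  obtain ⟨r, hr, hball⟩ := Metric.isOpen_iff.1 D.domain.isOpen x hx
  have hm : 0 < min r 1 := lt_min hr one_pos
  refine ⟨x, ⟨min r 1 / 4, min r 1 / 2, by positivity, by linarith⟩, ?_, ?_⟩
  · have := min_le_right r 1
    change min r 1 / 2 < 1
    linarith
  · rw [ContDiffBump.tsupport_eq]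
    refine (Metric.closedBall_subset_ball ?_).trans hball
    have := min_le_left r 1
    change min r 1 / 2 < r
    linarith

/-- The semigroup is not positive: the positive part of a smooth function with a simple zero is not
in the form domain. -/
lemma not_isPositiveSemigroup (hd : 1 ≤ d) {R : HSpace Ω β →L[ℂ] HSpace Ω β} (hR : IsResolvent R)
    (hform : ∀ p, IsFormBounded R p ↔ ∃ k, D.formEmb k = p) :
    ¬ IsPositiveSemigroup (heatSemigroup R) := by
  intro hpos
  obtain ⟨x, χ, -, hχ⟩ := D.exists_bump
  let i : Fin d := ⟨0, hd⟩
  have hℓ : ContDiff ℝ ∞ fun y : Sp d => y i - x i :=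
    (EuclideanSpace.proj (𝕜 := ℝ) i).contDiff.sub contDiff_const
  have hu : ContDiff ℝ ∞ fun y => χ y * (y i - x i) := χ.contDiff.mul hℓ
  -- Near `x`, the function `u` is `y i - x i`, so that `2 max(u, 0) - u = |y i - x i|`.
  refine one_ne_zero (α := ℝ) (D.kink_eq_zero_of_invariant hR hform (S := {f | IsNonnegElt f})
    (u := fun y => χ y * (y i - x i)) (q := fun y => max (χ y * (y i - x i)) 0)
    (fun t f hf => hpos t f hf) hu χ.hasCompactSupport.mul_right
    (tsupport_mul_subset_left.trans hχ) (hu.continuous.max continuous_const) ?_ ?_ (x := x) (i := i)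
    (c := 0) χ.rIn_pos ?_ ?_)
  · intro p hp1 hp2
    constructor
    · filter_upwards [hp1] with y hy
      rw [hy]
      exact ⟨Complex.ofReal_im _, le_max_right _ _⟩
    · rw [hp2]
      filter_upwards [Lp.coeFn_zero ℂ 2 (wsurf Ω β)] with y hy
      rw [hy]
      simp
  · rintro f ⟨hf, -⟩
    filter_upwards [hf] with y hy
    rcases le_total (χ y * (y i - x i)) 0 with h | h
    · rw [max_eq_right h, sub_zero, sub_zero]
      exact mul_nonpos_of_nonpos_of_nonneg h hy.2
    · rw [max_eq_left h, sub_self, zero_mul]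
  · refine Metric.ball_subset_closedBall.trans fun y hy => hχ (subset_tsupport _ ?_)
    rw [Function.mem_support, χ.one_of_mem_closedBall hy]
    exact one_ne_zero
  · intro y hy
    rw [χ.one_of_mem_closedBall (Metric.ball_subset_closedBall hy)]
    rcases le_total (y i - x i) 0 with h | h
    · rw [abs_of_nonpos h, one_mul, max_eq_right h]
      ring
    · rw [abs_of_nonneg h, one_mul, max_eq_left h]
      ring

/-- The semigroup is not `L^∞`-contractive: the minimum of a smooth function `u` and `1` is not in
the form domain if `u - 1` has a simple zero. -/
lemma not_isLinfContractive (hd : 1 ≤ d) {R : HSpace Ω β →L[ℂ] HSpace Ω β} (hR : IsResolvent R)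
    (hform : ∀ p, IsFormBounded R p ↔ ∃ k, D.formEmb k = p) :
    ¬ IsLinfContractive (heatSemigroup R) := by
  intro hcon
  obtain ⟨x, χ, hχ1, hχ⟩ := D.exists_bump
  let i : Fin d := ⟨0, hd⟩
  have hℓ : ContDiff ℝ ∞ fun y : Sp d => 1 + (y i - x i) :=
    contDiff_const.add ((EuclideanSpace.proj (𝕜 := ℝ) i).contDiff.sub contDiff_const)
  have hu : ContDiff ℝ ∞ fun y => χ y * (1 + (y i - x i)) := χ.contDiff.mul hℓ
  -- The support of `χ` is so small that `u` is nonnegative and its projection is `min u 1`.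
  have hu0 : ∀ y, 0 ≤ χ y * (1 + (y i - x i)) := by
    intro y
    by_cases hy : y ∈ Metric.ball x χ.rOut
    · have h1 : |y i - x i| ≤ dist y x := by
        rw [dist_eq_norm]
        exact PiLp.norm_apply_le (y - x) i
      have h2 : |y i - x i| < 1 := h1.trans_lt ((Metric.mem_ball.1 hy).trans hχ1)
      exact mul_nonneg χ.nonneg (by linarith [neg_abs_le (y i - x i)])
    · rw [χ.zero_of_le_dist (not_lt.1 hy), zero_mul]
  -- Near `x`, the function `u` is `1 + (y i - x i)`, so that `2 min(u, 1) - u = 1 - |y i - x i|`.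
  refine neg_ne_zero.2 (one_ne_zero (α := ℝ)) (D.kink_eq_zero_of_invariant hR hform
    (S := {f | linfNorm f ≤ 1}) (u := fun y => χ y * (1 + (y i - x i)))
    (q := fun y => min (χ y * (1 + (y i - x i))) 1)
    (fun t f hf => (hcon t f).trans hf) hu χ.hasCompactSupport.mul_right
    (tsupport_mul_subset_left.trans hχ) (hu.continuous.min continuous_const) ?_ ?_ (x := x) (i := i)
    (c := 1) χ.rIn_pos ?_ ?_)
  · intro p hp1 hp2
    change max (eLpNorm p.fst ∞ (vol Ω)) (eLpNorm p.snd ∞ (wsurf Ω β)) ≤ 1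
    refine max_le ?_ ?_
    · rw [eLpNorm_exponent_top]
      refine essSup_le_of_ae_le _ ?_
      filter_upwards [hp1] with y hy
      rw [hy, ← ofReal_norm, Complex.norm_real, Real.norm_eq_abs,
        abs_of_nonneg (le_min (hu0 y) zero_le_one)]
      exact ENNReal.ofReal_le_one.2 (min_le_right _ _)
    · rw [hp2, eLpNorm_congr_ae (Lp.coeFn_zero ℂ 2 (wsurf Ω β)), eLpNorm_zero]
      exact bot_le
  · intro f hf
    have h1 : eLpNormEssSup f.fst (vol Ω) ≤ 1 := by
      rw [← eLpNorm_exponent_top]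
      exact (le_max_left _ _).trans hf
    filter_upwards [ae_le_eLpNormEssSup (f := f.fst) (μ := vol Ω)] with y hy
    have h2 : ‖f.fst y‖ ≤ 1 := by
      have h3 := hy.trans h1
      rwa [← ofReal_norm, ENNReal.ofReal_le_one] at h3
    have h3 := (Complex.re_le_norm _).trans h2
    rcases le_total (χ y * (1 + (y i - x i))) 1 with h | h
    · rw [min_eq_left h, sub_self, zero_mul]
    · rw [min_eq_right h]
      exact mul_nonpos_of_nonneg_of_nonpos (sub_nonneg.2 h) (sub_nonpos.2 h3)
  · refine Metric.ball_subset_closedBall.trans fun y hy => hχ (subset_tsupport _ ?_)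
    rw [Function.mem_support, χ.one_of_mem_closedBall hy]
    exact one_ne_zero
  · intro y hy
    rw [χ.one_of_mem_closedBall (Metric.ball_subset_closedBall hy)]
    rcases le_total (y i - x i) 0 with h | h
    · rw [abs_of_nonpos h, one_mul, min_eq_left (by linarith)]
      ring
    · rw [abs_of_nonneg h, one_mul, min_eq_right (by linarith)]
      ring

end FormData

end

end Wentzell

theorem mainTheorem12 {d : ℕ} (hd : 1 ≤ d) (Ω : Set (Wentzell.Sp d))
    (hΩ : Wentzell.IsBoundedLipschitzDomain Ω)
    (Q : Wentzell.Sp d → Matrix (Fin d) (Fin d) ℝ) (hQ : Wentzell.IsEllipticCoeff Ω Q)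
    (α β γ δ : Wentzell.Sp d → ℝ) (hcoeff : Wentzell.IsAdmissibleCoeff Ω α β γ δ)
    (hγ : ∀ᵐ x ∂Wentzell.surf Ω, 0 ≤ γ x) :
    (∃! T : ℝ≥0 → Wentzell.HSpace Ω β →L[ℂ] Wentzell.HSpace Ω β,
      Wentzell.IsGeneratedByNegA Ω Q α β γ δ T) ∧
    ∀ T : ℝ≥0 → Wentzell.HSpace Ω β →L[ℂ] Wentzell.HSpace Ω β,
      Wentzell.IsGeneratedByNegA Ω Q α β γ δ T →
        Wentzell.IsRealSemigroup T ∧ ¬ Wentzell.IsPositiveSemigroup T ∧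
          ¬ Wentzell.IsLinfContractive T := by
  have D := Wentzell.formData_of_isAdmissibleCoeff hΩ hQ hcoeff hγ
  obtain ⟨R, hR, hA, hform⟩ := D.exists_isResolvent
  have hgen : ∀ T, Wentzell.IsGeneratedByNegA Ω Q α β γ δ T ↔
      Wentzell.IsGeneratedBy T fun u f => u = R (u - f) := fun T => by
    have h : (fun u f => Wentzell.IsA Ω Q α β γ δ u (-f)) = fun u f => u = R (u - f) :=
      funext₂ fun u f => propext (hA u f)
    rw [Wentzell.IsGeneratedByNegA, h]
  refine ⟨by simpa only [hgen] using hR.existsUnique_isGeneratedBy, fun T hT => ?_⟩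
  rw [hR.eq_heatSemigroup ((hgen T).1 hT)]
  refine ⟨fun t f hf => ?_, D.not_isPositiveSemigroup hd hR hform,
    D.not_isLinfContractive hd hR hform⟩
  have hRJ : ∀ f, R (Wentzell.conjH Ω β f) = Wentzell.conjH Ω β (R f) := fun f => by
    have h1 := D.isA_conjH ((hA (R f) (R f - f)).2 (by rw [sub_sub_cancel]))
    rw [map_neg, hA, ← map_sub, sub_sub_cancel] at h1
    exact h1.symm
  rw [Wentzell.isRealElt_iff] at hf ⊢
  rw [← hR.heatSemigroup_conj Wentzell.conjH_conjH hRJ, hf]
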